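/- Let $h>1$. In the sector with an even number of fermions, the Jordan–Wigner transformation turns the periodic transverse-field Ising chain $-\sum_{i=1}^N\sigma^x_i\sigma^x_{i+1}+\sum_{i=1}^N h_i\sigma^z_i$ into (up to a constant) the free-fermion Hamiltonian $$-\sum_{i=1}^N\bigl(c_i^\dagger c_{i+1}+c_i^\dagger c_{i+1}^\dagger+\mathrm{h.c.}-2h_ic_i^\dagger c_i\bigr)=\Psi^\dagger\mathcal H(\{h_i\})\Psi,\qquad c_{N+1}=-c_1,\quad \Psi=(c,c^\dagger)^T,$$ with a Hermitian $2N\times 2N$ matrix $\mathcal H(\{h_i\})$. Let $\mathcal H_0$ be this matrix for $h_i=0$ (its ground state is the initial, ferromagnetic state) and $\mathcal H_1$ the one for $h_i=h$. A perturbation is a Hermitian matrix $V=\begin{pmatrix}V_1&V_2\\-V_2^*&-V_1^*\end{pmatrix}$ ($^*$ is entrywise complex conjugation); field disorder $\sum_i\delta_i\sigma^z_i$ is $V=\mathrm{diag}(\delta,-\delta)$, whose operator norm is $\max_i|\delta_i|$. A diagonalization of $\mathcal H$ is a unitary $U=\begin{pmatrix}u&v\\v^*&u^*\end{pmatrix}$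 with $U\mathcal HU^{-1}=\tfrac12\mathrm{diag}(E,-E)$ and quasiparticle energies $E_1\ge E_2\ge\dots\ge E_N>0$ (the lowest energies have the largest indices); the quasiparticle operators are $(\eta,\eta^\dagger)^T=U\Psi$. For diagonalizations $U_0$ of $\mathcal H_0$ and $U$ of $\mathcal H_1$ write $U_0U^{-1}=\begin{pmatrix}W_1&W_2\\W_2^*&W_1^*\end{pmatrix}$. The BCS (Thouless) pairing matrix is $G=-W_1^{-1}W_2$; $\tilde G$ is defined in the same way from a diagonalization $\tilde U$ of $\mathcal H_1+V$, with energies $\tilde E_\alpha$. **Theorem.** Let $c>0$. There are a constant $C$, a sequence $r_N\to0$ and a function $K:(0,\infty)\to\mathbb N$, all depending only on $h$ and $c$, such that for all sufficiently large $N$ and every perturbation $V$ with $\|V\|/\|\mathcal H_1\|\le c\,N^{-3}$ (operator norms) the following holds. Diagonalizations of $\mathcal H_0$ and $\mathcal H_1+V$ exist, and for every diagonalization $\tilde U$ of $\mathcal H_1+V$ there is a diagonalization $U$ of $\mathcal H_1$ (the spectrum of $\mathcal H_1$ is degenerate, so its quasiparticle basis has to be adapted to $V$) with $\|\tilde UU^{-1}-1\|\le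 r_N$ such that, for every diagonalization $U_0$ of $\mathcal H_0$: 1. $|\tilde E_\alpha-E_\alpha|\le r_N$ for all $\alpha$. 2. For both $U$ and $\tilde U$ the block $W_1$ is invertible, the matrices $G,\tilde G$ are antisymmetric, and $|\mathrm{vac}\rangle_{\eta^0}\propto\exp\bigl(\tfrac12\sum_{\alpha\beta}G_{\alpha\beta}\eta^\dagger_\alpha\eta^\dagger_\beta\bigr)|\mathrm{vac}\rangle_\eta$ in the fermionic Fock space, and likewise with tildes. With $\Delta G=\tilde G-G$: * $|(\Delta G-(a_1G-Ga_1^*))_{\alpha\beta}|\le r_N$ for all $\alpha,\beta$, where $(a_1)_{\alpha\beta}=2V_{\alpha\beta}/(E_\alpha-E_\beta)$ if $E_\alpha\ne E_\beta$ and $(a_1)_{\alpha\beta}=0$ otherwise, and $V_{\alpha\beta}$ is the upper left block of $UVU^{-1}$; * entries that were already nonzero change by a vanishing amount: $|\Delta G_{\alpha\beta}|\le r_N$ whenever $G_{\alpha\beta}\neq0$; * all changes, in particular all new entries, are at most of order one: $|\Delta G_{\alpha\beta}|\le C$ for all $\alpha,\beta$; * changes of order one occur only in the lowest-energy block: if $\varepsilon>0$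 and $|\Delta G_{\alpha\beta}|\ge\varepsilon$, then $E_\alpha-E_{\min}$ and $E_\beta-E_{\min}$ are at most $K(\varepsilon)N^{-2}$ (with $E_{\min}=\min_\gamma E_\gamma$), and $\alpha,\beta> N-K(\varepsilon)$. Moreover, new entries of order one do occur: there is $\kappa>0$ depending only on $h$ such that for all $0<c_1\le c_2$, all sufficiently large $N$ (depending on $h,c_1,c_2$) and all $D\in[c_1N^{-3},c_2N^{-3}]$, for the field perturbation $\delta_j=D\cos(2\pi j/N)$, $j=0,\dots,N-1$, and for any diagonalizations of $\mathcal H_0$, $\mathcal H_1$ and $\mathcal H_1+V$, there are $\alpha\in\{N-1,N\}$ and $\beta\in\{N-3,\dots,N\}$ with $G_{\alpha\beta}=0$ and $|\tilde G_{\alpha\beta}|\ge\kappa DN^3$. -/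

import Mathlib

open Filter Topology
open scoped Matrix Matrix.Norms.L2Operator

noncomputable section

namespace IsingQuench

/-- Indices of the Nambu vector `Ψ = (c₁, …, c_N, c₁†, …, c_N†)`. -/
abbrev Nambu (N : ℕ) : Type := Fin N ⊕ Fin N

/-- Entrywise complex conjugate `A*` (not the adjoint). -/
def conjMat {m n : Type*} (A : Matrix m n ℂ) : Matrix m n ℂ := A.map star

/-- The matrix `S` of the map `c_i ↦ c_{i+1}`, with `c_{N+1} = -c₁`: in the sector with an even
number of fermions the periodic spin chain becomes an antiperiodic fermion chain. -/
def antiperiodicShift (N : ℕ) : Matrix (Fin N) (Fin N) ℂ :=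
  Matrix.of fun i j =>
    if i.val + 1 = j.val then 1 else if i.val + 1 = N ∧ j.val = 0 then -1 else 0

/-- One-particle matrix `𝓗` of the transverse-field Ising chain
`-∑ σˣᵢ σˣᵢ₊₁ + ∑ hᵢ σᶻᵢ` in the even sector, after the Jordan-Wigner transformation: up to an
additive constant,
`-∑ᵢ (c†ᵢ cᵢ₊₁ + c†ᵢ c†ᵢ₊₁ + h.c. - 2 hᵢ c†ᵢ cᵢ) = Ψ† 𝓗 Ψ`. -/
def isingMatrix {N : ℕ} (h : Fin N → ℝ) : Matrix (Nambu N) (Nambu N) ℂ :=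
  let S := antiperiodicShift N
  let A := Matrix.diagonal (fun i => 2 * (h i : ℂ)) - (S + Sᵀ)
  let B := -(S - Sᵀ)
  (1 / 2 : ℂ) • Matrix.fromBlocks A B (-B) (-A)

/-- One-particle matrices `V` of perturbations `Ψ† V Ψ`: Hermitian, of the form
`[[V₁, V₂], [-V₂*, -V₁*]]`. -/
def IsPerturbation {N : ℕ} (V : Matrix (Nambu N) (Nambu N) ℂ) : Prop :=
  V.IsHermitian ∧ ∃ V₁ V₂ : Matrix (Fin N) (Fin N) ℂ,
    V = Matrix.fromBlocks V₁ V₂ (-conjMat V₂) (-conjMat V₁)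

/-- The perturbation `∑ δᵢ σᶻᵢ` of the transverse field: since `σᶻᵢ = c†ᵢ cᵢ - cᵢ c†ᵢ`, it is
`Ψ† diag(δ, -δ) Ψ`. -/
def fieldPerturbation {N : ℕ} (δ : Fin N → ℝ) : Matrix (Nambu N) (Nambu N) ℂ :=
  Matrix.diagonal (Sum.elim (fun i => (δ i : ℂ)) (fun i => -(δ i : ℂ)))

/-- `(η, η†) = U (c, c†)` is a Bogoliubov transformation (unitary, of the form
`[[u, v], [v*, u*]]`) that brings `Ψ† 𝓗 Ψ` to `½ ∑ E_α (η†_α η_α - η_α η†_α)`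
with positive quasiparticle energies, in energy order: `E` does not increase with the index. -/
structure Diagonalizes {N : ℕ} (H : Matrix (Nambu N) (Nambu N) ℂ) (E : Fin N → ℝ)
    (U : Matrix (Nambu N) (Nambu N) ℂ) : Prop where
  unitary : U ∈ Matrix.unitaryGroup (Nambu N) ℂ
  form : ∃ u v : Matrix (Fin N) (Fin N) ℂ, U = Matrix.fromBlocks u v (conjMat v) (conjMat u)
  pos : ∀ α, 0 < E α
  ordered : Antitone E
  diag : U * H * Uᴴ =
    (1 / 2 : ℂ) • Matrix.diagonal (Sum.elim (fun α => (E α : ℂ)) (fun α => -(E α : ℂ)))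

/-- The blocks of `U₀ U⁻¹ = [[W₁, W₂], [W₂*, W₁*]]`. -/
def blockW₁ {N : ℕ} (U₀ U : Matrix (Nambu N) (Nambu N) ℂ) : Matrix (Fin N) (Fin N) ℂ :=
  (U₀ * U⁻¹).toBlocks₁₁

/-- See `blockW₁`. -/
def blockW₂ {N : ℕ} (U₀ U : Matrix (Nambu N) (Nambu N) ℂ) : Matrix (Fin N) (Fin N) ℂ :=
  (U₀ * U⁻¹).toBlocks₁₂

/-- The BCS matrix `G = -W₁⁻¹ W₂` of the vacuum of `U₀` over the vacuum of `U`
(meaningful when `W₁` is invertible). -/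
def bcsMatrix {N : ℕ} (U₀ U : Matrix (Nambu N) (Nambu N) ℂ) : Matrix (Fin N) (Fin N) ℂ :=
  -((blockW₁ U₀ U)⁻¹ * blockW₂ U₀ U)

/-- The fermionic Fock space of `N` modes. -/
abbrev Fock (N : ℕ) : Type := ExteriorAlgebra ℂ (Fin N → ℂ)

/-- The creation operator `c†ᵢ`: exterior multiplication by the `i`-th basis vector. -/
def create {N : ℕ} (i : Fin N) : Module.End ℂ (Fock N) :=
  LinearMap.mulLeft ℂ (ExteriorAlgebra.ι ℂ (Pi.single i (1 : ℂ)))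

/-- The annihilation operator `cᵢ`: contraction with the `i`-th coordinate. -/
def annihilate {N : ℕ} (i : Fin N) : Module.End ℂ (Fock N) :=
  CliffordAlgebra.contractLeft (Q := (0 : QuadraticForm ℂ (Fin N → ℂ))) (LinearMap.proj i)

/-- The components of `(η, η†) = U (c, c†)`. -/
def quasi {N : ℕ} (U : Matrix (Nambu N) (Nambu N) ℂ) (a : Nambu N) : Module.End ℂ (Fock N) :=
  ∑ i : Fin N, (U a (Sum.inl i) • annihilate i + U a (Sum.inr i) • create i)

/-- `Ω` is a vacuum of the quasiparticles `η` of `U`. -/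
def IsVacuum {N : ℕ} (U : Matrix (Nambu N) (Nambu N) ℂ) (Ω : Fock N) : Prop :=
  Ω ≠ 0 ∧ ∀ α : Fin N, quasi U (Sum.inl α) Ω = 0

/-- The Thouless relation `|vac⟩_{η⁰} ∝ exp(½ ∑_{αβ} G_{αβ} η†_α η†_β) |vac⟩_η` with `G`
antisymmetric (so that each pair `α < β` enters once, with amplitude `G_{αβ}`). The exponent
is nilpotent, so its exponential is a finite sum. -/
def Thouless {N : ℕ} (U₀ U : Matrix (Nambu N) (Nambu N) ℂ) (G : Matrix (Fin N) (Fin N) ℂ) :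
    Prop :=
  Gᵀ = -G ∧ ∃ Ω : Fock N, IsVacuum U Ω ∧
    IsVacuum U₀ (IsNilpotent.exp ((1 / 2 : ℂ) • ∑ α : Fin N, ∑ β : Fin N,
      G α β • (quasi U (Sum.inr α) * quasi U (Sum.inr β))) Ω)

/-- The matrix `(a₁)_{αβ} = 2 (V₁)_{αβ} / (E_α - E_β)`, where `V₁` is the upper left block of the
perturbation in the quasiparticle basis `U V U⁻¹`. Only entries between different energies
occur: the entries with `E_α = E_β` (diagonal or degenerate) are zero. -/
def mixing {N : ℕ} (E : Fin N → ℝ) (U V : Matrix (Nambu N) (Nambu N) ℂ) :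
    Matrix (Fin N) (Fin N) ℂ :=
  Matrix.of fun α β =>
    if E α = E β then 0 else 2 * (U * V * U⁻¹).toBlocks₁₁ α β / ((E α - E β : ℝ) : ℂ)

end IsingQuench

end

/-! The unperturbed chain is governed by one algebraic identity. Write ℋ₁ = ℋ₀ + hZ with Z = diag(1,
-1). Since ℋ₀² = Z² = 1, the anticommutator of ℋ₀ and ℋ₁ equals ℋ₁² + 1 - h²
(`isingMatrix_anticomm`). In any eigenbasis of ℋ₁, with eigenvalues ε_a = ±E/2, this reads (ε_a +
ε_b)(Uℋ₀U†)_{ab} = δ_{ab}(ε_a² + 1 - h²). For W = U₀U⁻¹ one has Uℋ₀U† = W†ZW, so W₁†W₁ is an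
explicit positive diagonal matrix, G connects only equal energies, and GG† = diag p(ε) with p(ε) ≤
2/(ε - (h-1)). Plane waves are needed only for the spectrum ε = √(1 + h² - 2h cos k), k an odd
multiple of π/N. Distinct levels are at least of order N⁻² apart, ε - (h-1) is at least of order N⁻²
(so ‖G‖ ≤ N), and the inverse squared gaps sum to O(N⁴) (`sum_inv_gap_sq_le`).

For the perturbed chain, X = ŨU⁻¹ satisfies the exact equation (ε̃_a - ε_b)X_{ab} = (ŨVU†)_{ab}.
With ‖V‖ = O(N⁻³) the part of X₁₁ between different levels is O(N⁻¹) in Hilbert–Schmidt norm, and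
X₁₂, protected by the bulk gap, is O(N^{-5/2}). Hence the part of X₁₁ inside levels is unitary up to
O(N⁻²), and its polar factor commutes with the energies, so it can be absorbed into U
(`exists_adapted`). Then X₁₁ = 1 + a₁ + O(N⁻²). Since U₀Ũ⁻¹ = WX†, the new pairing matrix solves
(X₁₁† - GX₁₂†)G̃ = GX₁₁ᵀ - X₁₂ᵀ, whence ΔG = a₁G - Ga₁* + O(N^{-1/2}) (`norm_pairing_expansion_le`);
the worst error is GX₁₂†G.

The first-order term T vanishes inside levels. Between levels the level structure of G lets the
denominators factor out: T_{αβ} = 2(V₁G - GV₁*)_{αβ}/(E_α - E_β), so |T_{αβ}| |E_α - E_β| ≤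
2‖V‖(√p_α + √p_β). As √p ≤ N and the gap is at least 1/(2N²), T is bounded. If T is of order one,
the larger √p must be of order N and the gap of order N⁻², which puts both energies within O(N⁻²) of
the band edge.

New entries do occur because the cosine field couples the momenta π/N and 3π/N with matrix element
about D/2, while the corresponding values of p have ratio tending to 9. So V₁G and GV₁* cannot
cancel in Hilbert–Schmidt norm, in whatever basis of the degenerate levels
(`exists_large_pairingShift`). Their difference is of order DN, and division by a gap O(N⁻²) gives
DN³. -/

namespace IsingQuench

set_option linter.unusedSectionVars false

/-! ### Operator norm, entrywise conjugation and blocks of complex matrices. -/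

section LinearAlgebra

variable {m n : Type*} [Fintype m] [Fintype n] [DecidableEq m] [DecidableEq n]

theorem sum_sq_norm_col_le (A : Matrix m n ℂ) (j : n) : ∑ i, ‖A i j‖ ^ 2 ≤ ‖A‖ ^ 2 := by
  have h := Matrix.l2_opNorm_mulVec A (EuclideanSpace.single j (1 : ℂ))
  rw [PiLp.norm_single, norm_one, mul_one] at h
  have h2 := pow_le_pow_left₀ (norm_nonneg _) h 2
  rw [EuclideanSpace.norm_sq_eq] at h2
  simpa using h2

theorem sum_sq_norm_row_le (A : Matrix m n ℂ) (i : m) : ∑ j, ‖A i j‖ ^ 2 ≤ ‖A‖ ^ 2 := by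
  have h := sum_sq_norm_col_le Aᴴ i
  rw [Matrix.l2_opNorm_conjTranspose] at h
  simpa using h

theorem norm_entry_le (A : Matrix m n ℂ) (i : m) (j : n) : ‖A i j‖ ≤ ‖A‖ := by
  have h := sum_sq_norm_row_le A i
  have h2 := Finset.single_le_sum (f := fun j => ‖A i j‖ ^ 2) (fun _ _ => by positivity)
    (Finset.mem_univ j)
  exact le_of_sq_le_sq (h2.trans h) (norm_nonneg _)

theorem opNorm_le_of_mulVec {A : Matrix m n ℂ} {c : ℝ} (hc : 0 ≤ c)
    (h : ∀ x : n → ℂ, ∑ i, ‖(A *ᵥ x) i‖ ^ 2 ≤ c ^ 2 * ∑ j, ‖x j‖ ^ 2) : ‖A‖ ≤ c := by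
  rw [Matrix.l2_opNorm_def]
  refine ContinuousLinearMap.opNorm_le_bound _ hc fun x => ?_
  refine le_of_sq_le_sq ?_ (by positivity)
  rw [mul_pow, EuclideanSpace.norm_sq_eq, EuclideanSpace.norm_sq_eq]
  exact h x.ofLp

/-- Perturbation theory bounds entries one at a time; domination by the Hilbert–Schmidt norm turns
such bounds into operator norm bounds. -/
theorem sq_opNorm_le_sum (A : Matrix m n ℂ) : ‖A‖ ^ 2 ≤ ∑ i, ∑ j, ‖A i j‖ ^ 2 := by
  have h0 : 0 ≤ ∑ i, ∑ j, ‖A i j‖ ^ 2 := by positivity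
  have : ‖A‖ ≤ √(∑ i, ∑ j, ‖A i j‖ ^ 2) := by
    refine opNorm_le_of_mulVec (Real.sqrt_nonneg _) fun x => ?_
    rw [Real.sq_sqrt h0, Finset.sum_mul]
    refine Finset.sum_le_sum fun i _ => ?_
    calc ‖(A *ᵥ x) i‖ ^ 2 ≤ (∑ j, ‖A i j‖ * ‖x j‖) ^ 2 := by
          gcongr
          refine (norm_sum_le _ _).trans (le_of_eq ?_)
          simp
      _ ≤ _ := Finset.sum_mul_sq_le_sq_mul_sq _ _ _
  calc ‖A‖ ^ 2 ≤ √(∑ i, ∑ j, ‖A i j‖ ^ 2) ^ 2 := by gcongr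
    _ = _ := Real.sq_sqrt h0

theorem conjMat_apply {m n : Type*} (A : Matrix m n ℂ) (i : m) (j : n) :
    conjMat A i j = star (A i j) := rfl

theorem conjMat_mulVec (A : Matrix m n ℂ) (x : n → ℂ) :
    conjMat A *ᵥ x = star (A *ᵥ star x) := by
  ext i
  simp [Matrix.mulVec, dotProduct, conjMat_apply]

theorem norm_conjMat_le (A : Matrix m n ℂ) : ‖conjMat A‖ ≤ ‖A‖ := by
  refine opNorm_le_of_mulVec (norm_nonneg _) fun x => ?_
  have h := Matrix.l2_opNorm_mulVec A (WithLp.toLp 2 (star x))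
  have h2 := pow_le_pow_left₀ (norm_nonneg _) h 2
  rw [mul_pow, EuclideanSpace.norm_sq_eq, EuclideanSpace.norm_sq_eq] at h2
  rw [conjMat_mulVec]
  simpa using h2

theorem conjMat_conjMat {m n : Type*} (A : Matrix m n ℂ) : conjMat (conjMat A) = A := by
  ext; simp [conjMat_apply]

theorem norm_conjMat (A : Matrix m n ℂ) : ‖conjMat A‖ = ‖A‖ :=
  le_antisymm (norm_conjMat_le A) (by simpa [conjMat_conjMat] using norm_conjMat_le (conjMat A))

theorem conjMat_conjTranspose {m n : Type*} (A : Matrix m n ℂ) : conjMat Aᴴ = Aᵀ := by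
  ext; simp [conjMat_apply]

theorem conjTranspose_conjMat {m n : Type*} (A : Matrix m n ℂ) : (conjMat A)ᴴ = Aᵀ := by
  ext; simp [conjMat_apply]

theorem norm_transpose (A : Matrix m n ℂ) : ‖Aᵀ‖ = ‖A‖ := by
  rw [← conjMat_conjTranspose, norm_conjMat, Matrix.l2_opNorm_conjTranspose]

theorem conjMat_mul {l m n : Type*} [Fintype m] (A : Matrix l m ℂ) (B : Matrix m n ℂ) :
    conjMat (A * B) = conjMat A * conjMat B := by
  ext; simp [conjMat_apply, Matrix.mul_apply]

theorem conjMat_add {m n : Type*} (A B : Matrix m n ℂ) :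
    conjMat (A + B) = conjMat A + conjMat B := by
  ext; simp [conjMat_apply]

theorem conjMat_sub {m n : Type*} (A B : Matrix m n ℂ) :
    conjMat (A - B) = conjMat A - conjMat B := by
  ext; simp [conjMat_apply]

theorem conjMat_neg {m n : Type*} (A : Matrix m n ℂ) : conjMat (-A) = -conjMat A := by
  ext; simp [conjMat_apply]

theorem conjMat_one : conjMat (1 : Matrix n n ℂ) = 1 := by
  ext i j; simp [conjMat_apply, Matrix.one_apply, apply_ite]

theorem conjMat_smul_real {m n : Type*} (r : ℝ) (A : Matrix m n ℂ) :
    conjMat ((r : ℂ) • A) = (r : ℂ) • conjMat A := by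
  ext; simp [conjMat_apply]

theorem conjMat_diagonal_real (d : n → ℝ) :
    conjMat (Matrix.diagonal fun i => (d i : ℂ)) = Matrix.diagonal fun i => (d i : ℂ) := by
  ext i j; by_cases h : i = j <;> simp [conjMat_apply, h]

theorem norm_le_one_of_conjTranspose_mul_self {A : Matrix m n ℂ} (h : Aᴴ * A = 1) : ‖A‖ ≤ 1 := by
  have h1 := Matrix.l2_opNorm_conjTranspose_mul_self A
  have h2 : ‖(1 : Matrix n n ℂ)‖ ≤ 1 := by
    rw [← Matrix.diagonal_one, Matrix.l2_opNorm_diagonal, pi_norm_le_iff_of_nonneg zero_le_one]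
    simp
  rw [h] at h1
  nlinarith [norm_nonneg A]

/-- The isometric inclusion of the first summand. -/
def inlMat (m n : Type*) [DecidableEq m] : Matrix (m ⊕ n) m ℂ := Matrix.fromRows 1 0

/-- The isometric inclusion of the second summand. -/
def inrMat (m n : Type*) [DecidableEq n] : Matrix (m ⊕ n) n ℂ := Matrix.fromRows 0 1

theorem norm_inlMat_le : ‖inlMat m n‖ ≤ 1 :=
  norm_le_one_of_conjTranspose_mul_self (by
    simp [inlMat, Matrix.conjTranspose_fromRows_eq_fromCols_conjTranspose,
      Matrix.fromCols_mul_fromRows])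

theorem norm_inrMat_le : ‖inrMat m n‖ ≤ 1 :=
  norm_le_one_of_conjTranspose_mul_self (by
    simp [inrMat, Matrix.conjTranspose_fromRows_eq_fromCols_conjTranspose,
      Matrix.fromCols_mul_fromRows])

theorem norm_mul_mul_le {k l : Type*} [Fintype k] [Fintype l] [DecidableEq k] [DecidableEq l]
    {A : Matrix k m ℂ} {C : Matrix n l ℂ}
    (hA : ‖A‖ ≤ 1) (hC : ‖C‖ ≤ 1) (B : Matrix m n ℂ) : ‖A * B * C‖ ≤ ‖B‖ := by
  calc ‖A * B * C‖ ≤ ‖A‖ * ‖B‖ * ‖C‖ :=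
        (Matrix.l2_opNorm_mul _ _).trans (by gcongr; exact Matrix.l2_opNorm_mul _ _)
    _ ≤ 1 * ‖B‖ * 1 := by gcongr
    _ = ‖B‖ := by ring

theorem norm_fromBlocks_le (A : Matrix m m ℂ) (B : Matrix m n ℂ) (C : Matrix n m ℂ)
    (D : Matrix n n ℂ) : ‖Matrix.fromBlocks A B C D‖ ≤ ‖A‖ + ‖B‖ + ‖C‖ + ‖D‖ := by
  have h : Matrix.fromBlocks A B C D = inlMat m n * A * (inlMat m n)ᴴ
      + inlMat m n * B * (inrMat m n)ᴴ + inrMat m n * C * (inlMat m n)ᴴ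
      + inrMat m n * D * (inrMat m n)ᴴ := by
    ext (i | i) (j | j) <;> simp [inlMat, inrMat, Matrix.fromRows_mul,
      Matrix.conjTranspose_fromRows_eq_fromCols_conjTranspose, Matrix.mul_fromCols]
  have hl : ‖(inlMat m n)ᴴ‖ ≤ 1 := by rw [Matrix.l2_opNorm_conjTranspose]; exact norm_inlMat_le
  have hr : ‖(inrMat m n)ᴴ‖ ≤ 1 := by rw [Matrix.l2_opNorm_conjTranspose]; exact norm_inrMat_le
  rw [h]
  refine (norm_add_le _ _).trans (add_le_add ((norm_add_le _ _).trans (add_le_add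
    ((norm_add_le _ _).trans (add_le_add ?_ ?_)) ?_)) ?_)
  · exact norm_mul_mul_le norm_inlMat_le hl _
  · exact norm_mul_mul_le norm_inlMat_le hr _
  · exact norm_mul_mul_le norm_inrMat_le hl _
  · exact norm_mul_mul_le norm_inrMat_le hr _

theorem norm_toBlocks₁₁_le (A : Matrix (m ⊕ n) (m ⊕ n) ℂ) : ‖A.toBlocks₁₁‖ ≤ ‖A‖ := by
  have h : A.toBlocks₁₁ = (inlMat m n)ᴴ * A * inlMat m n := by
    conv_rhs => rw [← Matrix.fromBlocks_toBlocks A]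
    ext i j
    simp [inlMat, Matrix.conjTranspose_fromRows_eq_fromCols_conjTranspose,
      Matrix.fromCols_mul_fromBlocks, Matrix.fromCols_mul_fromRows]
  rw [h]
  exact norm_mul_mul_le (by rw [Matrix.l2_opNorm_conjTranspose]; exact norm_inlMat_le)
    norm_inlMat_le _

theorem norm_le_one_of_mem_unitary {U : Matrix n n ℂ} (h : U ∈ Matrix.unitaryGroup n ℂ) :
    ‖U‖ ≤ 1 :=
  norm_le_one_of_conjTranspose_mul_self (Matrix.mem_unitaryGroup_iff'.1 h)

theorem norm_conj_unitary_le {U : Matrix n n ℂ} (h : U ∈ Matrix.unitaryGroup n ℂ)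
    (V : Matrix n n ℂ) : ‖U * V * Uᴴ‖ ≤ ‖V‖ :=
  norm_mul_mul_le (norm_le_one_of_mem_unitary h)
    (by rw [Matrix.l2_opNorm_conjTranspose]; exact norm_le_one_of_mem_unitary h) _

theorem inv_eq_conjTranspose {U : Matrix n n ℂ} (h : U ∈ Matrix.unitaryGroup n ℂ) :
    U⁻¹ = Uᴴ :=
  Matrix.inv_eq_right_inv (Matrix.mem_unitaryGroup_iff.1 h)

end LinearAlgebra

/-! ### Exponentials of nilpotent elements and commutators. -/

section Exponential

variable {A : Type*} [Ring A] [Module ℚ A] [IsScalarTower ℚ A A] [SMulCommClass ℚ A A]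

/-- The commutator of b with aⁿ⁺¹ is (n+1)aⁿc because c commutes with a; summing the series gives
the shift b ↦ b + c. It is applied with a the pairing exponent and b a quasiparticle operator. -/
theorem mul_exp_of_commutator {a b c : A} (ha : IsNilpotent a) (h : b * a = a * b + c)
    (hc : Commute c a) : b * IsNilpotent.exp a = IsNilpotent.exp a * (b + c) := by
  have hpow : ∀ n : ℕ, b * a ^ (n + 1) = a ^ (n + 1) * b + (n + 1 : ℕ) • (a ^ n * c) := by
    intro n
    induction n with
    | zero => simpa using h
    | succ n ih =>
      have hc' : a ^ n * c * a = a ^ (n + 1) * c := by rw [mul_assoc, hc.eq, ← mul_assoc, pow_succ]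
      rw [pow_succ, ← mul_assoc, ih, add_mul, mul_assoc, h, mul_add, ← mul_assoc, ← pow_succ,
        smul_mul_assoc, hc', add_assoc, add_smul (n + 1) 1, one_smul, add_comm (a ^ (n + 1) * c)]
  obtain ⟨k, hk⟩ := ha
  have hk1 : a ^ (k + 1) = 0 := by rw [pow_succ, hk, zero_mul]
  have hk2 : a ^ (k + 2) = 0 := by rw [pow_succ, hk1, zero_mul]
  -- The copies of the exponential that multiply b are cut one term later than the copy that
  -- multiplies c: once their zeroth terms are split off, all sums have the same range.
  have e1 := IsNilpotent.exp_eq_sum hk1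
  have e2 := IsNilpotent.exp_eq_sum hk2
  rw [mul_add]
  nth_rewrite 1 [e2]
  nth_rewrite 1 [e2]
  rw [e1, Finset.sum_range_succ', mul_add, add_mul, Finset.mul_sum, Finset.sum_mul,
    Finset.sum_mul]
  simp only [pow_zero, Nat.factorial_zero, Nat.cast_one, inv_one, one_smul, mul_one, one_mul]
  rw [add_right_comm, ← Finset.sum_add_distrib]
  congr 1
  refine Finset.sum_congr rfl fun n _ => ?_
  rw [mul_smul_comm, hpow, smul_add, smul_mul_assoc, smul_mul_assoc]
  congr 1
  rw [← Nat.cast_smul_eq_nsmul ℚ, smul_smul]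
  congr 1
  rw [Nat.factorial_succ]
  have : ((n + 1 : ℕ) : ℚ) ≠ 0 := by positivity
  push_cast
  push_cast at this
  field_simp

theorem commute_mul_of_anticomm {R : Type*} [Ring R] {a b c : R} (hb : a * b + b * a = 0)
    (hc : a * c + c * a = 0) : Commute a (b * c) := by
  change _ * _ = _ * _
  rw [← mul_assoc, eq_neg_of_add_eq_zero_left hb, neg_mul, mul_assoc,
    eq_neg_of_add_eq_zero_left hc, mul_neg, neg_neg, mul_assoc]

end Exponential

/-! ### Canonical anticommutation relations, vacua and the Thouless exponential. -/

section Fock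

variable {N : ℕ}

theorem annihilate_mul_annihilate (i j : Fin N) :
    annihilate i * annihilate j + annihilate j * annihilate i = 0 := by
  refine LinearMap.ext fun x => ?_
  change CliffordAlgebra.contractLeft _ (CliffordAlgebra.contractLeft _ x) +
    CliffordAlgebra.contractLeft _ (CliffordAlgebra.contractLeft _ x) = 0
  rw [CliffordAlgebra.contractLeft_comm]
  simp

theorem create_mul_create (i j : Fin N) :
    create i * create j + create j * create i = 0 := by
  refine LinearMap.ext fun x => ?_
  simp only [create, LinearMap.add_apply, Module.End.mul_apply, LinearMap.mulLeft_apply,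
    LinearMap.zero_apply]
  rw [← mul_assoc, ← mul_assoc, ← add_mul, ExteriorAlgebra.ι_add_mul_swap, zero_mul]

theorem annihilate_mul_create (i j : Fin N) :
    annihilate i * create j + create j * annihilate i = if i = j then 1 else 0 := by
  refine LinearMap.ext fun x => ?_
  change CliffordAlgebra.contractLeft _ (CliffordAlgebra.ι _ _ * x) +
    CliffordAlgebra.ι _ _ * CliffordAlgebra.contractLeft _ x = _
  rw [CliffordAlgebra.contractLeft_ι_mul]
  by_cases h : i = j
  · subst h; simp
  · simp [h]

/-- Operators linear in c and c† anticommute to a scalar, the bilinear form that pairs each c with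
its c†. Nothing is required of U. -/
theorem quasi_anticomm (U : Matrix (Nambu N) (Nambu N) ℂ) (a b : Nambu N) :
    quasi U a * quasi U b + quasi U b * quasi U a =
      (∑ i, (U a (Sum.inl i) * U b (Sum.inr i) + U a (Sum.inr i) * U b (Sum.inl i))) •
        (1 : Module.End ℂ (Fock N)) := by
  have key : ∀ i j : Fin N,
      (U a (Sum.inl i) • annihilate i + U a (Sum.inr i) • create i) *
        (U b (Sum.inl j) • annihilate j + U b (Sum.inr j) • create j) +
      (U b (Sum.inl j) • annihilate j + U b (Sum.inr j) • create j) *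
        (U a (Sum.inl i) • annihilate i + U a (Sum.inr i) • create i) =
      if i = j then (U a (Sum.inl i) * U b (Sum.inr i) + U a (Sum.inr i) * U b (Sum.inl i)) •
        (1 : Module.End ℂ (Fock N)) else 0 := by
    intro i j
    have h1 := annihilate_mul_annihilate i j
    have h2 := create_mul_create i j
    have h3 := annihilate_mul_create i j
    have h4 := annihilate_mul_create j i
    have e : (U a (Sum.inl i) • annihilate i + U a (Sum.inr i) • create i) *
        (U b (Sum.inl j) • annihilate j + U b (Sum.inr j) • create j) +
      (U b (Sum.inl j) • annihilate j + U b (Sum.inr j) • create j) *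
        (U a (Sum.inl i) • annihilate i + U a (Sum.inr i) • create i) =
      (U a (Sum.inl i) * U b (Sum.inl j)) •
        (annihilate i * annihilate j + annihilate j * annihilate i) +
      (U a (Sum.inr i) * U b (Sum.inr j)) • (create i * create j + create j * create i) +
      (U a (Sum.inl i) * U b (Sum.inr j)) •
        (annihilate i * create j + create j * annihilate i) +
      (U a (Sum.inr i) * U b (Sum.inl j)) •
        (annihilate j * create i + create i * annihilate j) := by
      simp only [mul_add, add_mul, smul_mul_smul_comm, smul_add]
      simp only [mul_comm (U b _) (U a _)]
      abel
    rw [e, h1, h2, h3, h4]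
    by_cases h : i = j
    · subst h; simp [add_smul]
    · simp [h, Ne.symm h]
  simp only [quasi]
  rw [Finset.sum_mul_sum, Finset.sum_mul_sum, Finset.sum_comm (s := Finset.univ)
    (f := fun i j => (U b (Sum.inl i) • annihilate i + U b (Sum.inr i) • create i) *
      (U a (Sum.inl j) • annihilate j + U a (Sum.inr j) • create j)), ← Finset.sum_add_distrib,
    Finset.sum_smul]
  refine Finset.sum_congr rfl fun i _ => ?_
  rw [← Finset.sum_add_distrib]
  simp only [key]
  simp

/-- Bogoliubov transformations: unitary of the form `[[u, v], [v*, u*]]`. -/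
def IsBogoliubov (U : Matrix (Nambu N) (Nambu N) ℂ) : Prop :=
  U ∈ Matrix.unitaryGroup (Nambu N) ℂ ∧
    ∃ u v : Matrix (Fin N) (Fin N) ℂ, U = Matrix.fromBlocks u v (conjMat v) (conjMat u)

theorem IsBogoliubov.star_apply {U : Matrix (Nambu N) (Nambu N) ℂ} (h : IsBogoliubov U)
    (a b : Nambu N) : star (U a b) = U a.swap b.swap := by
  obtain ⟨_, u, v, rfl⟩ := h
  rcases a with a | a <;> rcases b with b | b <;> simp [conjMat]

/-- The form [[u, v], [v*, u*]] makes exchanging c and c† the same as conjugating coefficients, so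
the bilinear form of `quasi_anticomm` becomes the Hermitian product of rows and unitarity evaluates
it. -/
theorem IsBogoliubov.anticomm {U : Matrix (Nambu N) (Nambu N) ℂ} (h : IsBogoliubov U)
    (a b : Nambu N) :
    quasi U a * quasi U b + quasi U b * quasi U a = if a = b.swap then 1 else 0 := by
  rw [quasi_anticomm]
  have h1 : (U * Uᴴ) a b.swap = (1 : Matrix (Nambu N) (Nambu N) ℂ) a b.swap :=
    congrFun (congrFun (Matrix.mem_unitaryGroup_iff.1 h.1) a) b.swap
  rw [Matrix.mul_apply, Fintype.sum_sum_type, ← Finset.sum_add_distrib] at h1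
  simp only [Matrix.conjTranspose_apply, h.star_apply, Sum.swap_swap, Sum.swap_inl,
    Sum.swap_inr] at h1
  rw [h1, Matrix.one_apply]
  split <;> simp

/-- Start from any nonzero vector and treat the modes one by one: if η_a does not already kill Ω,
replace Ω by η_aΩ. This is killed by η_a because η_a² = 0, and the earlier modes still kill it
because they anticommute with η_a. -/
theorem IsBogoliubov.exists_isVacuum {U : Matrix (Nambu N) (Nambu N) ℂ} (h : IsBogoliubov U) :
    ∃ Ω, IsVacuum U Ω := by
  suffices H : ∀ s : Finset (Fin N), ∃ Ω : Fock N, Ω ≠ 0 ∧ ∀ α ∈ s, quasi U (Sum.inl α) Ω = 0 by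
    obtain ⟨Ω, h1, h2⟩ := H Finset.univ
    exact ⟨Ω, h1, fun α => h2 α (Finset.mem_univ α)⟩
  intro s
  induction s using Finset.induction_on with
  | empty => exact ⟨1, one_ne_zero, by simp⟩
  | insert a s ha ih =>
    obtain ⟨Ω, h1, h2⟩ := ih
    by_cases h0 : quasi U (Sum.inl a) Ω = 0
    · refine ⟨Ω, h1, fun α hα => ?_⟩
      rcases Finset.mem_insert.1 hα with rfl | hα
      exacts [h0, h2 α hα]
    · refine ⟨_, h0, fun α hα => ?_⟩
      have e := h.anticomm (Sum.inl α) (Sum.inl a)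
      simp only [Sum.swap_inl, reduceCtorEq, if_false] at e
      have e' := LinearMap.congr_fun e Ω
      simp only [LinearMap.add_apply, Module.End.mul_apply, LinearMap.zero_apply] at e'
      rcases Finset.mem_insert.1 hα with rfl | hα
      · have : (2 : ℂ) • quasi U (Sum.inl α) (quasi U (Sum.inl α) Ω) = 0 := by
          rw [two_smul]; exact e'
        simpa using this
      · rw [h2 α hα, map_zero, add_zero] at e'
        exact e'

theorem quasi_mul (W U : Matrix (Nambu N) (Nambu N) ℂ) (a : Nambu N) :
    quasi (W * U) a = ∑ b, W a b • quasi U b := by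
  simp only [quasi, Finset.smul_sum, smul_add, smul_smul]
  rw [Finset.sum_comm]
  refine Finset.sum_congr rfl fun i _ => ?_
  rw [Finset.sum_add_distrib, Matrix.mul_apply, Matrix.mul_apply, Finset.sum_smul,
    Finset.sum_smul]

/-- The exponent `½ ∑ G_{αβ} η†_α η†_β`. -/
noncomputable def pairing (U : Matrix (Nambu N) (Nambu N) ℂ) (G : Matrix (Fin N) (Fin N) ℂ) :
    Module.End ℂ (Fock N) :=
  (1 / 2 : ℂ) • ∑ α : Fin N, ∑ β : Fin N,
      G α β • (quasi U (Sum.inr α) * quasi U (Sum.inr β))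

theorem IsBogoliubov.inr_anticomm {U : Matrix (Nambu N) (Nambu N) ℂ} (h : IsBogoliubov U)
    (α β : Fin N) : quasi U (Sum.inr α) * quasi U (Sum.inr β) +
      quasi U (Sum.inr β) * quasi U (Sum.inr α) = 0 := by
  have e := h.anticomm (Sum.inr α) (Sum.inr β)
  simpa only [Sum.swap_inr, reduceCtorEq, if_false] using e

theorem IsBogoliubov.inr_commute_pair {U : Matrix (Nambu N) (Nambu N) ℂ} (h : IsBogoliubov U)
    (γ α β : Fin N) :
    Commute (quasi U (Sum.inr γ)) (quasi U (Sum.inr α) * quasi U (Sum.inr β)) :=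
  commute_mul_of_anticomm (h.inr_anticomm γ α) (h.inr_anticomm γ β)

theorem IsBogoliubov.inr_mul_self {U : Matrix (Nambu N) (Nambu N) ℂ} (h : IsBogoliubov U)
    (α : Fin N) : quasi U (Sum.inr α) * quasi U (Sum.inr α) = 0 := by
  have this : (2 : ℂ) • (quasi U (Sum.inr α) * quasi U (Sum.inr α)) = 0 := by
    rw [two_smul]; exact h.inr_anticomm α α
  simpa using this

/-- The products η†η† commute with one another and each squares to zero, so any linear combination
of them is nilpotent. -/
theorem IsBogoliubov.isNilpotent_pairing {U : Matrix (Nambu N) (Nambu N) ℂ} (h : IsBogoliubov U)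
    (G : Matrix (Fin N) (Fin N) ℂ) : IsNilpotent (pairing U G) := by
  have hc : ∀ γ δ α β : Fin N, Commute (quasi U (Sum.inr γ) * quasi U (Sum.inr δ))
      (quasi U (Sum.inr α) * quasi U (Sum.inr β)) := fun γ δ α β =>
    (h.inr_commute_pair γ α β).mul_left (h.inr_commute_pair δ α β)
  have hn : ∀ α β : Fin N, IsNilpotent (quasi U (Sum.inr α) * quasi U (Sum.inr β)) := by
    intro α β
    refine ⟨2, ?_⟩
    rw [pow_two, ← mul_assoc, ← (h.inr_commute_pair α α β).eq, ← mul_assoc, h.inr_mul_self]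
    simp
  refine IsNilpotent.smul ?_ _
  refine Commute.isNilpotent_sum (fun α _ => Commute.isNilpotent_sum
    (fun β _ => (hn α β).smul _) fun β β' _ _ => ?_) fun α α' _ _ => ?_
  · exact ((hc _ _ _ _).smul_left _).smul_right _
  · exact Commute.sum_left _ _ _ fun β _ => Commute.sum_right _ _ _ fun β' _ =>
      ((hc _ _ _ _).smul_left _).smul_right _

/-- Moving η_γ past a pair η†_αη†_β leaves two contractions. Antisymmetry of G makes their sums
equal, which cancels the factor ½. -/
theorem IsBogoliubov.inl_mul_pairing {U : Matrix (Nambu N) (Nambu N) ℂ} (h : IsBogoliubov U)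
    {G : Matrix (Fin N) (Fin N) ℂ} (hG : Gᵀ = -G) (γ : Fin N) :
    quasi U (Sum.inl γ) * pairing U G =
      pairing U G * quasi U (Sum.inl γ) + ∑ β, G γ β • quasi U (Sum.inr β) := by
  have hanti : ∀ α β, G β α = -G α β := fun α β => congrFun (congrFun hG α) β
  have key : ∀ α β : Fin N, quasi U (Sum.inl γ) * (quasi U (Sum.inr α) * quasi U (Sum.inr β)) =
      quasi U (Sum.inr α) * quasi U (Sum.inr β) * quasi U (Sum.inl γ) +
        ((if γ = α then quasi U (Sum.inr β) else 0) -
          (if γ = β then quasi U (Sum.inr α) else 0)) := by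
    intro α β
    have e1 := h.anticomm (Sum.inl γ) (Sum.inr α)
    have e2 := h.anticomm (Sum.inl γ) (Sum.inr β)
    simp only [Sum.swap_inr, Sum.inl.injEq] at e1 e2
    rw [← mul_assoc, eq_sub_of_add_eq e1, sub_mul, mul_assoc (quasi U (Sum.inr α)),
      eq_sub_of_add_eq e2, mul_sub, mul_assoc]
    split <;> split <;> simp <;> abel
  simp only [pairing, mul_smul_comm, smul_mul_assoc, Finset.mul_sum, Finset.sum_mul]
  simp only [key, smul_add, Finset.sum_add_distrib]
  congr 1
  simp only [smul_sub, Finset.sum_sub_distrib, smul_ite, smul_zero]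
  rw [Finset.sum_comm (f := fun α β => if γ = α then G α β • quasi U (Sum.inr β) else 0)]
  simp only [Finset.sum_ite_eq, Finset.mem_univ, if_true]
  have e : ∑ α, G α γ • quasi U (Sum.inr α) = -∑ α, G γ α • quasi U (Sum.inr α) := by
    rw [← Finset.sum_neg_distrib]
    exact Finset.sum_congr rfl fun α _ => by rw [hanti γ α]; exact neg_smul (G γ α) (quasi U (Sum.inr α))
  rw [e]
  module

/-- By the commutator formula, η_γ acts on exp(pairing)Ω as exp(pairing) applied to Σ_β G_{γβ}η†_βΩ,
whereas η† commutes with the exponential. Thus η⁰ = W₁η + W₂η† produces the coefficient W₁G + W₂ =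
0. The vector is nonzero because the exponential is invertible. -/
theorem thouless_of_blocks {U₀ U W : Matrix (Nambu N) (Nambu N) ℂ} (h : IsBogoliubov U)
    (hW : U₀ = W * U) {G : Matrix (Fin N) (Fin N) ℂ} (hG : Gᵀ = -G)
    (h12 : W.toBlocks₁₁ * G = -W.toBlocks₁₂) : Thouless U₀ U G := by
  obtain ⟨Ω, hΩ⟩ := h.exists_isVacuum
  refine ⟨hG, Ω, hΩ, ?_⟩
  change IsVacuum U₀ (IsNilpotent.exp (pairing U G) Ω)
  have hn := h.isNilpotent_pairing G
  constructor
  · intro h0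
    have := LinearMap.congr_fun (IsNilpotent.exp_neg_mul_exp_self hn) Ω
    rw [Module.End.mul_apply, h0, map_zero] at this
    exact hΩ.1 (by simpa using this.symm)
  · intro α
    have hcomm : ∀ γ, Commute (∑ β, G γ β • quasi U (Sum.inr β)) (pairing U G) := fun γ =>
      Commute.sum_left _ _ _ fun β _ => Commute.smul_left (Commute.smul_right
        (Commute.sum_right _ _ _ fun α' _ => Commute.sum_right _ _ _ fun β' _ =>
          (h.inr_commute_pair _ _ _).smul_right _) _) _
    have hl : ∀ γ, quasi U (Sum.inl γ) (IsNilpotent.exp (pairing U G) Ω) =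
        IsNilpotent.exp (pairing U G) (∑ β, G γ β • quasi U (Sum.inr β) Ω) := by
      intro γ
      have e := mul_exp_of_commutator hn (h.inl_mul_pairing hG γ) (hcomm γ)
      have e' := LinearMap.congr_fun e Ω
      rw [Module.End.mul_apply, Module.End.mul_apply, LinearMap.add_apply, hΩ.2, zero_add] at e'
      rw [e']
      simp [LinearMap.sum_apply]
    have hr : ∀ γ, quasi U (Sum.inr γ) (IsNilpotent.exp (pairing U G) Ω) =
        IsNilpotent.exp (pairing U G) (quasi U (Sum.inr γ) Ω) := by
      intro γ
      have hc : Commute (quasi U (Sum.inr γ)) (pairing U G) := Commute.smul_right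
        (Commute.sum_right _ _ _ fun α' _ => Commute.sum_right _ _ _ fun β' _ =>
          (h.inr_commute_pair _ _ _).smul_right _) _
      have e := mul_exp_of_commutator hn (b := quasi U (Sum.inr γ)) (c := 0)
        (by rw [add_zero]; exact hc.eq) (Commute.zero_left _)
      have e' := LinearMap.congr_fun e Ω
      rw [Module.End.mul_apply, Module.End.mul_apply, add_zero] at e'
      exact e'
    rw [hW, quasi_mul, Fintype.sum_sum_type]
    simp only [LinearMap.add_apply, LinearMap.sum_apply, LinearMap.smul_apply, hl, hr,
      ← map_smul (IsNilpotent.exp (pairing U G)), ← map_sum (IsNilpotent.exp (pairing U G)),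
      ← map_add (IsNilpotent.exp (pairing U G))]
    refine (congrArg _ ?_).trans (map_zero (IsNilpotent.exp (pairing U G)))
    rw [Finset.sum_congr rfl fun γ _ => Finset.smul_sum, Finset.sum_comm,
      ← Finset.sum_add_distrib]
    refine Finset.sum_eq_zero fun β _ => ?_
    have e : ∑ γ, W (Sum.inl α) (Sum.inl γ) * G γ β = -W (Sum.inl α) (Sum.inr β) :=
      congrFun (congrFun h12 α) β
    rw [Finset.sum_congr rfl fun γ _ => smul_smul _ _ _, ← Finset.sum_smul, ← add_smul, e,
      neg_add_cancel, zero_smul]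

end Fock

/-! ### Particle-hole symmetry and existence of Bogoliubov diagonalizations. -/

section Existence

variable {N : ℕ} {H : Matrix (Nambu N) (Nambu N) ℂ}

theorem IsPerturbation.star_apply (hH : IsPerturbation H) (a b : Nambu N) :
    star (H a b) = -H a.swap b.swap := by
  obtain ⟨_, A, B, rfl⟩ := hH
  rcases a with a | a <;> rcases b with b | b <;> simp [conjMat]

theorem IsPerturbation.add {H' : Matrix (Nambu N) (Nambu N) ℂ} (hH : IsPerturbation H)
    (hH' : IsPerturbation H') : IsPerturbation (H + H') := by
  obtain ⟨h, A, B, rfl⟩ := hH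
  obtain ⟨h', A', B', rfl⟩ := hH'
  refine ⟨h.add h', A + A', B + B', ?_⟩
  rw [Matrix.fromBlocks_add, conjMat_add, conjMat_add, neg_add, neg_add]

/-- The particle-hole conjugation `(x, y) ↦ (y*, x*)`. -/
def particleHole (x : Nambu N → ℂ) : Nambu N → ℂ := fun a => star (x a.swap)

theorem sum_swap (f : Nambu N → ℂ) : ∑ a : Nambu N, f a.swap = ∑ a, f a :=
  Equiv.sum_comp (Equiv.sumComm (Fin N) (Fin N)) f

/-- This sign makes the spectrum symmetric: particle-hole conjugation is an antiunitary exchange of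
the eigenspaces of λ and -λ. -/
theorem IsPerturbation.mulVec_particleHole (hH : IsPerturbation H) (x : Nambu N → ℂ) :
    H *ᵥ particleHole x = -particleHole (H *ᵥ x) := by
  ext a
  simp only [Matrix.mulVec, dotProduct, particleHole, Pi.neg_apply, star_sum, star_mul']
  rw [← sum_swap, ← Finset.sum_neg_distrib]
  refine Finset.sum_congr rfl fun b _ => ?_
  rw [hH.star_apply, Sum.swap_swap, Sum.swap_swap]
  ring

theorem IsPerturbation.orthogonal (hH : IsPerturbation H) {x y : Nambu N → ℂ} {s t : ℝ}
    (hx : H *ᵥ x = (s : ℂ) • x) (hy : H *ᵥ y = (t : ℂ) • y) (hst : s ≠ t) :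
    star x ⬝ᵥ y = 0 := by
  have h1 : star x ⬝ᵥ (H *ᵥ y) = star (H *ᵥ x) ⬝ᵥ y := by
    rw [Matrix.star_mulVec, ← Matrix.dotProduct_mulVec, hH.1.eq]
  rw [hx, hy, dotProduct_smul, star_smul, smul_dotProduct] at h1
  simp only [smul_eq_mul, Complex.star_def, Complex.conj_ofReal] at h1
  have h2 : ((t : ℂ) - s) * (star x ⬝ᵥ y) = 0 := by rw [sub_mul, h1, sub_self]
  rcases mul_eq_zero.1 h2 with h3 | h3
  · exact absurd (by exact_mod_cast (sub_eq_zero.1 h3).symm) hst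
  · exact h3

/-- A family of vectors together with their particle-hole conjugates. -/
def doubled {ι : Type*} (v : ι → Nambu N → ℂ) : ι ⊕ ι → Nambu N → ℂ :=
  Sum.elim v fun i => particleHole (v i)

theorem IsPerturbation.mulVec_doubled (hH : IsPerturbation H) {ι : Type*}
    {v : ι → Nambu N → ℂ} {f : ι → ℝ} (hv : ∀ i, H *ᵥ v i = (f i : ℂ) • v i) (a : ι ⊕ ι) :
    H *ᵥ doubled v a = ((Sum.elim f (fun i => -f i) a : ℝ) : ℂ) • doubled v a := by
  rcases a with i | i
  · exact hv i
  · simp only [doubled, Sum.elim_inr]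
    rw [hH.mulVec_particleHole, hv]
    ext a
    simp [particleHole]

theorem IsPerturbation.doubled_orthonormal (hH : IsPerturbation H) {ι : Type*} [DecidableEq ι]
    {v : ι → Nambu N → ℂ} {f : ι → ℝ} (hv : ∀ i, H *ᵥ v i = (f i : ℂ) • v i)
    (ho : ∀ i j, star (v i) ⬝ᵥ v j = if i = j then 1 else 0) (hf : ∀ i j, f i + f j ≠ 0)
    (a b : ι ⊕ ι) : star (doubled v a) ⬝ᵥ doubled v b = if a = b then 1 else 0 := by
  have hp : ∀ x y : Nambu N → ℂ, star (particleHole x) ⬝ᵥ particleHole y = star y ⬝ᵥ x := by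
    intro x y
    simp only [dotProduct, particleHole, Pi.star_apply, star_star]
    rw [← sum_swap]
    exact Finset.sum_congr rfl fun a _ => by rw [Sum.swap_swap, mul_comm]
  rcases a with i | i <;> rcases b with j | j
  · simpa [doubled] using ho i j
  · rw [hH.orthogonal (hH.mulVec_doubled hv _) (hH.mulVec_doubled hv _)
      (fun h => hf i j (by simpa using eq_neg_iff_add_eq_zero.1 h))]
    simp
  · rw [hH.orthogonal (hH.mulVec_doubled hv _) (hH.mulVec_doubled hv _)
      (fun h => hf j i (by simpa using eq_neg_iff_add_eq_zero.1 h.symm))]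
    simp
  · simp only [doubled, Sum.elim_inr]
    rw [hp, ho]
    simp [eq_comm]

/-- The matrix whose rows are the conjugates of the vectors of a family. -/
def rowsMat {κ : Type*} (w : κ → Nambu N → ℂ) : Matrix κ (Nambu N) ℂ :=
  Matrix.of fun a b => star (w a b)

theorem rowsMat_mul_conjTranspose {κ : Type*} [Fintype κ] [DecidableEq κ] {w : κ → Nambu N → ℂ}
    (h : ∀ a b, star (w a) ⬝ᵥ w b = if a = b then 1 else 0) :
    rowsMat w * (rowsMat w)ᴴ = 1 := by
  ext a b
  rw [Matrix.one_apply, ← h a b]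
  simp [rowsMat, Matrix.mul_apply, dotProduct]

/-- If no two of the eigenvalues are opposite, the family and its particle-hole conjugates are
together orthonormal in dimension 2N, so the family has at most N members. -/
theorem IsPerturbation.card_le (hH : IsPerturbation H) {ι : Type*} [Fintype ι] [DecidableEq ι]
    {v : ι → Nambu N → ℂ} {f : ι → ℝ} (hv : ∀ i, H *ᵥ v i = (f i : ℂ) • v i)
    (ho : ∀ i j, star (v i) ⬝ᵥ v j = if i = j then 1 else 0) (hf : ∀ i j, f i + f j ≠ 0) :
    Fintype.card ι ≤ N := by
  have h1 := rowsMat_mul_conjTranspose (hH.doubled_orthonormal hv ho hf)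
  have h2 := Matrix.rank_mul_le_left (rowsMat (doubled v)) (rowsMat (doubled v))ᴴ
  rw [h1, Matrix.rank_one] at h2
  have h3 := h2.trans (Matrix.rank_le_card_width _)
  simp only [Fintype.card_sum, Fintype.card_fin] at h3
  omega

theorem IsPerturbation.diagonalizes_of_orthonormal (hH : IsPerturbation H)
    {v : Fin N → Nambu N → ℂ} {f : Fin N → ℝ} (hv : ∀ i, H *ᵥ v i = (f i : ℂ) • v i)
    (ho : ∀ i j, star (v i) ⬝ᵥ v j = if i = j then 1 else 0) (hf : ∀ i, 0 < f i)
    (hanti : Antitone f) : Diagonalizes H (fun α => 2 * f α) (rowsMat (doubled v)) := by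
  have hw := hH.doubled_orthonormal hv ho fun α β => (add_pos (hf α) (hf β)).ne'
  refine ⟨Matrix.mem_unitaryGroup_iff.2 (rowsMat_mul_conjTranspose hw),
    ⟨Matrix.of fun α i => star (v α (Sum.inl i)), Matrix.of fun α i => star (v α (Sum.inr i)), ?_⟩,
    fun α => mul_pos two_pos (hf α), fun α β hαβ => ?_, ?_⟩
  · ext (a | a) (b | b) <;> simp [rowsMat, doubled, particleHole, conjMat]
  · have := hanti hαβ
    change 2 * f β ≤ 2 * f α
    linarith
  · ext a b
    have h1 : (rowsMat (doubled v) * H * (rowsMat (doubled v))ᴴ) a b =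
        star (doubled v a) ⬝ᵥ (H *ᵥ doubled v b) := by
      rw [Matrix.mul_assoc, Matrix.mul_apply]
      simp [rowsMat, dotProduct, Matrix.mul_apply, Matrix.mulVec]
    rw [h1, hH.mulVec_doubled hv, dotProduct_smul, hw]
    rcases a with a | a <;> rcases b with b | b <;>
      simp [Matrix.diagonal_apply]
    all_goals split_ifs with h
    all_goals first | rfl | rw [h]

/-- Without zero modes, `card_le` allows at most N positive and at most N negative eigenvalues out
of 2N, so there are exactly N of each. The positive eigenvectors in decreasing order give η; their
particle-hole conjugates give η†. -/
theorem IsPerturbation.exists_diagonalizes (hH : IsPerturbation H)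
    (hker : ∀ x, H *ᵥ x = 0 → x = 0) : ∃ E U, Diagonalizes H E U := by
  set e := hH.1.eigenvalues with he
  have hv : ∀ a, H *ᵥ (hH.1.eigenvectorBasis a).ofLp = ((e a : ℝ) : ℂ) •
      (hH.1.eigenvectorBasis a).ofLp := fun a => by
    rw [hH.1.mulVec_eigenvectorBasis]; rfl
  have ho : ∀ a b, star (hH.1.eigenvectorBasis a).ofLp ⬝ᵥ (hH.1.eigenvectorBasis b).ofLp =
      if a = b then 1 else 0 := fun a b => by
    rw [← orthonormal_iff_ite.1 hH.1.eigenvectorBasis.orthonormal a b, dotProduct_comm]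
    rfl
  have hne : ∀ a, e a ≠ 0 := fun a h0 => by
    have h1 := hker _ (by rw [hv a, h0]; simp)
    have h2 := ho a a
    rw [h1] at h2
    simp at h2
  have c1 : Fintype.card {a // 0 < e a} ≤ N :=
    hH.card_le (v := fun a : {a // 0 < e a} => (hH.1.eigenvectorBasis a).ofLp)
      (f := fun a => e a) (fun a => hv a)
      (fun a b => by rw [ho]; simp [Subtype.ext_iff]) fun a b => (add_pos a.2 b.2).ne'
  have c2 : Fintype.card {a // ¬0 < e a} ≤ N :=
    hH.card_le (v := fun a : {a // ¬0 < e a} => (hH.1.eigenvectorBasis a).ofLp)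
      (f := fun a => e a) (fun a => hv a)
      (fun a b => by rw [ho]; simp [Subtype.ext_iff]) fun a b =>
        (add_neg (lt_of_le_of_ne (not_lt.1 a.2) (hne a))
          (lt_of_le_of_ne (not_lt.1 b.2) (hne b))).ne
  have c3 := Fintype.card_subtype_compl (fun a => 0 < e a)
  have c4 := Fintype.card_subtype_le (fun a => 0 < e a)
  simp only [Fintype.card_sum, Fintype.card_fin] at c3 c4
  have c5 : Fintype.card {a // 0 < e a} = N := by omega
  let ι : {a // 0 < e a} ≃ Fin N := Fintype.equivFinOfCardEq c5
  let σ := Tuple.sort fun α : Fin N => -e (ι.symm α)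
  have hσ := Tuple.monotone_sort fun α : Fin N => -e (ι.symm α)
  let g : Fin N → {a // 0 < e a} := fun α => ι.symm (σ α)
  have hg : Function.Injective g := ι.symm.injective.comp σ.injective
  let v : Fin N → Nambu N → ℂ := fun α => (hH.1.eigenvectorBasis (g α)).ofLp
  have hv' : ∀ α, H *ᵥ v α = ((e (g α) : ℝ) : ℂ) • v α := fun α => hv _
  refine ⟨_, _, hH.diagonalizes_of_orthonormal hv' (fun α β => ?_) (fun α => (g α).2)
    fun α β hαβ => ?_⟩
  · change star (hH.1.eigenvectorBasis (g α)).ofLp ⬝ᵥ (hH.1.eigenvectorBasis (g β)).ofLp = _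
    rw [ho]
    simp [← Subtype.ext_iff, hg.eq_iff]
  · have := hσ hαβ
    simp only [Function.comp_apply] at this
    change e (ι.symm (σ β)) ≤ e (ι.symm (σ α))
    linarith

end Existence

/-! ### Weyl's inequality and uniqueness of the quasiparticle energies. -/

section Weyl

variable {N : ℕ} {H H' : Matrix (Nambu N) (Nambu N) ℂ} {E E' : Fin N → ℝ}
  {U U' : Matrix (Nambu N) (Nambu N) ℂ}

theorem Diagonalizes.isBogoliubov (h : Diagonalizes H E U) : IsBogoliubov U := ⟨h.unitary, h.form⟩

theorem Diagonalizes.mul_conjTranspose (h : Diagonalizes H E U) : U * Uᴴ = 1 :=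
  Matrix.mem_unitaryGroup_iff.1 h.unitary

theorem Diagonalizes.conjTranspose_mul (h : Diagonalizes H E U) : Uᴴ * U = 1 :=
  Matrix.mem_unitaryGroup_iff'.1 h.unitary

/-- The eigenvalues `½ (E, -E)`. -/
noncomputable def halfLevels (E : Fin N → ℝ) : Nambu N → ℝ :=
  Sum.elim (fun α => E α / 2) fun α => -(E α / 2)

theorem half_smul_diagonal (E : Fin N → ℝ) :
    (1 / 2 : ℂ) • Matrix.diagonal (Sum.elim (fun α => (E α : ℂ)) (fun α => -(E α : ℂ))) =
      Matrix.diagonal fun a => (halfLevels E a : ℂ) := by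
  rw [← Matrix.diagonal_smul]
  congr 1
  ext (a | a) <;> simp [halfLevels] <;> ring

theorem Diagonalizes.diag_halfLevels (h : Diagonalizes H E U) :
    U * H * Uᴴ = Matrix.diagonal fun a => (halfLevels E a : ℂ) := by
  rw [h.diag, half_smul_diagonal]

theorem Diagonalizes.mul_eq (h : Diagonalizes H E U) :
    U * H = (Matrix.diagonal fun a => (halfLevels E a : ℂ)) * U := by
  rw [← h.diag_halfLevels, Matrix.mul_assoc (U * H), h.conjTranspose_mul, Matrix.mul_one]

theorem Diagonalizes.eq_conj (h : Diagonalizes H E U) :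
    H = Uᴴ * (Matrix.diagonal fun a => (halfLevels E a : ℂ)) * U := by
  rw [Matrix.mul_assoc, ← h.mul_eq, ← Matrix.mul_assoc, h.conjTranspose_mul, Matrix.one_mul]

theorem Diagonalizes.quadratic_form (h : Diagonalizes H E U) (x : Nambu N → ℂ) :
    star x ⬝ᵥ (H *ᵥ x) = ((∑ a, halfLevels E a * ‖(U *ᵥ x) a‖ ^ 2 : ℝ) : ℂ) := by
  conv_lhs => rw [h.eq_conj]
  rw [← Matrix.mulVec_mulVec, ← Matrix.mulVec_mulVec, Matrix.dotProduct_mulVec,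
    ← Matrix.star_mulVec]
  simp only [dotProduct, Matrix.mulVec_diagonal, Pi.star_apply, Complex.ofReal_sum,
    Complex.ofReal_mul, Complex.ofReal_pow]
  refine Finset.sum_congr rfl fun a _ => ?_
  rw [← Complex.conj_mul']
  simp only [Complex.star_def]
  ring

theorem sum_sq_mulVec_unitary (hU : U ∈ Matrix.unitaryGroup (Nambu N) ℂ) (x : Nambu N → ℂ) :
    ∑ a, ‖(U *ᵥ x) a‖ ^ 2 = ∑ a, ‖x a‖ ^ 2 := by
  have h : ∀ y : Nambu N → ℂ, ((∑ a, ‖y a‖ ^ 2 : ℝ) : ℂ) = star y ⬝ᵥ y := by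
    intro y
    simp only [dotProduct, Complex.ofReal_sum, Complex.ofReal_pow, Pi.star_apply]
    exact Finset.sum_congr rfl fun a _ => (Complex.conj_mul' _).symm
  have h2 : star (U *ᵥ x) ⬝ᵥ (U *ᵥ x) = star x ⬝ᵥ x := by
    rw [Matrix.star_mulVec, ← Matrix.dotProduct_mulVec, Matrix.mulVec_mulVec]
    rw [show Uᴴ * U = 1 from Matrix.mem_unitaryGroup_iff'.1 hU, Matrix.one_mulVec]
  have h3 := h (U *ᵥ x)
  rw [h2, ← h x] at h3
  exact_mod_cast h3

theorem norm_quadratic_form_le (V : Matrix (Nambu N) (Nambu N) ℂ) (x : Nambu N → ℂ) :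
    ‖star x ⬝ᵥ (V *ᵥ x)‖ ≤ ‖V‖ * ∑ a, ‖x a‖ ^ 2 := by
  have h1 := norm_inner_le_norm (𝕜 := ℂ) (WithLp.toLp 2 x) (WithLp.toLp 2 (V *ᵥ x))
  have h2 := Matrix.l2_opNorm_mulVec V (WithLp.toLp 2 x)
  have h3 : ‖WithLp.toLp 2 x‖ ^ 2 = ∑ a, ‖x a‖ ^ 2 := EuclideanSpace.norm_sq_eq _
  have h4 : star x ⬝ᵥ (V *ᵥ x) = inner ℂ (WithLp.toLp 2 x) (WithLp.toLp 2 (V *ᵥ x)) := by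
    rw [dotProduct_comm]; rfl
  rw [h4, ← h3]
  calc _ ≤ _ := h1
    _ ≤ ‖WithLp.toLp 2 x‖ * (‖V‖ * ‖WithLp.toLp 2 x‖) := by gcongr; exact h2
    _ = _ := by ring

/-- Weyl's inequality for the ordered quasiparticle energies, in one direction. -/
theorem Diagonalizes.energy_le (h : Diagonalizes H E U) (h' : Diagonalizes H' E' U')
    (α : Fin N) : E' α ≤ E α + 2 * ‖H' - H‖ := by
  -- Min-max by dimension count. A kernel vector x lies in the span of the eigenvectors of H with
  -- level at most E α / 2 and in the span of those of H' with level at least E' α / 2. These are 2N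
  -- - 1 linear conditions; the spare row, at index α, is set to zero so that M is square and
  -- singular.
  let M : Matrix (Nambu N) (Nambu N) ℂ := Matrix.of fun a =>
    Sum.elim (fun β => if β < α then U (Sum.inl β) else if β = α then 0 else U' (Sum.inl β))
      (fun β => U' (Sum.inr β)) a
  have hM : M.det = 0 := Matrix.det_eq_zero_of_row_eq_zero (Sum.inl α) fun j => by simp [M]
  obtain ⟨x, hx, hMx⟩ := Matrix.exists_mulVec_eq_zero_iff.2 hM
  have h1 : ∀ β, β < α → (U *ᵥ x) (Sum.inl β) = 0 := fun β hβ => by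
    have := congrFun hMx (Sum.inl β)
    simpa [M, Matrix.mulVec, hβ] using this
  have h2 : ∀ β, α < β → (U' *ᵥ x) (Sum.inl β) = 0 := fun β hβ => by
    have := congrFun hMx (Sum.inl β)
    simpa [M, Matrix.mulVec, hβ.not_gt, hβ.ne'] using this
  have h3 : ∀ β, (U' *ᵥ x) (Sum.inr β) = 0 := fun β => by
    have := congrFun hMx (Sum.inr β)
    simpa [M, Matrix.mulVec] using this
  set n := ∑ a, ‖x a‖ ^ 2 with hn
  have hpos : 0 < n := by
    obtain ⟨a, ha⟩ := Function.ne_iff.1 hx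
    exact Finset.sum_pos' (fun _ _ => by positivity)
      ⟨a, Finset.mem_univ a, by have := norm_pos_iff.2 ha; positivity⟩
  have e1 : ∑ a, halfLevels E a * ‖(U *ᵥ x) a‖ ^ 2 ≤ E α / 2 * n := by
    rw [hn, ← sum_sq_mulVec_unitary h.unitary, Finset.mul_sum]
    refine Finset.sum_le_sum fun a _ => ?_
    rcases a with β | β
    · rcases lt_or_ge β α with hβ | hβ
      · simp [h1 β hβ]
      · have := h.ordered hβ
        exact mul_le_mul_of_nonneg_right (by simp only [halfLevels, Sum.elim_inl]; linarith)
          (by positivity)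
    · have := h.pos β
      have := h.pos α
      exact mul_le_mul_of_nonneg_right (by simp only [halfLevels, Sum.elim_inr]; linarith)
          (by positivity)
  have e2 : E' α / 2 * n ≤ ∑ a, halfLevels E' a * ‖(U' *ᵥ x) a‖ ^ 2 := by
    rw [hn, ← sum_sq_mulVec_unitary h'.unitary, Finset.mul_sum]
    refine Finset.sum_le_sum fun a _ => ?_
    rcases a with β | β
    · rcases lt_or_ge α β with hβ | hβ
      · simp [h2 β hβ]
      · have := h'.ordered hβ
        exact mul_le_mul_of_nonneg_right (by simp only [halfLevels, Sum.elim_inl]; linarith)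
          (by positivity)
    · simp [h3 β]
  have e3 := norm_quadratic_form_le (H' - H) x
  rw [Matrix.sub_mulVec, dotProduct_sub, h.quadratic_form, h'.quadratic_form,
    ← Complex.ofReal_sub, Complex.norm_real] at e3
  have e4 := (le_abs_self _).trans e3
  have e5 : (E' α / 2 - E α / 2) * n ≤ ‖H' - H‖ * n := by linarith
  have e6 := le_of_mul_le_mul_right e5 hpos
  linarith

theorem Diagonalizes.abs_energy_sub_le (h : Diagonalizes H E U) (h' : Diagonalizes H' E' U')
    (α : Fin N) : |E' α - E α| ≤ 2 * ‖H' - H‖ := by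
  have h1 := h.energy_le h' α
  have h2 := h'.energy_le h α
  rw [norm_sub_rev] at h2
  rw [abs_le]
  constructor <;> linarith

/-- Weyl's inequality with zero perturbation. It lets the plane-wave energies be used for an
arbitrary diagonalization of the clean chain. -/
theorem Diagonalizes.energy_unique (h : Diagonalizes H E U) (h' : Diagonalizes H E' U') :
    E' = E := by
  ext α
  have h1 := h.abs_energy_sub_le h' α
  rw [sub_self, norm_zero, mul_zero] at h1
  linarith [abs_nonpos_iff.1 h1]

end Weyl

/-! ### The antiperiodic shift and the algebra of the Ising matrices. -/

section Chain

variable {N : ℕ}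

theorem shift_mulVec (x : Fin N → ℂ) (i : Fin N) :
    (antiperiodicShift N *ᵥ x) i =
      if hi : i.val + 1 < N then x ⟨i.val + 1, hi⟩ else -x ⟨0, i.pos⟩ := by
  simp only [Matrix.mulVec, dotProduct, antiperiodicShift, Matrix.of_apply]
  split_ifs with hi
  · rw [Finset.sum_eq_single ⟨i.val + 1, hi⟩]
    · simp
    · intro j _ hj
      have h1 : ¬ i.val + 1 = j.val := fun h => hj (Fin.ext h.symm)
      have h2 : ¬ (i.val + 1 = N ∧ j.val = 0) := fun h => by omega
      simp [h1, h2]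
    · simp
  · have hi' : i.val + 1 = N := by omega
    rw [Finset.sum_eq_single ⟨0, i.pos⟩]
    · rw [if_neg (by simp), if_pos ⟨hi', rfl⟩, neg_one_mul]
    · intro j _ hj
      have h1 : ¬ i.val + 1 = j.val := by omega
      have h2 : ¬ (i.val + 1 = N ∧ j.val = 0) := fun h => hj (Fin.ext h.2)
      simp only [h1, h2, if_false, zero_mul]
    · simp

theorem shift_transpose_mulVec (x : Fin N → ℂ) (i : Fin N) :
    ((antiperiodicShift N)ᵀ *ᵥ x) i =
      if 0 < i.val then x ⟨i.val - 1, by omega⟩ else -x ⟨N - 1, by have := i.pos; omega⟩ := by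
  simp only [Matrix.mulVec, dotProduct, antiperiodicShift, Matrix.of_apply,
    Matrix.transpose_apply]
  split_ifs with hi
  · rw [Finset.sum_eq_single ⟨i.val - 1, by omega⟩]
    · have : i.val - 1 + 1 = i.val := by omega
      simp [this]
    · intro j _ hj
      have h1 : ¬ j.val + 1 = i.val := fun h => hj (Fin.ext (show j.val = i.val - 1 by omega))
      have h2 : ¬ (j.val + 1 = N ∧ i.val = 0) := fun h => by omega
      simp only [h1, h2, if_false, zero_mul]
    · simp
  · rw [Finset.sum_eq_single ⟨N - 1, by have := i.pos; omega⟩]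
    · have h1 : ¬ N - 1 + 1 = i.val := by omega
      have h2 : N - 1 + 1 = N ∧ i.val = 0 := by omega
      rw [if_neg h1, if_pos h2, neg_one_mul]
    · intro j _ hj
      have h1 : ¬ j.val + 1 = i.val := by omega
      have h2 : ¬ (j.val + 1 = N ∧ i.val = 0) := fun h => hj (Fin.ext (show j.val = N - 1 by omega))
      simp only [h1, h2, if_false, zero_mul]
    · simp

theorem shift_transpose_mul_shift :
    (antiperiodicShift N)ᵀ * antiperiodicShift N = 1 := by
  refine Matrix.ext_of_mulVec_single fun j => ?_
  ext i
  rw [← Matrix.mulVec_mulVec, shift_transpose_mulVec, Matrix.one_mulVec]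
  split_ifs with hi
  · rw [shift_mulVec, dif_pos (by simp; omega)]
    congr 1
    exact Fin.ext (by simp; omega)
  · rw [shift_mulVec, dif_neg (by simp; omega), neg_neg]
    congr 1
    exact Fin.ext (by simp; omega)

theorem shift_mul_shift_transpose :
    antiperiodicShift N * (antiperiodicShift N)ᵀ = 1 :=
  mul_eq_one_comm.1 shift_transpose_mul_shift

theorem conjMat_shift : conjMat (antiperiodicShift N) = antiperiodicShift N := by
  ext i j
  simp only [conjMat_apply, antiperiodicShift, Matrix.of_apply]
  split_ifs <;> simp

theorem isPerturbation_isingMatrix (h : Fin N → ℝ) : IsPerturbation (isingMatrix h) := by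
  have hS : (antiperiodicShift N)ᴴ = (antiperiodicShift N)ᵀ := by
    rw [← conjTranspose_conjMat, conjMat_shift]
  have hS' : conjMat (antiperiodicShift N)ᵀ = (antiperiodicShift N)ᵀ := by
    rw [← hS, conjMat_conjTranspose, hS]
  have hd : (Matrix.diagonal fun i => 2 * (h i : ℂ)) =
      Matrix.diagonal fun i => ((2 * h i : ℝ) : ℂ) := by simp
  constructor
  · have hd' : (Matrix.diagonal fun i => 2 * (h i : ℂ))ᴴ = Matrix.diagonal fun i => 2 * (h i : ℂ) := by
      rw [hd, ← conjMat_diagonal_real, conjTranspose_conjMat, Matrix.diagonal_transpose,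
        conjMat_diagonal_real]
    have hS2 : ((antiperiodicShift N)ᵀ)ᴴ = antiperiodicShift N := by
      rw [← hS, Matrix.conjTranspose_conjTranspose]
    simp only [isingMatrix, Matrix.IsHermitian, Matrix.conjTranspose_smul,
      Matrix.fromBlocks_conjTranspose, Matrix.conjTranspose_sub, Matrix.conjTranspose_neg,
      Matrix.conjTranspose_add, hS, hS2, hd']
    congr 1
    · simp
    · congr 1 <;> abel
  · refine ⟨(1 / 2 : ℂ) • (Matrix.diagonal (fun i => 2 * (h i : ℂ)) -
      (antiperiodicShift N + (antiperiodicShift N)ᵀ)),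
      (1 / 2 : ℂ) • -(antiperiodicShift N - (antiperiodicShift N)ᵀ), ?_⟩
    have h2 : (1 / 2 : ℂ) = ((1 / 2 : ℝ) : ℂ) := by simp
    rw [h2, conjMat_smul_real, conjMat_smul_real, conjMat_neg, conjMat_sub, conjMat_sub,
      conjMat_add, conjMat_shift, hS', hd, conjMat_diagonal_real, ← h2, ← hd]
    simp only [isingMatrix, Matrix.fromBlocks_smul, smul_neg]

/-- `c†c - cc†` on every site. -/
def fieldMat (N : ℕ) : Matrix (Nambu N) (Nambu N) ℂ := Matrix.fromBlocks 1 0 0 (-1)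

theorem fieldMat_mul_self : fieldMat N * fieldMat N = 1 := by
  simp [fieldMat, Matrix.fromBlocks_multiply]

theorem isingMatrix_const (h : ℝ) :
    isingMatrix (fun _ : Fin N => h) =
      isingMatrix (fun _ : Fin N => 0) + (h : ℂ) • fieldMat N := by
  simp only [isingMatrix, fieldMat]
  ext (i | i) (j | j) <;> by_cases hij : i = j <;>
    simp [hij] <;> ring

/-- Holds because the antiperiodic shift is orthogonal. At zero field the spectrum is therefore
flat, ±1. -/
theorem isingMatrix_zero_mul_self :
    isingMatrix (fun _ : Fin N => 0) * isingMatrix (fun _ : Fin N => 0) = 1 := by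
  simp only [isingMatrix, smul_mul_smul_comm, Matrix.fromBlocks_multiply]
  have h1 := shift_mul_shift_transpose (N := N)
  have h2 := shift_transpose_mul_shift (N := N)
  set S := antiperiodicShift N
  simp only [Complex.ofReal_zero, mul_zero, Matrix.diagonal_zero, zero_sub, sub_mul, mul_sub,
    add_mul, mul_add, neg_mul, mul_neg, neg_neg, h1, h2]
  rw [← Matrix.fromBlocks_one, Matrix.fromBlocks_smul]
  congr 1 <;> module

/-- Only ℋ₀² = Z² = 1 enters: both ℋ₀ℋ₁ + ℋ₁ℋ₀ and ℋ₁² equal a scalar plus h(ℋ₀Z + Zℋ₀). The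
identity determines the pairing matrix of the quench without explicit eigenvectors. -/
theorem isingMatrix_anticomm (h : ℝ) :
    isingMatrix (fun _ : Fin N => 0) * isingMatrix (fun _ : Fin N => h) +
      isingMatrix (fun _ : Fin N => h) * isingMatrix (fun _ : Fin N => 0) =
    isingMatrix (fun _ : Fin N => h) * isingMatrix (fun _ : Fin N => h) +
      ((1 - h ^ 2 : ℝ) : ℂ) • 1 := by
  have h1 := isingMatrix_zero_mul_self (N := N)
  have h2 := fieldMat_mul_self (N := N)
  rw [isingMatrix_const h]
  simp only [mul_add, add_mul, h1, h2, mul_smul_comm, smul_mul_assoc, smul_smul, smul_add]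
  push_cast
  module

end Chain

noncomputable section

/-! ### Plane-wave eigenvectors of the clean chain. -/

section PlaneWaves

/-- The half quasiparticle energy `√(1 + h² - 2 h cos k)`. -/
def dispersion (h k : ℝ) : ℝ := √(1 + h ^ 2 - 2 * h * Real.cos k)

theorem dispersion_radicand (h k : ℝ) :
    1 + h ^ 2 - 2 * h * Real.cos k = (h - Real.cos k) ^ 2 + Real.sin k ^ 2 := by
  have := Real.sin_sq_add_cos_sq k
  nlinarith

theorem sq_dispersion (h k : ℝ) :
    dispersion h k ^ 2 = (h - Real.cos k) ^ 2 + Real.sin k ^ 2 := by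
  rw [dispersion, Real.sq_sqrt (by rw [dispersion_radicand]; positivity), dispersion_radicand]

theorem sub_cos_le_dispersion (h k : ℝ) : h - Real.cos k ≤ dispersion h k := by
  rw [dispersion, dispersion_radicand]
  exact Real.le_sqrt_of_sq_le (by nlinarith [sq_nonneg (Real.sin k)])

variable {N : ℕ}

/-- Unnormalized amplitudes of the positive-energy mode of momentum `k`. -/
def modeAmplitude (h k : ℝ) (N : ℕ) : Nambu N → ℂ :=
  Sum.elim (fun j => ((dispersion h k + (h - Real.cos k) : ℝ) : ℂ) * Complex.exp (k * j * Complex.I))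
    (fun j => (Real.sin k : ℂ) * Complex.I * Complex.exp (k * j * Complex.I))

theorem shift_mulVec_exp {k : ℝ} (hk : Complex.exp (k * N * Complex.I) = -1) :
    antiperiodicShift N *ᵥ (fun j : Fin N => Complex.exp (k * j * Complex.I)) =
      Complex.exp (k * Complex.I) • fun j : Fin N => Complex.exp (k * j * Complex.I) := by
  ext i
  rw [shift_mulVec, Pi.smul_apply, smul_eq_mul, ← Complex.exp_add]
  split_ifs with hi
  · congr 1
    push_cast
    ring
  · have hN : (N : ℂ) = (i : ℂ) + 1 := by
      have : N = i.val + 1 := by omega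
      exact_mod_cast this
    rw [hN] at hk
    rw [show (k : ℂ) * Complex.I + k * i * Complex.I = k * (i + 1) * Complex.I by ring, hk]
    simp

theorem shift_transpose_mulVec_exp {k : ℝ} (hk : Complex.exp (k * N * Complex.I) = -1) :
    (antiperiodicShift N)ᵀ *ᵥ (fun j : Fin N => Complex.exp (k * j * Complex.I)) =
      Complex.exp (-(k * Complex.I)) • fun j : Fin N => Complex.exp (k * j * Complex.I) := by
  have h1 := shift_mulVec_exp hk
  have h2 : (fun j : Fin N => Complex.exp (k * j * Complex.I)) = Complex.exp (-(k * Complex.I)) •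
      (antiperiodicShift N *ᵥ fun j : Fin N => Complex.exp (k * j * Complex.I)) := by
    rw [h1, smul_smul, ← Complex.exp_add, neg_add_cancel, Complex.exp_zero, one_smul]
  conv_lhs => rw [h2]
  rw [Matrix.mulVec_smul, Matrix.mulVec_mulVec, shift_transpose_mul_shift, Matrix.one_mulVec]

/-- On an antiperiodic plane wave the shift is multiplication by exp(ik), so the matrix reduces to
[[h - cos k, -i sin k], [i sin k, -(h - cos k)]], whose square is the squared dispersion. -/
theorem isingMatrix_mulVec_modeAmplitude (h : ℝ) {k : ℝ}
    (hk : Complex.exp (k * N * Complex.I) = -1) :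
    isingMatrix (fun _ : Fin N => h) *ᵥ modeAmplitude h k N =
      (dispersion h k : ℂ) • modeAmplitude h k N := by
  set x : Fin N → ℂ := fun j => Complex.exp (k * j * Complex.I) with hx
  have h1 := shift_mulVec_exp hk
  have h2 := shift_transpose_mulVec_exp hk
  rw [← hx] at h1 h2
  have hv : modeAmplitude h k N =
      Sum.elim (((dispersion h k + (h - Real.cos k) : ℝ) : ℂ) • x)
        (((Real.sin k : ℂ) * Complex.I) • x) := by
    ext (j | j) <;> simp [modeAmplitude, hx]
  have hc : Complex.exp (k * Complex.I) + Complex.exp (-(k * Complex.I)) =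
      2 * (Real.cos k : ℂ) := by
    rw [Complex.ofReal_cos, Complex.cos]; simp; ring
  have hs : Complex.exp (k * Complex.I) - Complex.exp (-(k * Complex.I)) =
      2 * Complex.I * (Real.sin k : ℂ) := by
    rw [Complex.ofReal_sin, Complex.sin, neg_mul]
    linear_combination (-(Complex.exp (-(k * Complex.I)) - Complex.exp (k * Complex.I))) * Complex.I_sq
  have hd : (dispersion h k : ℂ) ^ 2 = (h - Real.cos k : ℂ) ^ 2 + (Real.sin k : ℂ) ^ 2 := by
    exact_mod_cast congrArg Complex.ofReal (sq_dispersion h k)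
  have hD : (Matrix.diagonal fun _ : Fin N => 2 * (h : ℂ)) *ᵥ x = (2 * (h : ℂ)) • x := by
    ext i; simp [Matrix.mulVec_diagonal]
  have hA : (Matrix.diagonal (fun _ : Fin N => 2 * (h : ℂ)) -
      (antiperiodicShift N + (antiperiodicShift N)ᵀ)) *ᵥ x =
      (2 * ((h : ℂ) - Real.cos k)) • x := by
    rw [Matrix.sub_mulVec, Matrix.add_mulVec, h1, h2, hD, ← add_smul, hc, ← sub_smul, mul_sub]
  have hB : (-(antiperiodicShift N - (antiperiodicShift N)ᵀ)) *ᵥ x =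
      (-(2 * Complex.I * (Real.sin k : ℂ))) • x := by
    rw [Matrix.neg_mulVec, Matrix.sub_mulVec, h1, h2, ← sub_smul, hs, neg_smul]
  change ((1 / 2 : ℂ) • Matrix.fromBlocks
    (Matrix.diagonal (fun _ : Fin N => 2 * (h : ℂ)) -
      (antiperiodicShift N + (antiperiodicShift N)ᵀ))
    (-(antiperiodicShift N - (antiperiodicShift N)ᵀ))
    (-(-(antiperiodicShift N - (antiperiodicShift N)ᵀ)))
    (-(Matrix.diagonal (fun _ : Fin N => 2 * (h : ℂ)) -
      (antiperiodicShift N + (antiperiodicShift N)ᵀ)))) *ᵥ _ = _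
  generalize Matrix.diagonal (fun _ : Fin N => 2 * (h : ℂ)) -
      (antiperiodicShift N + (antiperiodicShift N)ᵀ) = A at hA ⊢
  generalize -(antiperiodicShift N - (antiperiodicShift N)ᵀ) = B at hB ⊢
  rw [hv, Matrix.smul_mulVec, Matrix.fromBlocks_mulVec, Sum.elim_comp_inl, Sum.elim_comp_inr,
    Matrix.neg_mulVec, Matrix.neg_mulVec, Matrix.mulVec_smul, Matrix.mulVec_smul,
    Matrix.mulVec_smul, Matrix.mulVec_smul, hA, hB]
  ext (j | j)
  · simp only [Pi.smul_apply, Sum.elim_inl, Pi.add_apply, smul_eq_mul]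
    simp only [Complex.ofReal_add, Complex.ofReal_sub]
    linear_combination (-x j) * hd - (Real.sin k : ℂ) ^ 2 * x j * Complex.I_sq
  · simp only [Pi.smul_apply, Sum.elim_inr, Pi.add_apply, Pi.neg_apply, smul_eq_mul]
    push_cast
    ring

theorem sum_exp_eq_zero {k : ℝ} (h1 : Complex.exp (k * N * Complex.I) = 1)
    (h2 : Complex.exp (k * Complex.I) ≠ 1) :
    ∑ j : Fin N, Complex.exp (k * j * Complex.I) = 0 := by
  have h3 : ∀ j : ℕ, Complex.exp (k * j * Complex.I) = Complex.exp (k * Complex.I) ^ j := by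
    intro j
    rw [← Complex.exp_nat_mul]
    congr 1
    ring
  rw [Fin.sum_univ_eq_sum_range fun j : ℕ => Complex.exp (k * j * Complex.I)]
  simp only [h3]
  rw [geom_sum_eq h2, ← h3, h1]
  simp

theorem exp_int_mul_two_pi_div_ne_one {p : ℤ} (hN : N ≠ 0)
    (h : ¬ (N : ℤ) ∣ p) :
    Complex.exp (((2 * p * Real.pi / N : ℝ) : ℂ) * Complex.I) ≠ 1 := by
  intro h1
  obtain ⟨n, hn⟩ := Complex.exp_eq_one_iff.1 h1
  have hN : (N : ℝ) ≠ 0 := by exact_mod_cast hN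
  have h2 : (2 * p * Real.pi / N : ℝ) = n * (2 * Real.pi) := by
    have : ((2 * p * Real.pi / N : ℝ) : ℂ) * Complex.I =
        ((n * (2 * Real.pi) : ℝ) : ℂ) * Complex.I := by
      rw [hn]; push_cast; ring
    exact_mod_cast mul_right_cancel₀ Complex.I_ne_zero this
  rw [div_eq_iff hN] at h2
  have h3 : (p : ℝ) = N * n := by
    have := Real.pi_pos
    nlinarith
  exact h ⟨n, by exact_mod_cast h3⟩

theorem exp_int_mul_two_pi (p : ℤ) (hN : N ≠ 0) :
    Complex.exp (((2 * p * Real.pi / N : ℝ) : ℂ) * N * Complex.I) = 1 := by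
  rw [Complex.exp_eq_one_iff]
  refine ⟨p, ?_⟩
  have : (N : ℂ) ≠ 0 := by exact_mod_cast hN
  push_cast
  field_simp

theorem sum_exp_int_mul_two_pi {p : ℤ} (hN : N ≠ 0) (h : ¬ (N : ℤ) ∣ p) :
    ∑ j : Fin N, Complex.exp (((2 * p * Real.pi / N : ℝ) : ℂ) * j * Complex.I) = 0 :=
  sum_exp_eq_zero (exp_int_mul_two_pi p hN) (exp_int_mul_two_pi_div_ne_one hN h)

/-- The sign s treats two cases together: s = 1 with V = 1 is the inner product of modes, s = -1 is
the matrix element of a field perturbation, which acts on holes with the opposite sign. -/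
theorem star_modeAmplitude_dotProduct (h k l : ℝ) (V : Fin N → ℝ) (s : ℝ) :
    star (modeAmplitude h k N) ⬝ᵥ
      (Matrix.diagonal (Sum.elim (fun i => (V i : ℂ)) fun i => ((s * V i : ℝ) : ℂ)) *ᵥ
        modeAmplitude h l N) =
      (((dispersion h k + (h - Real.cos k)) * (dispersion h l + (h - Real.cos l)) +
        s * (Real.sin k * Real.sin l) : ℝ) : ℂ) *
        ∑ j : Fin N, V j * Complex.exp (((l - k : ℝ) : ℂ) * j * Complex.I) := by
  have he : ∀ j : Fin N, (starRingEnd ℂ) (Complex.exp (k * j * Complex.I)) *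
      Complex.exp (l * j * Complex.I) = Complex.exp (((l - k : ℝ) : ℂ) * j * Complex.I) := by
    intro j
    rw [← Complex.exp_conj, ← Complex.exp_add]
    congr 1
    simp
    ring
  rw [dotProduct, Fintype.sum_sum_type, Finset.mul_sum, ← Finset.sum_add_distrib]
  refine Finset.sum_congr rfl fun j _ => ?_
  rw [← he]
  simp only [Matrix.mulVec_diagonal, Pi.star_apply, modeAmplitude, Sum.elim_inl, Sum.elim_inr,
    Complex.star_def, map_mul, Complex.conj_ofReal, Complex.conj_I]
  simp only [Complex.ofReal_add, Complex.ofReal_sub, Complex.ofReal_mul]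
  linear_combination (-(s : ℂ) * (V j : ℂ) * (Real.sin k : ℂ) * (Real.sin l : ℂ) *
    (starRingEnd ℂ) (Complex.exp (k * j * Complex.I)) *
      Complex.exp (l * j * Complex.I)) * Complex.I_sq

/-- The square of the norm of `modeAmplitude h k N`. -/
def modeNormSq (h k : ℝ) (N : ℕ) : ℝ :=
  ((dispersion h k + (h - Real.cos k)) ^ 2 + Real.sin k ^ 2) * N

theorem modeNormSq_pos {h : ℝ} (hh : 1 < h) (k : ℝ) (hN : 0 < N) : 0 < modeNormSq h k N := by
  have h1 := sub_cos_le_dispersion h k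
  have h2 := Real.cos_le_one k
  have h3 : 0 < dispersion h k + (h - Real.cos k) := by linarith
  have : (0 : ℝ) < N := by exact_mod_cast hN
  unfold modeNormSq
  positivity

/-- The normalized positive-energy mode of momentum `k`. -/
def mode (h k : ℝ) (N : ℕ) : Nambu N → ℂ :=
  (((√(modeNormSq h k N))⁻¹ : ℝ) : ℂ) • modeAmplitude h k N

theorem isingMatrix_mulVec_mode (h : ℝ) {k : ℝ}
    (hk : Complex.exp (k * N * Complex.I) = -1) :
    isingMatrix (fun _ : Fin N => h) *ᵥ mode h k N = (dispersion h k : ℂ) • mode h k N := by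
  rw [mode, Matrix.mulVec_smul, isingMatrix_mulVec_modeAmplitude h hk, smul_comm]

theorem star_mode_dotProduct (h k l : ℝ) (V : Fin N → ℝ) (s : ℝ) :
    star (mode h k N) ⬝ᵥ
      (Matrix.diagonal (Sum.elim (fun i => (V i : ℂ)) fun i => ((s * V i : ℝ) : ℂ)) *ᵥ
        mode h l N) =
      (((√(modeNormSq h k N))⁻¹ * (√(modeNormSq h l N))⁻¹ *
      ((dispersion h k + (h - Real.cos k)) * (dispersion h l + (h - Real.cos l)) +
        s * (Real.sin k * Real.sin l)) : ℝ) : ℂ) *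
        ∑ j : Fin N, V j * Complex.exp (((l - k : ℝ) : ℂ) * j * Complex.I) := by
  rw [mode, mode, star_smul, smul_dotProduct, Matrix.mulVec_smul, dotProduct_smul,
    star_modeAmplitude_dotProduct]
  simp only [smul_eq_mul, Complex.star_def, Complex.conj_ofReal]
  push_cast
  ring

theorem star_mode_dotProduct_self {h : ℝ} (hh : 1 < h) (k : ℝ) (hN : 0 < N) :
    star (mode h k N) ⬝ᵥ mode h k N = 1 := by
  have h1 := star_mode_dotProduct (N := N) h k k (fun _ => 1) 1
  simp only [mul_one, Complex.ofReal_one] at h1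
  have h2 : Matrix.diagonal (Sum.elim (fun _ : Fin N => (1 : ℂ)) fun _ : Fin N => (1 : ℂ)) = 1 := by
    rw [← Matrix.diagonal_one]
    congr 1
    ext (i | i) <;> rfl
  rw [h2, Matrix.one_mulVec] at h1
  rw [h1]
  have h3 := modeNormSq_pos hh k hN
  simp only [sub_self, Complex.ofReal_zero, zero_mul, Complex.exp_zero, mul_one, one_mul,
    Finset.sum_const, Finset.card_univ, Fintype.card_fin, nsmul_eq_mul]
  rw [← Complex.ofReal_natCast, ← Complex.ofReal_mul, ← mul_inv, Real.mul_self_sqrt h3.le]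
  have h4 : (modeNormSq h k N)⁻¹ * ((dispersion h k + (h - Real.cos k)) *
      (dispersion h k + (h - Real.cos k)) + Real.sin k * Real.sin k) * N = 1 := by
    rw [mul_assoc, inv_mul_eq_one₀ h3.ne', modeNormSq]
    ring
  exact_mod_cast congrArg Complex.ofReal h4

theorem star_mode_dotProduct_of_ne (h : ℝ) {k l : ℝ} {p : ℤ} (hN : N ≠ 0)
    (hkl : l - k = 2 * p * Real.pi / N) (hp : ¬ (N : ℤ) ∣ p) :
    star (mode h k N) ⬝ᵥ mode h l N = 0 := by
  have h1 := star_mode_dotProduct (N := N) h k l (fun _ => 1) 1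
  have h2 : Matrix.diagonal (Sum.elim (fun _ : Fin N => (1 : ℂ)) fun _ : Fin N => (1 : ℂ)) = 1 := by
    rw [← Matrix.diagonal_one]
    congr 1
    ext (i | i) <;> rfl
  simp only [mul_one, Complex.ofReal_one, one_mul] at h1
  rw [h2, Matrix.one_mulVec, hkl, sum_exp_int_mul_two_pi hN hp, mul_zero] at h1
  exact h1

end PlaneWaves

end

noncomputable section

/-! ### Energies of the clean chain, their gaps and the band edge. -/

section Spectrum

variable {N : ℕ}

/-- The number of the doubly degenerate level of a quasiparticle, counted from the lowest one. -/
def level (α : Fin N) : ℕ := (N - 1 - α.val) / 2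

/-- The momentum of a quasiparticle of the clean chain in units of `π / N`, an odd integer. -/
def momentumIndex (α : Fin N) : ℤ :=
  if (N - 1 - α.val) % 2 = 0 then 2 * level α + 1 else -(2 * level α + 1)

/-- The momentum of a quasiparticle of the clean chain. -/
def momentum (α : Fin N) : ℝ := momentumIndex α * Real.pi / N

theorem exp_odd_mul_pi (m : ℤ) (hN : N ≠ 0) :
    Complex.exp ((((2 * m + 1 : ℤ) * Real.pi / N : ℝ) : ℂ) * N * Complex.I) = -1 := by
  have h1 : ((((2 * m + 1 : ℤ) * Real.pi / N : ℝ) : ℂ) * N * Complex.I) =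
      Real.pi * Complex.I + m * (2 * Real.pi * Complex.I) := by
    have : (N : ℂ) ≠ 0 := by exact_mod_cast hN
    push_cast
    field_simp
    ring
  rw [h1, Complex.exp_add, Complex.exp_int_mul_two_pi_mul_I, Complex.exp_pi_mul_I, mul_one]

theorem momentumIndex_odd (α : Fin N) : ∃ m : ℤ, momentumIndex α = 2 * m + 1 := by
  unfold momentumIndex
  split_ifs
  · exact ⟨level α, rfl⟩
  · exact ⟨-(level α) - 1, by ring⟩

theorem exp_momentum (α : Fin N) : Complex.exp (momentum α * N * Complex.I) = -1 := by
  obtain ⟨m, hm⟩ := momentumIndex_odd α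
  rw [momentum, hm]
  exact exp_odd_mul_pi m (Fin.pos α).ne'

/-- Momenta are distinct odd multiples of π/N, from -(N-1) to N at most, so half the index
difference is a nonzero integer smaller than N in absolute value. This is what orthogonality of the
modes needs. -/
theorem exists_momentum_sub {α β : Fin N} (h : α ≠ β) :
    ∃ p : ℤ, momentum β - momentum α = 2 * p * Real.pi / N ∧ ¬ (N : ℤ) ∣ p := by
  have hne : α.val ≠ β.val := fun h' => h (Fin.ext h')
  have key : ∃ p : ℤ, momentumIndex β - momentumIndex α = 2 * p ∧ p ≠ 0 ∧ |p| < N := by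
    have h1 := α.isLt
    have h2 := β.isLt
    unfold momentumIndex level
    split_ifs with h3 h4 h4
    · refine ⟨((N - 1 - β.val) / 2 : ℕ) - ((N - 1 - α.val) / 2 : ℕ), by ring, ?_, ?_⟩
      · omega
      · rw [abs_lt]; omega
    · refine ⟨((N - 1 - β.val) / 2 : ℕ) + ((N - 1 - α.val) / 2 : ℕ) + 1, by ring, ?_, ?_⟩
      · omega
      · rw [abs_lt]; omega
    · refine ⟨-((N - 1 - β.val) / 2 : ℕ) - ((N - 1 - α.val) / 2 : ℕ) - 1, by ring, ?_, ?_⟩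
      · omega
      · rw [abs_lt]; omega
    · refine ⟨-((N - 1 - β.val) / 2 : ℕ) + ((N - 1 - α.val) / 2 : ℕ), by ring, ?_, ?_⟩
      · omega
      · rw [abs_lt]; omega
  obtain ⟨p, hp, hp0, hpN⟩ := key
  refine ⟨p, ?_, fun hd => hp0 (Int.eq_zero_of_abs_lt_dvd hd hpN)⟩
  have : (momentumIndex β : ℝ) - momentumIndex α = 2 * p := by exact_mod_cast hp
  rw [momentum, momentum, ← sub_div, ← sub_mul, this]

theorem cos_momentum (α : Fin N) :
    Real.cos (momentum α) = Real.cos ((2 * level α + 1) * Real.pi / N) := by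
  unfold momentum momentumIndex
  split_ifs
  · push_cast; rfl
  · rw [← Real.cos_neg]
    congr 1
    push_cast
    ring

theorem dispersion_momentum (h : ℝ) (α : Fin N) :
    dispersion h (momentum α) = dispersion h ((2 * level α + 1) * Real.pi / N) := by
  rw [dispersion, dispersion, cos_momentum]

theorem sub_one_le_dispersion (h k : ℝ) : h - 1 ≤ dispersion h k :=
  (by linarith [Real.cos_le_one k] : h - 1 ≤ h - Real.cos k).trans (sub_cos_le_dispersion h k)

theorem two_mul_level_add_one_le (α : Fin N) : 2 * level α + 1 ≤ N := by
  have := α.isLt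
  unfold level
  omega

theorem dispersion_momentum_antitone {h : ℝ} (hh : 1 < h) :
    Antitone fun α : Fin N => dispersion h (momentum α) := by
  intro α β hαβ
  change dispersion h (momentum β) ≤ dispersion h (momentum α)
  rw [dispersion_momentum, dispersion_momentum]
  have hN : (0 : ℝ) < N := by exact_mod_cast Fin.pos α
  have h1 : level β ≤ level α := by
    unfold level
    have : α.val ≤ β.val := hαβ
    omega
  have h1' : (level β : ℝ) ≤ level α := by exact_mod_cast h1
  have h2 : (2 * level α + 1 : ℝ) ≤ N := by exact_mod_cast two_mul_level_add_one_le α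
  have hpi := Real.pi_pos
  refine Real.sqrt_le_sqrt ?_
  have : Real.cos ((2 * level α + 1) * Real.pi / N) ≤ Real.cos ((2 * level β + 1) * Real.pi / N) := by
    refine Real.cos_le_cos_of_nonneg_of_le_pi (by positivity) ?_ (by gcongr)
    rw [div_le_iff₀ hN]
    nlinarith
  nlinarith

theorem diagonalizes_modes {h : ℝ} (hh : 1 < h) :
    Diagonalizes (isingMatrix fun _ : Fin N => h) (fun α => 2 * dispersion h (momentum α))
      (rowsMat (doubled fun α => mode h (momentum α) N)) := by
  refine (isPerturbation_isingMatrix _).diagonalizes_of_orthonormal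
    (fun α => isingMatrix_mulVec_mode h (exp_momentum α)) (fun α β => ?_)
    (fun α => by linarith [sub_one_le_dispersion h (momentum α)])
    (dispersion_momentum_antitone hh)
  split_ifs with hαβ
  · rw [hαβ]
    exact star_mode_dotProduct_self hh _ (Fin.pos α)
  · obtain ⟨p, hp, hd⟩ := exists_momentum_sub hαβ
    exact star_mode_dotProduct_of_ne h (Fin.pos α).ne' hp hd

/-- The quasiparticle energies of the clean chain. -/
def cleanEnergy (h : ℝ) (α : Fin N) : ℝ :=
  2 * dispersion h ((2 * level α + 1) * Real.pi / N)

theorem Diagonalizes.energy_eq {h : ℝ} (hh : 1 < h) {E : Fin N → ℝ}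
    {U : Matrix (Nambu N) (Nambu N) ℂ}
    (hU : Diagonalizes (isingMatrix fun _ : Fin N => h) E U) : E = cleanEnergy h := by
  rw [(diagonalizes_modes hh).energy_unique hU]
  ext α
  rw [cleanEnergy, dispersion_momentum]

theorem dispersion_le {h : ℝ} (hh : 1 < h) (k : ℝ) : dispersion h k ≤ h + 1 := by
  refine (Real.sqrt_le_left (by linarith)).2 ?_
  nlinarith [Real.neg_one_le_cos k]

theorem dispersion_sub_mul_add (h k l : ℝ) :
    (dispersion h k - dispersion h l) * (dispersion h k + dispersion h l) =
      2 * h * (Real.cos l - Real.cos k) := by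
  have h1 := sq_dispersion h k
  have h2 := sq_dispersion h l
  nlinarith [Real.sin_sq_add_cos_sq k, Real.sin_sq_add_cos_sq l]

/-- The difference of squared energies is 2h times the difference of cosines, and a sum of two
energies is at most 2(h + 1) ≤ 4h. -/
theorem abs_cos_sub_le {h : ℝ} (hh : 1 < h) (k l : ℝ) :
    |Real.cos l - Real.cos k| ≤ 2 * |dispersion h k - dispersion h l| := by
  have h1 := congrArg abs (dispersion_sub_mul_add h k l)
  have h2 := dispersion_le hh k
  have h3 := dispersion_le hh l
  have h4 := sub_one_le_dispersion h k
  have h5 := sub_one_le_dispersion h l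
  rw [abs_mul, abs_mul, abs_of_pos (by linarith : 0 < dispersion h k + dispersion h l),
    abs_of_pos (by linarith : 0 < 2 * h)] at h1
  have h6 := abs_nonneg (dispersion h k - dispersion h l)
  have h7 := abs_nonneg (Real.cos l - Real.cos k)
  nlinarith

theorem div_le_sin_mul_pi_div {s n : ℕ} (h : 2 * s ≤ n) (hn : 0 < n) :
    (2 * s / n : ℝ) ≤ Real.sin (s * Real.pi / n) := by
  have hn' : (0 : ℝ) < n := by exact_mod_cast hn
  have hpi := Real.pi_pos
  have h' : (2 * s : ℝ) ≤ n := by exact_mod_cast h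
  have := Real.mul_le_sin (x := s * Real.pi / n) (by positivity)
    (by rw [div_le_div_iff₀ hn' two_pos]; nlinarith)
  refine le_trans (le_of_eq ?_) this
  field_simp

/-- Jordan's inequality, reflected at π/2 so that it also covers angles up to π. -/
theorem div_le_sin_mul_pi_div' {s n : ℕ} (h : s ≤ n) (hn : 0 < n) :
    2 * min (s : ℝ) (n - s) / n ≤ Real.sin (s * Real.pi / n) := by
  have hn' : (0 : ℝ) < n := by exact_mod_cast hn
  rcases le_total (2 * s) n with h1 | h1
  · refine le_trans ?_ (div_le_sin_mul_pi_div h1 hn)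
    gcongr
    exact min_le_left _ _
  · have h2 := div_le_sin_mul_pi_div (s := n - s) (n := n) (by omega) hn
    rw [Nat.cast_sub h] at h2
    have h3 : ((n : ℝ) - s) * Real.pi / n = Real.pi - s * Real.pi / n := by field_simp
    rw [h3, Real.sin_pi_sub] at h2
    refine le_trans ?_ h2
    gcongr
    exact min_le_right _ _

theorem level_eq_of_cleanEnergy_ne {h : ℝ} {α β : Fin N} (hne : cleanEnergy h α ≠ cleanEnergy h β) :
    level α ≠ level β := fun h' => hne (by rw [cleanEnergy, cleanEnergy, h'])

/-- Distinct energies of the clean chain are separated. -/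
theorem gap_le {h : ℝ} (hh : 1 < h) {α β : Fin N} (hne : level α ≠ level β) :
    min ((N : ℝ) - α) (α + 1) * |(α : ℝ) - β| / (2 * N ^ 2) ≤
      |cleanEnergy h α - cleanEnergy h β| := by
  have hN : 0 < N := Fin.pos α
  have hN' : (0 : ℝ) < N := by exact_mod_cast hN
  have hα := α.isLt
  have hβ := β.isLt
  set l := level α with hl
  set m := level β with hm
  have hl' : l = (N - 1 - α.val) / 2 := hl
  have hm' : m = (N - 1 - β.val) / 2 := hm
  set s := l + m + 1 with hs
  set d : ℕ := (l - m) + (m - l) with hd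
  -- The sine of the mean momentum is small at both band edges, hence the minimum: 4s is compared
  -- with N - α and 4(N - s) with α + 1.
  have h1 : min ((s : ℝ)) (N - s) * 4 ≥ min ((N : ℝ) - α) (α + 1) := by
    have e1 : N ≤ 4 * s + α.val := by omega
    have e2 : α.val + 1 + 4 * s ≤ 4 * N := by omega
    have e1' : (N : ℝ) ≤ 4 * s + α.val := by exact_mod_cast e1
    have e2' : (α.val : ℝ) + 1 + 4 * s ≤ 4 * N := by exact_mod_cast e2
    rw [min_mul_of_nonneg _ _ (by norm_num : (0 : ℝ) ≤ 4)]
    refine le_min ?_ ?_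
    · exact (min_le_left _ _).trans (by linarith)
    · exact (min_le_right _ _).trans (by linarith)
  -- Each level holds at most two indices, so the index distance is at most 2d + 1, and d ≥ 1
  -- because the levels differ.
  have h2 : |(α : ℝ) - β| ≤ 3 * d := by
    have e1 : α.val ≤ β.val + 3 * d := by omega
    have e2 : β.val ≤ α.val + 3 * d := by omega
    have e1' : (α.val : ℝ) ≤ β.val + 3 * d := by exact_mod_cast e1
    have e2' : (β.val : ℝ) ≤ α.val + 3 * d := by exact_mod_cast e2
    rw [abs_le]
    constructor <;> linarith
  have h3 := div_le_sin_mul_pi_div' (s := s) (n := N) (by omega) hN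
  have h4 := div_le_sin_mul_pi_div (s := d) (n := N) (by omega) hN
  -- The difference of cosines splits into sines of half the sum and half the difference of the
  -- momenta; these are multiples s and d of π/N.
  have h5 : |Real.cos ((2 * m + 1) * Real.pi / N) - Real.cos ((2 * l + 1) * Real.pi / N)| =
      2 * |Real.sin (s * Real.pi / N)| * |Real.sin (d * Real.pi / N)| := by
    rw [Real.cos_sub_cos, abs_mul, abs_mul, abs_neg, abs_of_pos (two_pos : (0 : ℝ) < 2)]
    have e1 : ((2 * m + 1) * Real.pi / N + (2 * l + 1) * Real.pi / N) / 2 = s * Real.pi / N := by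
      rw [hs]; push_cast; ring
    have e2 : |Real.sin (((2 * m + 1) * Real.pi / N - (2 * l + 1) * Real.pi / N) / 2)| =
        |Real.sin (d * Real.pi / N)| := by
      rcases le_total l m with hlm | hlm
      · have : (d : ℝ) = m - l := by
          rw [← Nat.cast_sub hlm]; congr 1; omega
        rw [this]
        congr 2
        ring
      · have : (d : ℝ) = l - m := by
          rw [← Nat.cast_sub hlm]; congr 1; omega
        rw [this, ← abs_neg, ← Real.sin_neg]
        congr 2
        ring
    rw [e1, e2]
  have h6 := abs_cos_sub_le hh ((2 * l + 1) * Real.pi / N) ((2 * m + 1) * Real.pi / N)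
  have h7 : |cleanEnergy h α - cleanEnergy h β| = 2 *
      |dispersion h ((2 * l + 1) * Real.pi / N) - dispersion h ((2 * m + 1) * Real.pi / N)| := by
    rw [cleanEnergy, cleanEnergy, ← mul_sub, abs_mul, abs_of_pos (two_pos : (0 : ℝ) < 2)]
  rw [h7]
  refine le_trans ?_ h6
  rw [h5]
  have hmin : 0 ≤ min ((s : ℝ)) (N - s) := by
    have : s ≤ N := by omega
    have : (s : ℝ) ≤ N := by exact_mod_cast this
    exact le_min (by positivity) (by linarith)
  have h8 : min ((N : ℝ) - α) (α + 1) * |(α : ℝ) - β| ≤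
      (min ((s : ℝ)) (N - s) * 4) * (3 * d) :=
    mul_le_mul h1 h2 (abs_nonneg _) (by positivity)
  calc min ((N : ℝ) - α) (α + 1) * |(α : ℝ) - β| / (2 * N ^ 2)
      ≤ (min ((s : ℝ)) (N - s) * 4) * (3 * d) / (2 * N ^ 2) := by gcongr
    _ ≤ 2 * (2 * min ((s : ℝ)) (N - s) / N) * (2 * d / N) := by
        have : 0 ≤ min ((s : ℝ)) (N - s) * d / N ^ 2 := by positivity
        have e1 : (min ((s : ℝ)) (N - s) * 4) * (3 * d) / (2 * N ^ 2) =
          6 * (min ((s : ℝ)) (N - s) * d / N ^ 2) := by field_simp; ring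
        have e2 : 2 * (2 * min ((s : ℝ)) (N - s) / N) * (2 * d / N) =
          8 * (min ((s : ℝ)) (N - s) * d / N ^ 2) := by field_simp; ring
        rw [e1, e2]
        linarith
    _ ≤ 2 * |Real.sin (s * Real.pi / N)| * |Real.sin (d * Real.pi / N)| := by
        gcongr
        · exact h3.trans (le_abs_self _)
        · exact h4.trans (le_abs_self _)

theorem min_gap {h : ℝ} (hh : 1 < h) {α β : Fin N} (hne : cleanEnergy h α ≠ cleanEnergy h β) :
    1 / (2 * (N : ℝ) ^ 2) ≤ |cleanEnergy h α - cleanEnergy h β| := by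
  refine le_trans ?_ (gap_le hh (level_eq_of_cleanEnergy_ne hne))
  have h1 : (1 : ℝ) ≤ min ((N : ℝ) - α) (α + 1) := by
    have : α.val + 1 ≤ N := α.isLt
    have : (α.val : ℝ) + 1 ≤ N := by exact_mod_cast this
    exact le_min (by linarith) (by linarith [(Nat.cast_nonneg α.val : (0 : ℝ) ≤ α.val)])
  have h2 : (1 : ℝ) ≤ |(α : ℝ) - β| := by
    have h3 : (α.val : ℤ) - β.val ≠ 0 := by
      intro h0
      have : α = β := Fin.ext (by omega)
      exact hne (by rw [this])
    have := Int.one_le_abs h3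
    exact_mod_cast this
  gcongr
  nlinarith

theorem sum_one_div_sq_le (n : ℕ) : ∑ i ∈ Finset.range n, 1 / ((i : ℝ) + 1) ^ 2 ≤ 2 := by
  have h : ∀ n : ℕ, ∑ i ∈ Finset.range (n + 1), 1 / ((i : ℝ) + 1) ^ 2 ≤ 2 - 1 / ((n : ℝ) + 1) := by
    intro n
    induction n with
    | zero => norm_num
    | succ n ih =>
      rw [Finset.sum_range_succ]
      have : 1 / ((n : ℝ) + 1 + 1) ^ 2 ≤ 1 / ((n : ℝ) + 1) - 1 / ((n : ℝ) + 1 + 1) := by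
        rw [div_sub_div _ _ (by positivity) (by positivity),
          div_le_div_iff₀ (by positivity) (by positivity)]
        nlinarith [(Nat.cast_nonneg n : (0 : ℝ) ≤ n)]
      push_cast
      linarith
  rcases n with _ | n
  · simp
  · exact (h n).trans (by have : (0 : ℝ) ≤ 1 / ((n : ℝ) + 1) := by positivity
                          linarith)

theorem sum_one_div_sub_sq_le (a : Fin N) :
    ∑ b : Fin N, (if a = b then 0 else 1 / ((a : ℝ) - b) ^ 2) ≤ 4 := by
  have h1 : ∑ b : Fin N, (if a = b then 0 else 1 / ((a : ℝ) - b) ^ 2) =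
      ∑ b ∈ Finset.range N, (if a.val = b then 0 else 1 / ((a : ℝ) - b) ^ 2) := by
    rw [← Fin.sum_univ_eq_sum_range fun b : ℕ => (if a.val = b then 0 else 1 / ((a : ℝ) - b) ^ 2)]
    exact Finset.sum_congr rfl fun b _ => by simp only [Fin.ext_iff]
  obtain ⟨m, hm⟩ : ∃ m, N = a.val + (m + 1) := ⟨N - a.val - 1, by have := a.isLt; omega⟩
  rw [h1, show Finset.range N = Finset.range (a.val + (m + 1)) from congrArg _ hm,
    Finset.sum_range_add, Finset.sum_range_succ', add_zero, if_pos rfl, add_zero]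
  have h2 : ∑ b ∈ Finset.range a.val, (if a.val = b then 0 else 1 / ((a : ℝ) - b) ^ 2) =
      ∑ j ∈ Finset.range a.val, 1 / ((j : ℝ) + 1) ^ 2 := by
    rw [← Finset.sum_range_reflect]
    refine Finset.sum_congr rfl fun b hb => ?_
    have hb' := Finset.mem_range.1 hb
    rw [if_neg (by omega)]
    have : ((a.val - 1 - b : ℕ) : ℝ) = a.val - 1 - b := by
      rw [Nat.sub_sub, Nat.cast_sub (by omega)]; push_cast; ring
    rw [this]
    congr 2
    ring
  have h3 : ∑ b ∈ Finset.range m, (if a.val = a.val + (b + 1) then 0 else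
      1 / ((a : ℝ) - (a.val + (b + 1) : ℕ)) ^ 2) =
      ∑ j ∈ Finset.range m, 1 / ((j : ℝ) + 1) ^ 2 := by
    refine Finset.sum_congr rfl fun b _ => ?_
    rw [if_neg (by omega), ← neg_sq]
    push_cast
    congr 2
    ring
  rw [h2, h3]
  linarith [sum_one_div_sq_le a.val, sum_one_div_sq_le m]

theorem sum_edges_le : ∑ a : Fin N, (1 / ((N : ℝ) - a) ^ 2 + 1 / ((a : ℝ) + 1) ^ 2) ≤ 4 := by
  rw [Finset.sum_add_distrib]
  have h1 : ∑ a : Fin N, 1 / ((a : ℝ) + 1) ^ 2 = ∑ j ∈ Finset.range N, 1 / ((j : ℝ) + 1) ^ 2 :=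
    Fin.sum_univ_eq_sum_range (fun j : ℕ => 1 / ((j : ℝ) + 1) ^ 2) N
  have h2 : ∑ a : Fin N, 1 / ((N : ℝ) - a) ^ 2 = ∑ j ∈ Finset.range N, 1 / ((j : ℝ) + 1) ^ 2 := by
    rw [Fin.sum_univ_eq_sum_range (fun j : ℕ => 1 / ((N : ℝ) - j) ^ 2) N,
      ← Finset.sum_range_reflect]
    refine Finset.sum_congr rfl fun b hb => ?_
    have hb' := Finset.mem_range.1 hb
    have : ((N - 1 - b : ℕ) : ℝ) = N - 1 - b := by
      rw [Nat.sub_sub, Nat.cast_sub (by omega)]; push_cast; ring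
    rw [this]
    congr 2
    ring
  rw [h1, h2]
  linarith [sum_one_div_sq_le N]

/-- The inverse squared gaps of the clean chain, summed over all pairs of distinct energies. -/
theorem sum_inv_gap_sq_le {h : ℝ} (hh : 1 < h) :
    ∑ α : Fin N, ∑ β : Fin N, (if cleanEnergy h α = cleanEnergy h β then 0 else
      1 / (cleanEnergy h α - cleanEnergy h β) ^ 2) ≤ 64 * (N : ℝ) ^ 4 := by
  have key : ∀ α β : Fin N, (if cleanEnergy h α = cleanEnergy h β then 0 else
      1 / (cleanEnergy h α - cleanEnergy h β) ^ 2) ≤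
      4 * (N : ℝ) ^ 4 * (1 / ((N : ℝ) - α) ^ 2 + 1 / ((α : ℝ) + 1) ^ 2) *
        (if α = β then 0 else 1 / ((α : ℝ) - β) ^ 2) := by
    intro α β
    split_ifs with h1 h2 h2
    · simp
    · positivity
    · exact absurd (by rw [h2]) h1
    · have hN : (0 : ℝ) < N := by exact_mod_cast Fin.pos α
      have h3 := gap_le hh (level_eq_of_cleanEnergy_ne h1)
      have h4 : 0 < (N : ℝ) - α := sub_pos.2 (by exact_mod_cast α.isLt)
      have h5 : 0 < (α : ℝ) + 1 := by positivity
      have h6 : 0 < |(α : ℝ) - β| := abs_pos.2 (sub_ne_zero.2 fun h' =>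
        h2 (Fin.ext (by exact_mod_cast h')))
      set μ := min ((N : ℝ) - α) (α + 1) with hμ
      have h7 : 0 < μ := lt_min h4 h5
      -- Bounding the inverse square of a minimum by a sum over the two edges makes the double sum
      -- factor into convergent one-dimensional sums.
      have h8 : 1 / μ ^ 2 ≤ 1 / ((N : ℝ) - α) ^ 2 + 1 / ((α : ℝ) + 1) ^ 2 := by
        rcases min_choice ((N : ℝ) - α) (α + 1) with h' | h' <;> rw [hμ, h']
        · exact le_add_of_nonneg_right (by positivity)
        · exact le_add_of_nonneg_left (by positivity)
      rw [← sq_abs (cleanEnergy h α - cleanEnergy h β), ← sq_abs ((α : ℝ) - β)]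
      calc 1 / |cleanEnergy h α - cleanEnergy h β| ^ 2
          ≤ 1 / (μ * |(α : ℝ) - β| / (2 * N ^ 2)) ^ 2 := by gcongr
        _ = 4 * (N : ℝ) ^ 4 * (1 / μ ^ 2) * (1 / |(α : ℝ) - β| ^ 2) := by field_simp; ring
        _ ≤ _ := by gcongr
  calc _ ≤ ∑ α : Fin N, ∑ β : Fin N,
        4 * (N : ℝ) ^ 4 * (1 / ((N : ℝ) - α) ^ 2 + 1 / ((α : ℝ) + 1) ^ 2) *
        (if α = β then 0 else 1 / ((α : ℝ) - β) ^ 2) :=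
        Finset.sum_le_sum fun α _ => Finset.sum_le_sum fun β _ => key α β
    _ ≤ ∑ α : Fin N, 4 * (N : ℝ) ^ 4 * (1 / ((N : ℝ) - α) ^ 2 + 1 / ((α : ℝ) + 1) ^ 2) * 4 := by
        refine Finset.sum_le_sum fun α _ => ?_
        rw [← Finset.mul_sum]
        gcongr
        exact sum_one_div_sub_sq_le α
    _ = 16 * (N : ℝ) ^ 4 * ∑ α : Fin N, (1 / ((N : ℝ) - α) ^ 2 + 1 / ((α : ℝ) + 1) ^ 2) := by
        rw [Finset.mul_sum]
        exact Finset.sum_congr rfl fun _ _ => by ring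
    _ ≤ 16 * (N : ℝ) ^ 4 * 4 := by gcongr; exact sum_edges_le
    _ = _ := by ring

/-- Lower bound on the energies above the band edge. -/
theorem le_cleanEnergy_sub {h : ℝ} (hh : 1 < h) (α : Fin N) :
    2 * (2 * level α + 1 : ℝ) ^ 2 / N ^ 2 ≤ cleanEnergy h α / 2 - (h - 1) := by
  have hN : 0 < N := Fin.pos α
  have hN' : (0 : ℝ) < N := by exact_mod_cast hN
  rw [cleanEnergy, mul_div_cancel_left₀ _ two_ne_zero]
  set k := (2 * level α + 1) * Real.pi / N with hk
  have hpi := Real.pi_pos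
  have h1 : (2 * level α + 1 : ℝ) ≤ N := by exact_mod_cast two_mul_level_add_one_le α
  have h2 : (2 * level α + 1 : ℝ) / N ≤ Real.sin (k / 2) := by
    have := Real.mul_le_sin (x := k / 2) (by positivity) (by
      rw [hk]
      gcongr
      rw [div_le_iff₀ hN']
      nlinarith)
    refine le_trans (le_of_eq ?_) this
    rw [hk]
    field_simp
  have h3 : Real.cos k = 1 - 2 * Real.sin (k / 2) ^ 2 := by
    have := Real.cos_two_mul (k / 2)
    rw [mul_div_cancel₀ _ two_ne_zero] at this
    linarith [Real.sin_sq_add_cos_sq (k / 2)]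
  have h4 := sq_dispersion h k
  have h5 := sub_one_le_dispersion h k
  have h6 := dispersion_le hh k
  have h7 := Real.sin_sq_add_cos_sq k
  have h8 : ((2 * level α + 1 : ℝ) / N) ^ 2 ≤ Real.sin (k / 2) ^ 2 := by gcongr
  -- The excess over the band edge is 4h sin²(k/2) divided by ε + (h - 1), and this divisor is at
  -- most 2h.
  have h9 : (dispersion h k - (h - 1)) * (dispersion h k + (h - 1)) =
      4 * h * Real.sin (k / 2) ^ 2 := by
    have : Real.cos k * h = h - 2 * h * Real.sin (k / 2) ^ 2 := by rw [h3]; ring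
    nlinarith
  have h10 : 4 * h * Real.sin (k / 2) ^ 2 ≤ (dispersion h k - (h - 1)) * (2 * h) := by
    rw [← h9]
    gcongr
    · linarith
  have h11 : 2 * (2 * level α + 1 : ℝ) ^ 2 / N ^ 2 = 2 * ((2 * level α + 1 : ℝ) / N) ^ 2 := by
    rw [div_pow]; ring
  rw [h11]
  nlinarith

end Spectrum

end

/-! ### The group of Bogoliubov transformations and antisymmetry of the pairing matrix. -/

section Bogoliubov

variable {N : ℕ} {U U' W : Matrix (Nambu N) (Nambu N) ℂ}

theorem isBogoliubov_iff : IsBogoliubov U ↔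
    U ∈ Matrix.unitaryGroup (Nambu N) ℂ ∧ ∀ a b, star (U a b) = U a.swap b.swap := by
  refine ⟨fun h => ⟨h.1, h.star_apply⟩, fun h => ⟨h.1, U.toBlocks₁₁, U.toBlocks₁₂, ?_⟩⟩
  ext (a | a) (b | b)
  · rfl
  · rfl
  · exact (h.2 (Sum.inl a) (Sum.inr b)).symm
  · exact (h.2 (Sum.inl a) (Sum.inl b)).symm

theorem IsBogoliubov.mul (h : IsBogoliubov U) (h' : IsBogoliubov U') : IsBogoliubov (U * U') := by
  refine isBogoliubov_iff.2 ⟨mul_mem h.1 h'.1, fun a b => ?_⟩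
  rw [Matrix.mul_apply, Matrix.mul_apply, star_sum, ← sum_swap]
  refine Finset.sum_congr rfl fun c _ => ?_
  rw [star_mul', h.star_apply, h'.star_apply, Sum.swap_swap]

theorem IsBogoliubov.conjTranspose (h : IsBogoliubov U) : IsBogoliubov Uᴴ := by
  refine isBogoliubov_iff.2 ⟨Unitary.star_mem h.1, fun a b => ?_⟩
  rw [Matrix.conjTranspose_apply, Matrix.conjTranspose_apply, h.star_apply]

theorem IsBogoliubov.inv (h : IsBogoliubov U) : IsBogoliubov U⁻¹ := by
  rw [inv_eq_conjTranspose h.1]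
  exact h.conjTranspose

theorem IsBogoliubov.eq_fromBlocks (h : IsBogoliubov W) :
    W = Matrix.fromBlocks W.toBlocks₁₁ W.toBlocks₁₂ (conjMat W.toBlocks₁₂)
      (conjMat W.toBlocks₁₁) := by
  obtain ⟨_, u, v, rfl⟩ := h
  simp

theorem IsBogoliubov.block_relations (h : IsBogoliubov W) :
    W.toBlocks₁₁ * W.toBlocks₁₁ᴴ + W.toBlocks₁₂ * W.toBlocks₁₂ᴴ = 1 ∧
    W.toBlocks₁₁ * W.toBlocks₁₂ᵀ + W.toBlocks₁₂ * W.toBlocks₁₁ᵀ = 0 := by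
  have h1 := Matrix.mem_unitaryGroup_iff.1 h.1
  rw [Matrix.star_eq_conjTranspose, h.eq_fromBlocks, Matrix.fromBlocks_conjTranspose,
    Matrix.fromBlocks_multiply, conjTranspose_conjMat, conjTranspose_conjMat,
    ← Matrix.fromBlocks_one] at h1
  exact ⟨(Matrix.fromBlocks_inj.1 h1).1, (Matrix.fromBlocks_inj.1 h1).2.1⟩

theorem IsBogoliubov.block_relations' (h : IsBogoliubov W) :
    W.toBlocks₁₁ᴴ * W.toBlocks₁₁ + W.toBlocks₁₂ᵀ * conjMat W.toBlocks₁₂ = 1 ∧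
    W.toBlocks₁₁ᴴ * W.toBlocks₁₂ + W.toBlocks₁₂ᵀ * conjMat W.toBlocks₁₁ = 0 := by
  have h1 := Matrix.mem_unitaryGroup_iff'.1 h.1
  rw [Matrix.star_eq_conjTranspose, h.eq_fromBlocks, Matrix.fromBlocks_conjTranspose,
    Matrix.fromBlocks_multiply, conjTranspose_conjMat, conjTranspose_conjMat,
    ← Matrix.fromBlocks_one] at h1
  exact ⟨(Matrix.fromBlocks_inj.1 h1).1, (Matrix.fromBlocks_inj.1 h1).2.1⟩

theorem blockW₁_mul_bcsMatrix (h1 : IsUnit (blockW₁ U' U)) :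
    blockW₁ U' U * bcsMatrix U' U = -blockW₂ U' U := by
  rw [bcsMatrix, Matrix.mul_neg, Matrix.mul_nonsing_inv_cancel_left _ _
    ((Matrix.isUnit_iff_isUnit_det _).1 h1)]

/-- Unitarity gives W₁W₂ᵀ + W₂W₁ᵀ = 0. With W₂ = -W₁G this says W₁(Gᵀ + G)W₁ᵀ = 0, and W₁ can be
cancelled on both sides. -/
theorem transpose_bcsMatrix (h' : IsBogoliubov U') (h : IsBogoliubov U)
    (h1 : IsUnit (blockW₁ U' U)) : (bcsMatrix U' U)ᵀ = -bcsMatrix U' U := by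
  have h2 := (h'.mul h.inv).block_relations.2
  change blockW₁ U' U * (blockW₂ U' U)ᵀ + blockW₂ U' U * (blockW₁ U' U)ᵀ = 0 at h2
  have h3 := blockW₁_mul_bcsMatrix h1
  set A := blockW₁ U' U
  set B := blockW₂ U' U
  set G := bcsMatrix U' U
  have h4 : A * (Gᵀ + G) * Aᵀ = 0 := by
    rw [mul_add, add_mul, h3, Matrix.mul_assoc, ← Matrix.transpose_mul, h3,
      Matrix.transpose_neg, mul_neg, neg_mul, ← neg_add, h2, neg_zero]
  have hA : IsUnit Aᵀ := (Matrix.isUnit_transpose _).2 h1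
  have h5 : Gᵀ + G = 0 := by
    rw [hA.mul_left_eq_zero] at h4
    rwa [h1.mul_right_eq_zero] at h4
  exact eq_neg_of_add_eq_zero_left h5

theorem thouless_bcsMatrix (h' : IsBogoliubov U') (h : IsBogoliubov U)
    (h1 : IsUnit (blockW₁ U' U)) : Thouless U' U (bcsMatrix U' U) := by
  refine thouless_of_blocks (W := U' * U⁻¹) h ?_ (transpose_bcsMatrix h' h h1)
    (blockW₁_mul_bcsMatrix h1)
  rw [inv_eq_conjTranspose h.1, Matrix.mul_assoc,
    show Uᴴ * U = 1 from Matrix.mem_unitaryGroup_iff'.1 h.1, Matrix.mul_one]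

end Bogoliubov

/-! ### The exact level structure and weights of the clean pairing matrix. -/

section Clean

variable {N : ℕ} {h : ℝ} {E₀ E : Fin N → ℝ} {U₀ U : Matrix (Nambu N) (Nambu N) ℂ}

/-- Since ℋ₀² = 1 and the energies are positive, every half energy is 1. Hence all choices of U₀
conjugate ℋ₀ to the same matrix, and what follows does not depend on the choice. -/
theorem Diagonalizes.conj_zero_field
    (h₀ : Diagonalizes (isingMatrix fun _ : Fin N => 0) E₀ U₀) :
    U₀ * isingMatrix (fun _ : Fin N => 0) * U₀ᴴ = fieldMat N := by
  have h1 : (U₀ * isingMatrix (fun _ : Fin N => 0) * U₀ᴴ) *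
      (U₀ * isingMatrix (fun _ : Fin N => 0) * U₀ᴴ) = 1 := by
    rw [Matrix.mul_assoc (U₀ * _), ← Matrix.mul_assoc U₀ᴴ, ← Matrix.mul_assoc U₀ᴴ,
      h₀.conjTranspose_mul, Matrix.one_mul, ← Matrix.mul_assoc, Matrix.mul_assoc U₀,
      isingMatrix_zero_mul_self, Matrix.mul_one, h₀.mul_conjTranspose]
  rw [h₀.diag_halfLevels] at h1 ⊢
  rw [Matrix.diagonal_mul_diagonal, ← Matrix.diagonal_one] at h1
  have h2 : ∀ α, E₀ α / 2 = 1 := fun α => by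
    have h3 := congrFun (Matrix.diagonal_injective h1) (Sum.inl α)
    have h4 : E₀ α / 2 * (E₀ α / 2) = 1 := by exact_mod_cast h3
    nlinarith [h₀.pos α]
  ext (a | a) (b | b) <;>
    simp [fieldMat, Matrix.diagonal_apply, Matrix.one_apply, halfLevels, h2]
  split_ifs <;> simp

/-- The anticommutator identity read entrywise in an eigenbasis of ℋ₁. Entries of Uℋ₀U† vanish
unless they are diagonal or join opposite eigenvalues, that is, a particle and a hole of equal
energy. -/
theorem Diagonalizes.overlap_entry
    (hU : Diagonalizes (isingMatrix fun _ : Fin N => h) E U) (a b : Nambu N) :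
    ((halfLevels E a : ℂ) + halfLevels E b) *
      (U * isingMatrix (fun _ : Fin N => 0) * Uᴴ) a b =
      if a = b then (halfLevels E a : ℂ) ^ 2 + (1 - h ^ 2) else 0 := by
  have h1 := congrArg (fun M => U * M * Uᴴ) (isingMatrix_anticomm (N := N) h)
  have e : ∀ A B : Matrix (Nambu N) (Nambu N) ℂ, U * (A * B) * Uᴴ =
      (U * A * Uᴴ) * (U * B * Uᴴ) := by
    intro A B
    rw [Matrix.mul_assoc (U * A), ← Matrix.mul_assoc Uᴴ, ← Matrix.mul_assoc Uᴴ,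
      hU.conjTranspose_mul, Matrix.one_mul, ← Matrix.mul_assoc, ← Matrix.mul_assoc]
  simp only [mul_add, add_mul, e, hU.diag_halfLevels, Matrix.mul_smul, Matrix.smul_mul,
    Matrix.mul_one, hU.mul_conjTranspose] at h1
  have h2 := congrFun (congrFun h1 a) b
  simp only [Matrix.add_apply, Matrix.mul_diagonal, Matrix.diagonal_mul, Matrix.smul_apply,
    Matrix.diagonal_apply, Matrix.one_apply] at h2
  rw [add_comm (halfLevels E a : ℂ), add_mul, mul_comm (halfLevels E b : ℂ), h2]
  split_ifs with hab
  · subst hab; simp; ring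
  · simp

/-- Uℋ₀U† = W†ZW has first-row blocks that are differences of two products; the unitarity relations
W†W = 1 have the same products with a plus sign. Adding the two isolates W₁†W₁ and W₁†W₂. -/
theorem overlap_blocks (h₀ : Diagonalizes (isingMatrix fun _ : Fin N => 0) E₀ U₀)
    (hU : IsBogoliubov U) :
    (2 : ℂ) • ((blockW₁ U₀ U)ᴴ * blockW₁ U₀ U) =
      1 + (U * isingMatrix (fun _ : Fin N => 0) * Uᴴ).toBlocks₁₁ ∧
    (2 : ℂ) • ((blockW₁ U₀ U)ᴴ * blockW₂ U₀ U) =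
      (U * isingMatrix (fun _ : Fin N => 0) * Uᴴ).toBlocks₁₂ := by
  have hW := h₀.isBogoliubov.mul hU.inv
  have h1 : U * isingMatrix (fun _ : Fin N => 0) * Uᴴ =
      (U₀ * U⁻¹)ᴴ * fieldMat N * (U₀ * U⁻¹) := by
    rw [inv_eq_conjTranspose hU.1, ← h₀.conj_zero_field, Matrix.conjTranspose_mul,
      Matrix.conjTranspose_conjTranspose]
    have e := h₀.conjTranspose_mul
    calc _ = U * (U₀ᴴ * U₀) * isingMatrix (fun _ : Fin N => 0) * (U₀ᴴ * U₀) * Uᴴ := by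
          rw [e]; simp
      _ = _ := by simp only [Matrix.mul_assoc]
  have hb := hW.block_relations'
  rw [h1]
  change _ = 1 + ((U₀ * U⁻¹)ᴴ * fieldMat N * (U₀ * U⁻¹)).toBlocks₁₁ ∧ _
  have e1 : blockW₁ U₀ U = (U₀ * U⁻¹).toBlocks₁₁ := rfl
  have e2 : blockW₂ U₀ U = (U₀ * U⁻¹).toBlocks₁₂ := rfl
  rw [e1, e2]
  have h3 := hW.eq_fromBlocks
  set W := U₀ * U⁻¹
  have h4 : Wᴴ * fieldMat N * W = Matrix.fromBlocks
      (W.toBlocks₁₁ᴴ * W.toBlocks₁₁ - W.toBlocks₁₂ᵀ * conjMat W.toBlocks₁₂)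
      (W.toBlocks₁₁ᴴ * W.toBlocks₁₂ - W.toBlocks₁₂ᵀ * conjMat W.toBlocks₁₁)
      (W.toBlocks₁₂ᴴ * W.toBlocks₁₁ - W.toBlocks₁₁ᵀ * conjMat W.toBlocks₁₂)
      (W.toBlocks₁₂ᴴ * W.toBlocks₁₂ - W.toBlocks₁₁ᵀ * conjMat W.toBlocks₁₁) := by
    conv_lhs => rw [h3]
    rw [Matrix.fromBlocks_conjTranspose, fieldMat, Matrix.fromBlocks_multiply,
      Matrix.fromBlocks_multiply, conjTranspose_conjMat, conjTranspose_conjMat]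
    simp [sub_eq_add_neg]
  rw [h4, Matrix.toBlocks_fromBlocks₁₁, Matrix.toBlocks_fromBlocks₁₂, ← hb.1, two_smul, two_smul]
  refine ⟨by abel, ?_⟩
  rw [← sub_eq_zero, ← hb.2]
  abel

/-- The squared norm of a column of the `W₁` block of the clean chain, as a function of the half
energy. -/
noncomputable def overlapWeight (h ε : ℝ) : ℝ := ((ε + 1) ^ 2 - h ^ 2) / (4 * ε)

/-- The squared modulus of the pairing amplitude of the clean chain. -/
noncomputable def pairWeight (h ε : ℝ) : ℝ :=
  (h ^ 2 - (ε - 1) ^ 2) / ((ε + 1) ^ 2 - h ^ 2)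

theorem overlapWeight_pos {ε : ℝ} (hh : 1 < h) (hε : h - 1 < ε) : 0 < overlapWeight h ε := by
  unfold overlapWeight
  have : 0 < (ε + 1) ^ 2 - h ^ 2 := by nlinarith
  have : 0 < ε := by linarith
  positivity

theorem inv_overlapWeight_sub_one {ε : ℝ} (hh : 1 < h) (hε : h - 1 < ε) :
    (overlapWeight h ε)⁻¹ - 1 = pairWeight h ε := by
  unfold overlapWeight pairWeight
  have : (ε + 1) ^ 2 - h ^ 2 ≠ 0 := by nlinarith
  have : 0 < ε := by linarith
  rw [inv_div]
  field_simp
  ring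

/-- The weight is (h + 1 - ε)(ε + h - 1) divided by (ε - (h - 1))(ε + h + 1). The first factor is
less than 2, and the second is smaller than ε + h + 1. -/
theorem pairWeight_le {ε : ℝ} (hh : 1 < h) (hε : h - 1 < ε) :
    pairWeight h ε ≤ 2 / (ε - (h - 1)) := by
  unfold pairWeight
  have h1 : 0 < ε - (h - 1) := by linarith
  have h2 : 0 < (ε + 1) ^ 2 - h ^ 2 := by nlinarith
  rw [div_le_div_iff₀ h2 h1]
  nlinarith [mul_pos h1 h1]

theorem sub_one_lt_cleanEnergy (hh : 1 < h) (α : Fin N) : h - 1 < cleanEnergy h α / 2 := by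
  have h1 := le_cleanEnergy_sub hh α
  have hN : (0 : ℝ) < N := by exact_mod_cast Fin.pos α
  have h2 : 0 < 2 * (2 * level α + 1 : ℝ) ^ 2 / N ^ 2 := by positivity
  linarith

theorem cleanEnergy_le (hh : 1 < h) (α : Fin N) : cleanEnergy h α / 2 ≤ h + 1 := by
  rw [cleanEnergy, mul_div_cancel_left₀ _ two_ne_zero]
  exact dispersion_le hh _

theorem clean_blockW₁ (hh : 1 < h) (h₀ : Diagonalizes (isingMatrix fun _ : Fin N => 0) E₀ U₀)
    (hU : Diagonalizes (isingMatrix fun _ : Fin N => h) (cleanEnergy h) U) :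
    (blockW₁ U₀ U)ᴴ * blockW₁ U₀ U =
      Matrix.diagonal fun α => (overlapWeight h (cleanEnergy h α / 2) : ℂ) := by
  have h1 := (overlap_blocks h₀ hU.isBogoliubov).1
  have h2 : (blockW₁ U₀ U)ᴴ * blockW₁ U₀ U = (1 / 2 : ℂ) •
      (1 + (U * isingMatrix (fun _ : Fin N => 0) * Uᴴ).toBlocks₁₁) := by
    rw [← h1, smul_smul]; norm_num
  rw [h2]
  ext α β
  have h3 := hU.overlap_entry (Sum.inl α) (Sum.inl β)
  have hα := sub_one_lt_cleanEnergy hh α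
  have hβ := sub_one_lt_cleanEnergy hh β
  simp only [halfLevels, Sum.elim_inl, Sum.inl.injEq] at h3
  rw [Matrix.smul_apply, Matrix.add_apply, Matrix.toBlocks₁₁, Matrix.of_apply,
    Matrix.diagonal_apply, Matrix.one_apply]
  have hne : ((cleanEnergy h α / 2 : ℝ) : ℂ) + ((cleanEnergy h β / 2 : ℝ) : ℂ) ≠ 0 := by
    exact_mod_cast (by linarith : (0 : ℝ) < cleanEnergy h α / 2 + cleanEnergy h β / 2).ne'
  split_ifs at h3 ⊢ with hαβ
  · subst hαβ
    rw [overlapWeight]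
    have hx : ((cleanEnergy h α / 2 : ℝ) : ℂ) ≠ 0 := by
      exact_mod_cast (by linarith : (0 : ℝ) < cleanEnergy h α / 2).ne'
    rw [eq_div_of_mul_eq hne ((mul_comm _ _).trans h3)]
    generalize cleanEnergy h α / 2 = x at hx hne
    push_cast
    rw [smul_eq_mul, ← two_mul]
    field_simp
    ring
  · rw [mul_eq_zero] at h3
    rw [h3.resolve_left hne]
    simp

theorem isUnit_clean_blockW₁ (hh : 1 < h)
    (h₀ : Diagonalizes (isingMatrix fun _ : Fin N => 0) E₀ U₀)
    (hU : Diagonalizes (isingMatrix fun _ : Fin N => h) (cleanEnergy h) U) :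
    IsUnit (blockW₁ U₀ U) := by
  rw [Matrix.isUnit_iff_isUnit_det, isUnit_iff_ne_zero]
  intro h1
  have h2 := congrArg Matrix.det (clean_blockW₁ hh h₀ hU)
  rw [Matrix.det_mul, h1, mul_zero, Matrix.det_diagonal] at h2
  refine Finset.prod_ne_zero_iff.2 (fun α _ => ?_) h2.symm
  exact_mod_cast (overlapWeight_pos hh (sub_one_lt_cleanEnergy hh α)).ne'

/-- Multiplying W₁G = -W₂ by W₁† expresses G as an invertible diagonal matrix times the
particle-hole block of Uℋ₀U†, which vanishes between different energies. -/
theorem clean_bcsMatrix_eq_zero (hh : 1 < h)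
    (h₀ : Diagonalizes (isingMatrix fun _ : Fin N => 0) E₀ U₀)
    (hU : Diagonalizes (isingMatrix fun _ : Fin N => h) (cleanEnergy h) U) {α β : Fin N}
    (hαβ : cleanEnergy h α ≠ cleanEnergy h β) : bcsMatrix U₀ U α β = 0 := by
  have h1 := blockW₁_mul_bcsMatrix (isUnit_clean_blockW₁ hh h₀ hU)
  have h2 : (2 : ℂ) • ((blockW₁ U₀ U)ᴴ * blockW₁ U₀ U * bcsMatrix U₀ U) =
      -(U * isingMatrix (fun _ : Fin N => 0) * Uᴴ).toBlocks₁₂ := by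
    rw [Matrix.mul_assoc, h1, ← (overlap_blocks h₀ hU.isBogoliubov).2, Matrix.mul_neg, smul_neg]
  rw [clean_blockW₁ hh h₀ hU] at h2
  have h3 := congrFun (congrFun h2 α) β
  rw [Matrix.smul_apply, Matrix.diagonal_mul, Matrix.neg_apply, Matrix.toBlocks₁₂,
    Matrix.of_apply] at h3
  have h4 := hU.overlap_entry (Sum.inl α) (Sum.inr β)
  rw [if_neg (by simp)] at h4
  simp only [halfLevels, Sum.elim_inl, Sum.elim_inr] at h4
  have h5 : (U * isingMatrix (fun _ : Fin N => 0) * Uᴴ) (Sum.inl α) (Sum.inr β) = 0 := by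
    refine (mul_eq_zero.1 h4).resolve_left fun h6 => hαβ ?_
    have h7 : cleanEnergy h α / 2 + -(cleanEnergy h β / 2) = 0 := by exact_mod_cast h6
    linarith
  rw [h5, neg_zero] at h3
  have h6 : (overlapWeight h (cleanEnergy h α / 2) : ℂ) ≠ 0 := by
    exact_mod_cast (overlapWeight_pos hh (sub_one_lt_cleanEnergy hh α)).ne'
  simpa [h6] using h3

/-- The relation W₁W₁† + W₂W₂† = 1 becomes W₁(1 + GG†)W₁† = 1, so 1 + GG† is the inverse of the
diagonal matrix W₁†W₁. -/
theorem clean_bcsMatrix_mul_conjTranspose (hh : 1 < h)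
    (h₀ : Diagonalizes (isingMatrix fun _ : Fin N => 0) E₀ U₀)
    (hU : Diagonalizes (isingMatrix fun _ : Fin N => h) (cleanEnergy h) U) :
    bcsMatrix U₀ U * (bcsMatrix U₀ U)ᴴ =
      Matrix.diagonal fun α => (pairWeight h (cleanEnergy h α / 2) : ℂ) := by
  have hu := isUnit_clean_blockW₁ hh h₀ hU
  have h1 := blockW₁_mul_bcsMatrix hu
  have h2 : blockW₁ U₀ U * (blockW₁ U₀ U)ᴴ + blockW₂ U₀ U * (blockW₂ U₀ U)ᴴ = 1 :=
    (h₀.isBogoliubov.mul hU.isBogoliubov.inv).block_relations.1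
  have h3 := clean_blockW₁ hh h₀ hU
  set A := blockW₁ U₀ U
  set B := blockW₂ U₀ U
  set G := bcsMatrix U₀ U
  set D := Matrix.diagonal fun α => (overlapWeight h (cleanEnergy h α / 2) : ℂ)
  have h4 : A * (1 + G * Gᴴ) * Aᴴ = 1 := by
    rw [mul_add, add_mul, mul_one, ← Matrix.mul_assoc, h1, Matrix.mul_assoc,
      ← Matrix.conjTranspose_mul, h1, Matrix.conjTranspose_neg, neg_mul_neg, h2]
  have h5 : A * ((1 + G * Gᴴ) * D) = A := by
    rw [← h3, ← Matrix.mul_assoc, ← Matrix.mul_assoc, h4, Matrix.one_mul]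
  have h6 : (1 + G * Gᴴ) * D = 1 := hu.mul_left_cancel (by rw [h5, Matrix.mul_one])
  have h7 : D * Matrix.diagonal (fun α => ((overlapWeight h (cleanEnergy h α / 2))⁻¹ : ℂ)) = 1 := by
    rw [Matrix.diagonal_mul_diagonal, ← Matrix.diagonal_one]
    congr 1
    ext α
    refine mul_inv_cancel₀ ?_
    exact_mod_cast (overlapWeight_pos hh (sub_one_lt_cleanEnergy hh α)).ne'
  have h8 : 1 + G * Gᴴ = Matrix.diagonal
      (fun α => ((overlapWeight h (cleanEnergy h α / 2))⁻¹ : ℂ)) := by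
    have h9 := congrArg (fun M => (1 + G * Gᴴ) * M) h7
    simp only [← Matrix.mul_assoc, h6, Matrix.one_mul, Matrix.mul_one] at h9
    exact h9.symm
  rw [← add_sub_cancel_left 1 (G * Gᴴ), h8, ← Matrix.diagonal_one, Matrix.diagonal_sub]
  congr 1
  ext α
  rw [← inv_overlapWeight_sub_one hh (sub_one_lt_cleanEnergy hh α)]
  push_cast
  rfl

theorem clean_bcsMatrix_conjTranspose_mul (hh : 1 < h)
    (h₀ : Diagonalizes (isingMatrix fun _ : Fin N => 0) E₀ U₀)
    (hU : Diagonalizes (isingMatrix fun _ : Fin N => h) (cleanEnergy h) U) :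
    (bcsMatrix U₀ U)ᴴ * bcsMatrix U₀ U =
      Matrix.diagonal fun α => (pairWeight h (cleanEnergy h α / 2) : ℂ) := by
  have h1 := transpose_bcsMatrix h₀.isBogoliubov hU.isBogoliubov (isUnit_clean_blockW₁ hh h₀ hU)
  have h2 := congrArg conjMat (clean_bcsMatrix_mul_conjTranspose hh h₀ hU)
  rw [conjMat_diagonal_real, conjMat_mul, conjMat_conjTranspose, h1] at h2
  have h3 : (bcsMatrix U₀ U)ᴴ = -conjMat (bcsMatrix U₀ U) := by
    rw [← conjMat_neg, ← h1]
    rfl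
  rw [← h2, h3, neg_mul, mul_neg]

theorem sum_sq_row_clean_bcsMatrix (hh : 1 < h)
    (h₀ : Diagonalizes (isingMatrix fun _ : Fin N => 0) E₀ U₀)
    (hU : Diagonalizes (isingMatrix fun _ : Fin N => h) (cleanEnergy h) U) (α : Fin N) :
    ∑ γ, ‖bcsMatrix U₀ U α γ‖ ^ 2 = pairWeight h (cleanEnergy h α / 2) := by
  have h1 := congrFun (congrFun (clean_bcsMatrix_mul_conjTranspose hh h₀ hU) α) α
  rw [Matrix.mul_apply, Matrix.diagonal_apply_eq] at h1
  have h2 : ((∑ γ, ‖bcsMatrix U₀ U α γ‖ ^ 2 : ℝ) : ℂ) =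
      (pairWeight h (cleanEnergy h α / 2) : ℂ) := by
    rw [← h1]
    push_cast
    refine Finset.sum_congr rfl fun γ _ => ?_
    rw [Matrix.conjTranspose_apply, Complex.star_def, Complex.mul_conj']
  exact_mod_cast h2

theorem sum_sq_col_clean_bcsMatrix (hh : 1 < h)
    (h₀ : Diagonalizes (isingMatrix fun _ : Fin N => 0) E₀ U₀)
    (hU : Diagonalizes (isingMatrix fun _ : Fin N => h) (cleanEnergy h) U) (β : Fin N) :
    ∑ γ, ‖bcsMatrix U₀ U γ β‖ ^ 2 = pairWeight h (cleanEnergy h β / 2) := by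
  rw [← sum_sq_row_clean_bcsMatrix hh h₀ hU]
  refine Finset.sum_congr rfl fun γ _ => ?_
  have h1 := congrFun (congrFun (transpose_bcsMatrix h₀.isBogoliubov hU.isBogoliubov
    (isUnit_clean_blockW₁ hh h₀ hU)) β) γ
  rw [Matrix.transpose_apply, Matrix.neg_apply] at h1
  rw [h1, norm_neg]

theorem pairWeight_clean_le (hh : 1 < h) (α : Fin N) :
    pairWeight h (cleanEnergy h α / 2) ≤ (N : ℝ) ^ 2 := by
  have h1 := pairWeight_le hh (sub_one_lt_cleanEnergy hh α)
  have h2 := le_cleanEnergy_sub hh α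
  have hN : (0 : ℝ) < N := by exact_mod_cast Fin.pos α
  have h3 : 2 / (N : ℝ) ^ 2 ≤ cleanEnergy h α / 2 - (h - 1) := by
    refine le_trans ?_ h2
    gcongr
    have : (0 : ℝ) ≤ level α := by positivity
    nlinarith
  refine h1.trans ?_
  rw [div_le_iff₀ (by linarith [sub_one_lt_cleanEnergy hh α])]
  rw [div_le_iff₀ (by positivity)] at h3
  linarith

/-- By the C*-identity the norm of G is the largest √p, attained near the band edge. This growth in
N is why ‖V‖ has to be as small as N⁻³. -/
theorem norm_clean_bcsMatrix_le (hh : 1 < h)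
    (h₀ : Diagonalizes (isingMatrix fun _ : Fin N => 0) E₀ U₀)
    (hU : Diagonalizes (isingMatrix fun _ : Fin N => h) (cleanEnergy h) U) :
    ‖bcsMatrix U₀ U‖ ≤ N := by
  have h1 := Matrix.l2_opNorm_conjTranspose_mul_self (bcsMatrix U₀ U)
  rw [clean_bcsMatrix_conjTranspose_mul hh h₀ hU, Matrix.l2_opNorm_diagonal] at h1
  have h2 : ‖fun α : Fin N => (pairWeight h (cleanEnergy h α / 2) : ℂ)‖ ≤ (N : ℝ) ^ 2 := by
    rw [pi_norm_le_iff_of_nonneg (by positivity)]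
    intro α
    rw [Complex.norm_real, Real.norm_of_nonneg]
    · exact pairWeight_clean_le hh α
    · rw [← sum_sq_row_clean_bcsMatrix hh h₀ hU]; positivity
  refine le_of_sq_le_sq ?_ (by positivity)
  nlinarith

end Clean

/-! ### Unitary polar factors. -/

section Polar

variable {n : Type*} [Fintype n] [DecidableEq n]

/-- The unitary polar factor of a matrix `P` with `P Pᴴ` close to `1`. -/
theorem exists_polar {P : Matrix n n ℂ} (hP : ‖P * Pᴴ - 1‖ ≤ 1 / 2) :
    ∃ q : Matrix n n ℂ, q * qᴴ = 1 ∧ ‖P * qᴴ - 1‖ ≤ ‖P * Pᴴ - 1‖ ∧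
      ∀ D, Commute P D → Commute Pᴴ D → Commute q D := by
  set Y := P * Pᴴ with hY
  have hsa : IsSelfAdjoint Y := by
    rw [isSelfAdjoint_iff, Matrix.star_eq_conjTranspose, hY, Matrix.conjTranspose_mul,
      Matrix.conjTranspose_conjTranspose]
  have hsub : cfc (fun x : ℝ => x - 1) Y = Y - 1 := by
    rw [cfc_sub (fun x : ℝ => x) (fun _ => 1) Y, cfc_id' ℝ Y, cfc_const_one ℝ Y]
  have hspec : ∀ x ∈ spectrum ℝ Y, |x - 1| ≤ ‖Y - 1‖ := by
    rw [← hsub]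
    exact (norm_cfc_le_iff (fun x : ℝ => x - 1) Y (norm_nonneg _)).1 le_rfl
  have hpos : ∀ x ∈ spectrum ℝ Y, 0 < x := fun x hx => by
    have := (abs_le.1 ((hspec x hx).trans hP)).1
    linarith
  have hcont : ContinuousOn (fun x : ℝ => (√x)⁻¹) (spectrum ℝ Y) :=
    Real.continuous_sqrt.continuousOn.inv₀ fun x hx => (Real.sqrt_pos.2 (hpos x hx)).ne'
  set T := cfc (fun x : ℝ => (√x)⁻¹) Y with hT
  have hTsa : Tᴴ = T := by
    have : IsSelfAdjoint T := cfc_predicate _ _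
    exact this.star_eq
  have hYT : Y * T = cfc (fun x : ℝ => √x) Y := by
    have h0 := cfc_mul (fun x : ℝ => x) _ Y (by fun_prop) hcont
    rw [cfc_id' ℝ Y] at h0
    rw [hT, ← h0]
    refine cfc_congr fun x hx => ?_
    have h1 := hpos x hx
    have h2 := Real.sqrt_pos.2 h1
    field_simp
    rw [Real.sq_sqrt h1.le]
  have hTYT : T * (Y * T) = 1 := by
    rw [hYT, hT, ← cfc_mul _ _ Y hcont, ← cfc_const_one ℝ Y]
    refine cfc_congr fun x hx => ?_
    exact inv_mul_cancel₀ (Real.sqrt_pos.2 (hpos x hx)).ne'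
  -- The factor is q = Y^{-1/2}P with Y = PP†, so Pq† = Y^{1/2}. It is close to 1 since |√x - 1| ≤
  -- |x - 1|, and whatever commutes with P and P† commutes with Y and its functions.
  refine ⟨T * P, ?_, ?_, fun D h1 h2 => ?_⟩
  · rw [Matrix.conjTranspose_mul, hTsa, ← Matrix.mul_assoc, Matrix.mul_assoc T P, ← hY,
      Matrix.mul_assoc, hTYT]
  · rw [Matrix.conjTranspose_mul, hTsa, ← Matrix.mul_assoc, ← hY, hYT, ← cfc_const_one ℝ Y,
      ← cfc_sub (fun x : ℝ => √x) (fun _ => 1) Y]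
    rw [cfc_const_one ℝ Y]
    refine norm_cfc_le (norm_nonneg _) fun x hx => (le_trans ?_ (hspec x hx))
    have h1 := hpos x hx
    have h3 : (√x - 1) * (√x + 1) = x - 1 := by nlinarith [Real.sq_sqrt h1.le]
    rw [Real.norm_eq_abs, ← h3, abs_mul]
    have h4 : 1 ≤ |√x + 1| := by
      rw [abs_of_pos (by positivity)]
      linarith [Real.sqrt_nonneg x]
    nlinarith [abs_nonneg (√x - 1)]
  · exact ((h1.mul_left h2).cfc_real _).mul_left h1

end Polar

/-! ### Comparison of two diagonalizations and rotations inside levels. -/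

section Adapt

variable {N : ℕ} {H H' : Matrix (Nambu N) (Nambu N) ℂ} {E E' : Fin N → ℝ}
  {U U' : Matrix (Nambu N) (Nambu N) ℂ}

/-- An exact identity, not a first-order one: sandwich H' - H between a perturbed and an unperturbed
eigenvector and let each Hamiltonian act on its own side. -/
theorem Diagonalizes.mul_inv_entry (hU : Diagonalizes H E U) (hU' : Diagonalizes H' E' U')
    (a b : Nambu N) : ((halfLevels E' a - halfLevels E b : ℝ) : ℂ) * (U' * U⁻¹) a b =
      (U' * (H' - H) * Uᴴ) a b := by
  have h1 : U' * (H' - H) * Uᴴ = (Matrix.diagonal fun a => (halfLevels E' a : ℂ)) * (U' * Uᴴ) -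
      (U' * Uᴴ) * (Matrix.diagonal fun a => (halfLevels E a : ℂ)) := by
    rw [mul_sub, sub_mul, hU'.mul_eq, Matrix.mul_assoc]
    congr 1
    rw [← hU.diag_halfLevels, Matrix.mul_assoc U' Uᴴ, ← Matrix.mul_assoc Uᴴ, ← Matrix.mul_assoc Uᴴ,
      hU.conjTranspose_mul, Matrix.one_mul, Matrix.mul_assoc]
  rw [h1, inv_eq_conjTranspose hU.unitary, Matrix.sub_apply, Matrix.diagonal_mul,
    Matrix.mul_diagonal]
  push_cast
  ring

/-- The freedom in the quasiparticle basis: a unitary mixing of the η that commutes with the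
energies, with its conjugate acting on the η†. -/
theorem Diagonalizes.rotate (hU : Diagonalizes H E U) {q : Matrix (Fin N) (Fin N) ℂ}
    (hq : q * qᴴ = 1) (hc : Commute q (Matrix.diagonal fun α => (E α : ℂ))) :
    Diagonalizes H E (Matrix.fromBlocks q 0 0 (conjMat q) * U) := by
  have hq' : conjMat q * qᵀ = 1 := by
    rw [← conjMat_conjTranspose, ← conjMat_mul, hq, conjMat_one]
  have hQ : Matrix.fromBlocks q 0 0 (conjMat q) * (Matrix.fromBlocks q 0 0 (conjMat q))ᴴ = 1 := by
    rw [Matrix.fromBlocks_conjTranspose, Matrix.fromBlocks_multiply, conjTranspose_conjMat]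
    simp [hq, hq']
  have hB : IsBogoliubov (Matrix.fromBlocks q 0 0 (conjMat q)) :=
    ⟨Matrix.mem_unitaryGroup_iff.2 hQ, q, 0, by congr 1; ext; exact (star_zero ℂ).symm⟩
  have hc' : Commute (conjMat q) (Matrix.diagonal fun α => (E α : ℂ)) := by
    have h1 := congrArg conjMat hc.eq
    rw [conjMat_mul, conjMat_mul, conjMat_diagonal_real] at h1
    exact h1
  have hU2 := hB.mul hU.isBogoliubov
  refine ⟨hU2.1, hU2.2, hU.pos, hU.ordered, ?_⟩
  have e : (1 / 2 : ℂ) • Matrix.diagonal (Sum.elim (fun α => (E α : ℂ)) (fun α => -(E α : ℂ))) =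
      (1 / 2 : ℂ) • Matrix.fromBlocks (Matrix.diagonal fun α => (E α : ℂ)) 0 0
        (-Matrix.diagonal fun α => (E α : ℂ)) := by
    rw [Matrix.diagonal_neg, Matrix.fromBlocks_diagonal]
  rw [Matrix.conjTranspose_mul, ← Matrix.mul_assoc, Matrix.mul_assoc _ U H, Matrix.mul_assoc _ _ Uᴴ,
    hU.diag, e, Matrix.mul_smul, Matrix.smul_mul]
  congr 1
  have h2 : Matrix.fromBlocks q 0 0 (conjMat q) * Matrix.fromBlocks
      (Matrix.diagonal fun α => (E α : ℂ)) 0 0 (-Matrix.diagonal fun α => (E α : ℂ)) =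
      Matrix.fromBlocks (Matrix.diagonal fun α => (E α : ℂ)) 0 0
        (-Matrix.diagonal fun α => (E α : ℂ)) * Matrix.fromBlocks q 0 0 (conjMat q) := by
    rw [Matrix.fromBlocks_multiply, Matrix.fromBlocks_multiply]
    have h3 : conjMat q * -(Matrix.diagonal fun α => (E α : ℂ)) =
        -(Matrix.diagonal fun α => (E α : ℂ)) * conjMat q := by rw [mul_neg, neg_mul, hc'.eq]
    rw [hc.eq, h3]
    simp only [Matrix.mul_zero, Matrix.zero_mul]
  rw [h2, Matrix.mul_assoc, hQ, Matrix.mul_one]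

/-- The part of a matrix between equal energies. -/
noncomputable def levelPart (E : Fin N → ℝ) (A : Matrix (Fin N) (Fin N) ℂ) : Matrix (Fin N) (Fin N) ℂ :=
  Matrix.of fun α β => if E α = E β then A α β else 0

theorem commute_levelPart (E : Fin N → ℝ) (A : Matrix (Fin N) (Fin N) ℂ) :
    Commute (levelPart E A) (Matrix.diagonal fun α => (E α : ℂ)) := by
  change _ * _ = _ * _
  ext α β
  rw [Matrix.mul_diagonal, Matrix.diagonal_mul, levelPart, Matrix.of_apply]
  split_ifs with h
  · rw [h, mul_comm]
  · simp

theorem levelPart_conjTranspose (E : Fin N → ℝ) (A : Matrix (Fin N) (Fin N) ℂ) :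
    (levelPart E A)ᴴ = levelPart E Aᴴ := by
  ext α β
  simp only [levelPart, Matrix.conjTranspose_apply, Matrix.of_apply]
  by_cases h : E α = E β
  · rw [if_pos h, if_pos h.symm]
  · rw [if_neg h, if_neg (Ne.symm h), star_zero]

theorem apply_eq_zero_of_commute {q : Matrix (Fin N) (Fin N) ℂ}
    (hc : Commute q (Matrix.diagonal fun α => (E α : ℂ))) {α β : Fin N} (h : E α ≠ E β) :
    q α β = 0 := by
  have h1 := congrFun (congrFun hc.eq α) β
  rw [Matrix.mul_diagonal, Matrix.diagonal_mul] at h1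
  have h2 : ((E α : ℂ) - E β) * q α β = 0 := by linear_combination -h1
  refine (mul_eq_zero.1 h2).resolve_left (sub_ne_zero.2 ?_)
  exact_mod_cast h

theorem levelPart_mul_of_commute {A q : Matrix (Fin N) (Fin N) ℂ}
    (hc : Commute q (Matrix.diagonal fun α => (E α : ℂ))) :
    levelPart E (A * q) = levelPart E A * q := by
  ext α β
  rw [Matrix.mul_apply]
  simp only [levelPart, Matrix.of_apply, Matrix.mul_apply]
  split_ifs with h
  · refine Finset.sum_congr rfl fun γ _ => ?_
    split_ifs with h1
    · rfl
    · rw [apply_eq_zero_of_commute hc (fun h2 => h1 (h.trans h2.symm)), mul_zero, zero_mul]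
  · refine (Finset.sum_eq_zero fun γ _ => ?_).symm
    split_ifs with h1
    · rw [apply_eq_zero_of_commute hc (fun h2 => h (h1.trans h2)), mul_zero]
    · rw [zero_mul]

theorem norm_mul_conjTranspose_apply_le {m n : Type*} [Fintype n] (A : Matrix m n ℂ) (i j : m) :
    ‖(A * Aᴴ) i j‖ ^ 2 ≤ (∑ k, ‖A i k‖ ^ 2) * ∑ k, ‖A j k‖ ^ 2 := by
  rw [Matrix.mul_apply]
  calc ‖∑ k, A i k * Aᴴ k j‖ ^ 2 ≤ (∑ k, ‖A i k‖ * ‖A j k‖) ^ 2 := by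
        gcongr
        refine (norm_sum_le _ _).trans (le_of_eq ?_)
        simp
    _ ≤ _ := Finset.sum_mul_sq_le_sq_mul_sq _ _ _

theorem norm_levelPart_mul_conjTranspose_le (E : Fin N → ℝ) (A : Matrix (Fin N) (Fin N) ℂ) :
    ‖levelPart E (A * Aᴴ)‖ ≤ ∑ α, ∑ β, ‖A α β‖ ^ 2 := by
  have h0 : 0 ≤ ∑ α, ∑ β, ‖A α β‖ ^ 2 :=
    Finset.sum_nonneg fun α _ => Finset.sum_nonneg fun β _ => by positivity
  refine le_of_sq_le_sq ((sq_opNorm_le_sum _).trans ?_) h0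
  rw [pow_two (∑ α, ∑ β, ‖A α β‖ ^ 2), Finset.sum_mul_sum]
  refine Finset.sum_le_sum fun α _ => Finset.sum_le_sum fun β _ => ?_
  refine le_trans ?_ (norm_mul_conjTranspose_apply_le A α β)
  rw [levelPart, Matrix.of_apply]
  split_ifs
  · rfl
  · rw [norm_zero, zero_pow two_ne_zero]
    positivity

/-- Split P into its part inside levels and the rest. Inside a level the mixed products vanish, so
the defect from unitarity is quadratic in the off-level part and in R. -/
theorem levelPart_mul_levelPart_conjTranspose {P R : Matrix (Fin N) (Fin N) ℂ}
    (h : P * Pᴴ + R * Rᴴ = 1) :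
    levelPart E P * (levelPart E P)ᴴ - 1 =
      -(levelPart E ((P - levelPart E P) * (P - levelPart E P)ᴴ) + levelPart E (R * Rᴴ)) := by
  ext α β
  have h1 := congrFun (congrFun h α) β
  rw [Matrix.add_apply, Matrix.mul_apply] at h1
  simp only [Matrix.sub_apply, Matrix.neg_apply, Matrix.add_apply, levelPart, Matrix.of_apply]
  rw [Matrix.mul_apply]
  split_ifs with hαβ
  · rw [← h1, Matrix.mul_apply, ← sub_eq_zero]
    simp only [sub_neg_eq_add]
    rw [show ∀ a b c d : ℂ, a - (b + c) + (d + c) = a + d - b by intros; ring, Matrix.mul_apply,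
      ← Finset.sum_add_distrib, ← Finset.sum_sub_distrib]
    refine Finset.sum_eq_zero fun γ _ => ?_
    simp only [Matrix.conjTranspose_apply, Matrix.sub_apply, Matrix.of_apply, ← hαβ]
    split_ifs <;> simp
  · rw [Matrix.one_apply_ne (fun h2 => hαβ (by rw [h2])), sub_zero, add_zero, neg_zero]
    refine Finset.sum_eq_zero fun γ _ => ?_
    simp only [Matrix.conjTranspose_apply, Matrix.of_apply]
    split_ifs with h2 h3
    · exact absurd (h2.trans h3.symm) hαβ
    · simp
    · simp
    · simp

theorem norm_unitary_conj_le (hU : U ∈ Matrix.unitaryGroup (Nambu N) ℂ)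
    (hU' : U' ∈ Matrix.unitaryGroup (Nambu N) ℂ) (V : Matrix (Nambu N) (Nambu N) ℂ) :
    ‖U' * V * Uᴴ‖ ≤ ‖V‖ :=
  norm_mul_mul_le (norm_le_one_of_mem_unitary hU')
    (by rw [Matrix.l2_opNorm_conjTranspose]; exact norm_le_one_of_mem_unitary hU) _

end Adapt

/-! ### Size of the level mixing and the adapted quasiparticle basis. -/

section Estimates

variable {N : ℕ} {h : ℝ} {V : Matrix (Nambu N) (Nambu N) ℂ} {E' : Fin N → ℝ}
  {U U' : Matrix (Nambu N) (Nambu N) ℂ}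

/-- The hypothesis on ‖V‖ limits the energy shift 2‖V‖ to half the minimal gap 1/(2N²), so perturbed
denominators are at least half the clean ones. -/
theorem half_gap_le (hh : 1 < h)
    (hU : Diagonalizes (isingMatrix fun _ : Fin N => h) (cleanEnergy h) U)
    (hU' : Diagonalizes ((isingMatrix fun _ : Fin N => h) + V) E' U')
    (hv : 8 * (N : ℝ) ^ 2 * ‖V‖ ≤ 1) {α β : Fin N} (hne : cleanEnergy h α ≠ cleanEnergy h β) :
    |cleanEnergy h α - cleanEnergy h β| / 2 ≤ |E' α - cleanEnergy h β| := by
  have h1 := hU.abs_energy_sub_le hU' α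
  rw [add_sub_cancel_left] at h1
  have h2 := min_gap hh hne
  have hN : (0 : ℝ) < N := by exact_mod_cast Fin.pos α
  have h3 : 2 * ‖V‖ ≤ 1 / (2 * (N : ℝ) ^ 2) / 2 := by
    rw [div_div, le_div_iff₀ (by positivity)]
    linarith
  have h4 := abs_sub_abs_le_abs_sub (cleanEnergy h α - cleanEnergy h β) (E' α - cleanEnergy h β)
  have h5 : |cleanEnergy h α - cleanEnergy h β - (E' α - cleanEnergy h β)| =
      |E' α - cleanEnergy h α| := by rw [← abs_neg]; congr 1; ring
  linarith

theorem norm_offLevel_le (hh : 1 < h)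
    (hU : Diagonalizes (isingMatrix fun _ : Fin N => h) (cleanEnergy h) U)
    (hU' : Diagonalizes ((isingMatrix fun _ : Fin N => h) + V) E' U')
    (hv : 8 * (N : ℝ) ^ 2 * ‖V‖ ≤ 1) {α β : Fin N} (hne : cleanEnergy h α ≠ cleanEnergy h β) :
    ‖(U' * U⁻¹) (Sum.inl α) (Sum.inl β)‖ ≤ 4 * ‖V‖ / |cleanEnergy h α - cleanEnergy h β| := by
  have h1 := hU.mul_inv_entry hU' (Sum.inl α) (Sum.inl β)
  rw [add_sub_cancel_left] at h1
  have h2 := congrArg norm h1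
  rw [norm_mul, Complex.norm_real, Real.norm_eq_abs] at h2
  have h3 := (norm_entry_le (U' * V * Uᴴ) (Sum.inl α) (Sum.inl β)).trans
    (norm_unitary_conj_le hU.unitary hU'.unitary V)
  rw [← h2] at h3
  have h4 := half_gap_le hh hU hU' hv hne
  have h5 : |halfLevels E' (Sum.inl α) - halfLevels (cleanEnergy h) (Sum.inl β)| =
      |E' α - cleanEnergy h β| / 2 := by
    simp only [halfLevels, Sum.elim_inl]
    rw [← sub_div, abs_div, abs_of_pos (two_pos : (0 : ℝ) < 2)]
  rw [h5] at h3
  have h6 : 0 < |cleanEnergy h α - cleanEnergy h β| := abs_pos.2 (sub_ne_zero.2 hne)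
  rw [le_div_iff₀ h6]
  nlinarith [norm_nonneg ((U' * U⁻¹) (Sum.inl α) (Sum.inl β))]

theorem sum_sq_le_of_le_div_gap (hh : 1 < h) {A : Matrix (Fin N) (Fin N) ℂ} {c : ℝ}
    (h0 : ∀ α β, cleanEnergy h α = cleanEnergy h β → A α β = 0)
    (h1 : ∀ α β, cleanEnergy h α ≠ cleanEnergy h β →
      ‖A α β‖ ≤ c / |cleanEnergy h α - cleanEnergy h β|) :
    ∑ α, ∑ β, ‖A α β‖ ^ 2 ≤ 64 * c ^ 2 * (N : ℝ) ^ 4 := by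
  calc ∑ α, ∑ β, ‖A α β‖ ^ 2 ≤ ∑ α : Fin N, ∑ β : Fin N, c ^ 2 *
        (if cleanEnergy h α = cleanEnergy h β then 0 else
          1 / (cleanEnergy h α - cleanEnergy h β) ^ 2) := by
        refine Finset.sum_le_sum fun α _ => Finset.sum_le_sum fun β _ => ?_
        split_ifs with h2
        · simp [h0 α β h2]
        · rw [mul_one_div, ← sq_abs (cleanEnergy h α - cleanEnergy h β), ← div_pow]
          exact pow_le_pow_left₀ (norm_nonneg _) (h1 α β h2) 2
    _ = c ^ 2 * ∑ α : Fin N, ∑ β : Fin N,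
        (if cleanEnergy h α = cleanEnergy h β then 0 else
          1 / (cleanEnergy h α - cleanEnergy h β) ^ 2) := by
        rw [Finset.mul_sum]
        exact Finset.sum_congr rfl fun _ _ => (Finset.mul_sum _ _ _).symm
    _ ≤ c ^ 2 * (64 * (N : ℝ) ^ 4) := by gcongr; exact sum_inv_gap_sq_le hh
    _ = _ := by ring

theorem sum_sq_offLevel_le (hh : 1 < h)
    (hU : Diagonalizes (isingMatrix fun _ : Fin N => h) (cleanEnergy h) U)
    (hU' : Diagonalizes ((isingMatrix fun _ : Fin N => h) + V) E' U')
    (hv : 8 * (N : ℝ) ^ 2 * ‖V‖ ≤ 1) :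
    ∑ α, ∑ β, ‖((U' * U⁻¹).toBlocks₁₁ -
      levelPart (cleanEnergy h) (U' * U⁻¹).toBlocks₁₁) α β‖ ^ 2 ≤
      1024 * ‖V‖ ^ 2 * (N : ℝ) ^ 4 := by
  refine (sum_sq_le_of_le_div_gap hh (c := 4 * ‖V‖) (fun α β h1 => ?_) fun α β h1 => ?_).trans
    (le_of_eq (by ring))
  · simp [levelPart, h1]
  · rw [Matrix.sub_apply, levelPart, Matrix.of_apply, if_neg h1, sub_zero]
    exact norm_offLevel_le hh hU hU' hv h1

/-- Particle and hole levels are separated by at least h - 1 uniformly in N, and each row of U'VU†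
has ℓ² norm at most ‖V‖. Summing row by row costs a factor N where an entrywise bound would cost N².
-/
theorem sum_sq_pairBlock_le (hh : 1 < h)
    (hU : Diagonalizes (isingMatrix fun _ : Fin N => h) (cleanEnergy h) U)
    (hU' : Diagonalizes ((isingMatrix fun _ : Fin N => h) + V) E' U') :
    ∑ α, ∑ β, ‖(U' * U⁻¹).toBlocks₁₂ α β‖ ^ 2 ≤ N * (‖V‖ / (h - 1)) ^ 2 := by
  have h1 : ∀ α : Fin N, ∑ β, ‖(U' * U⁻¹).toBlocks₁₂ α β‖ ^ 2 ≤ (‖V‖ / (h - 1)) ^ 2 := by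
    intro α
    have hpos : 0 < h - 1 := by linarith
    have h2 : ∀ β : Fin N, ‖(U' * U⁻¹).toBlocks₁₂ α β‖ ^ 2 ≤
        ‖(U' * V * Uᴴ) (Sum.inl α) (Sum.inr β)‖ ^ 2 / (h - 1) ^ 2 := by
      intro β
      have e1 := hU.mul_inv_entry hU' (Sum.inl α) (Sum.inr β)
      rw [add_sub_cancel_left] at e1
      have e2 := congrArg norm e1
      rw [norm_mul, Complex.norm_real, Real.norm_eq_abs] at e2
      have e3 : h - 1 ≤ |halfLevels E' (Sum.inl α) - halfLevels (cleanEnergy h) (Sum.inr β)| := by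
        refine le_trans ?_ (le_abs_self _)
        simp only [halfLevels, Sum.elim_inl, Sum.elim_inr]
        linarith [hU'.pos α, sub_one_lt_cleanEnergy hh β]
      rw [← e2, ← div_pow]
      refine pow_le_pow_left₀ (norm_nonneg _) ?_ 2
      rw [le_div_iff₀ hpos, mul_comm]
      exact mul_le_mul_of_nonneg_right e3 (norm_nonneg _)
    have h3 := sum_sq_norm_row_le (U' * V * Uᴴ) (Sum.inl α)
    rw [Fintype.sum_sum_type] at h3
    have h4 : ∑ β, ‖(U' * V * Uᴴ) (Sum.inl α) (Sum.inr β)‖ ^ 2 ≤ ‖V‖ ^ 2 := by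
      refine le_trans ?_ (h3.trans (pow_le_pow_left₀ (norm_nonneg _)
        (norm_unitary_conj_le hU.unitary hU'.unitary V) 2))
      exact le_add_of_nonneg_left (Finset.sum_nonneg fun _ _ => by positivity)
    calc _ ≤ ∑ β, ‖(U' * V * Uᴴ) (Sum.inl α) (Sum.inr β)‖ ^ 2 / (h - 1) ^ 2 :=
          Finset.sum_le_sum fun β _ => h2 β
      _ = (∑ β, ‖(U' * V * Uᴴ) (Sum.inl α) (Sum.inr β)‖ ^ 2) / (h - 1) ^ 2 := by
          rw [Finset.sum_div]
      _ ≤ ‖V‖ ^ 2 / (h - 1) ^ 2 := by gcongr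
      _ = _ := by rw [div_pow]
  calc _ ≤ ∑ _α : Fin N, (‖V‖ / (h - 1)) ^ 2 := Finset.sum_le_sum fun α _ => h1 α
    _ = _ := by simp

/-- The quasiparticle basis of the clean chain adapted to a perturbation. -/
theorem exists_adapted (hh : 1 < h)
    (hU' : Diagonalizes ((isingMatrix fun _ : Fin N => h) + V) E' U')
    (hv : 8 * (N : ℝ) ^ 2 * ‖V‖ ≤ 1)
    (hδ : 1024 * ‖V‖ ^ 2 * (N : ℝ) ^ 4 + N * (‖V‖ / (h - 1)) ^ 2 ≤ 1 / 2) :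
    ∃ U, Diagonalizes (isingMatrix fun _ : Fin N => h) (cleanEnergy h) U ∧
      ‖levelPart (cleanEnergy h) (U' * U⁻¹).toBlocks₁₁ - 1‖ ≤
        1024 * ‖V‖ ^ 2 * (N : ℝ) ^ 4 + N * (‖V‖ / (h - 1)) ^ 2 := by
  obtain ⟨U, hU⟩ : ∃ U, Diagonalizes (isingMatrix fun _ : Fin N => h) (cleanEnergy h) U := by
    have h1 := diagonalizes_modes (N := N) hh
    exact ⟨_, by rw [← h1.energy_eq hh]; exact h1⟩
  have hX := hU'.isBogoliubov.mul hU.isBogoliubov.inv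
  set P := (U' * U⁻¹).toBlocks₁₁ with hP
  set R := (U' * U⁻¹).toBlocks₁₂ with hR
  have h1 := levelPart_mul_levelPart_conjTranspose (E := cleanEnergy h) hX.block_relations.1
  have h2 : ‖levelPart (cleanEnergy h) P * (levelPart (cleanEnergy h) P)ᴴ - 1‖ ≤
      1024 * ‖V‖ ^ 2 * (N : ℝ) ^ 4 + N * (‖V‖ / (h - 1)) ^ 2 := by
    rw [h1, norm_neg]
    exact (norm_add_le _ _).trans (add_le_add
      ((norm_levelPart_mul_conjTranspose_le _ _).trans (sum_sq_offLevel_le hh hU hU' hv))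
      ((norm_levelPart_mul_conjTranspose_le _ _).trans (sum_sq_pairBlock_le hh hU hU')))
  obtain ⟨q, hq, hq1, hq2⟩ := exists_polar (h2.trans hδ)
  have hc : Commute q (Matrix.diagonal fun α => (cleanEnergy h α : ℂ)) :=
    hq2 _ (commute_levelPart _ _) (by rw [levelPart_conjTranspose]; exact commute_levelPart _ _)
  have hc' : Commute qᴴ (Matrix.diagonal fun α => (cleanEnergy h α : ℂ)) := by
    have h3 : Commute (Matrix.diagonal fun α => (cleanEnergy h α : ℂ))ᴴ qᴴ := hc.star_star.symm
    rw [← conjMat_diagonal_real, conjTranspose_conjMat, Matrix.diagonal_transpose] at h3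
    exact h3.symm
  have hnew := hU.rotate hq hc
  refine ⟨_, hnew, ?_⟩
  have h4 : (U' * (Matrix.fromBlocks q 0 0 (conjMat q) * U)⁻¹).toBlocks₁₁ = P * qᴴ := by
    rw [inv_eq_conjTranspose hnew.unitary, Matrix.conjTranspose_mul, ← Matrix.mul_assoc,
      ← inv_eq_conjTranspose hU.unitary, hX.eq_fromBlocks, Matrix.fromBlocks_conjTranspose,
      Matrix.fromBlocks_multiply]
    simp [hP]
  -- Since q preserves levels, the new level part is the old one times q†, which is the positive
  -- square root supplied by the polar decomposition.
  rw [h4, levelPart_mul_of_commute hc']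
  exact hq1.trans h2

end Estimates

/-! ### First-order expansion of the quasiparticle basis and of the pairing matrix. -/

section Mixing

variable {N : ℕ} {h : ℝ} {V : Matrix (Nambu N) (Nambu N) ℂ} {E E' E₀ : Fin N → ℝ}
  {U U' U₀ : Matrix (Nambu N) (Nambu N) ℂ}

/-- A Hermitian numerator over an antisymmetric denominator: the generator of the first-order
rotation is anti-Hermitian. -/
theorem mixing_conjTranspose (hU : U ∈ Matrix.unitaryGroup (Nambu N) ℂ) (hV : V.IsHermitian) :
    (mixing E U V)ᴴ = -mixing E U V := by
  have h1 : (U * V * U⁻¹)ᴴ = U * V * U⁻¹ := by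
    rw [inv_eq_conjTranspose hU, Matrix.conjTranspose_mul, Matrix.conjTranspose_mul, hV.eq,
      Matrix.conjTranspose_conjTranspose, Matrix.mul_assoc]
  ext α β
  rw [Matrix.conjTranspose_apply, Matrix.neg_apply]
  simp only [mixing, Matrix.of_apply]
  by_cases hαβ : E α = E β
  · rw [if_pos hαβ, if_pos hαβ.symm, star_zero, neg_zero]
  · rw [if_neg hαβ, if_neg (Ne.symm hαβ)]
    have h2 := congrFun (congrFun h1 (Sum.inl α)) (Sum.inl β)
    rw [Matrix.conjTranspose_apply] at h2
    simp only [Matrix.toBlocks₁₁, Matrix.of_apply]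
    rw [star_div₀, star_mul', h2, ← neg_sub (E α), ← div_neg]
    simp

/-- The exact equation for U'U⁻¹ differs from its first-order form by U' in place of U on the left
of V and by the shifted energy in the denominator. Each replacement gains a small factor, and the
summed inverse squared gaps convert the result into an operator norm. -/
theorem norm_sub_mixing_le (hh : 1 < h)
    (hU : Diagonalizes (isingMatrix fun _ : Fin N => h) (cleanEnergy h) U)
    (hU' : Diagonalizes ((isingMatrix fun _ : Fin N => h) + V) E' U')
    (hv : 8 * (N : ℝ) ^ 2 * ‖V‖ ≤ 1) :
    ‖(U' * U⁻¹).toBlocks₁₁ - levelPart (cleanEnergy h) (U' * U⁻¹).toBlocks₁₁ -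
      mixing (cleanEnergy h) U V‖ ≤
      8 * (4 * ‖U' * U⁻¹ - 1‖ * ‖V‖ + 16 * (N : ℝ) ^ 2 * ‖V‖ ^ 2) * (N : ℝ) ^ 2 := by
  set c := 4 * ‖U' * U⁻¹ - 1‖ * ‖V‖ + 16 * (N : ℝ) ^ 2 * ‖V‖ ^ 2 with hc
  have hc0 : 0 ≤ c := by positivity
  have key := sum_sq_le_of_le_div_gap hh (A := (U' * U⁻¹).toBlocks₁₁ -
    levelPart (cleanEnergy h) (U' * U⁻¹).toBlocks₁₁ - mixing (cleanEnergy h) U V) (c := c)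
    (fun α β hαβ => by simp [levelPart, mixing, hαβ]) (fun α β hαβ => ?_)
  · refine le_of_sq_le_sq (((sq_opNorm_le_sum _).trans key).trans (le_of_eq (by ring)))
      (by positivity)
  · rw [Matrix.sub_apply, Matrix.sub_apply]
    simp only [levelPart, mixing, Matrix.of_apply, if_neg hαβ, sub_zero, Matrix.toBlocks₁₁]
    have h1 := hU.mul_inv_entry hU' (Sum.inl α) (Sum.inl β)
    rw [add_sub_cancel_left] at h1
    have e1 : halfLevels E' (Sum.inl α) - halfLevels (cleanEnergy h) (Sum.inl β) =
        (E' α - cleanEnergy h β) / 2 := by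
      simp only [halfLevels, Sum.elim_inl]; ring
    rw [e1] at h1
    have h2 : ‖(U' * V * Uᴴ) (Sum.inl α) (Sum.inl β) - (U * V * U⁻¹) (Sum.inl α) (Sum.inl β)‖ ≤
        ‖U' * U⁻¹ - 1‖ * ‖V‖ := by
      have e2 : U' * V * Uᴴ - U * V * U⁻¹ = (U' * U⁻¹ - 1) * (U * V * Uᴴ) := by
        have e3 : U' * Uᴴ * (U * V * Uᴴ) = U' * V * Uᴴ := by
          rw [Matrix.mul_assoc U V, Matrix.mul_assoc U', ← Matrix.mul_assoc Uᴴ,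
            hU.conjTranspose_mul, Matrix.one_mul, Matrix.mul_assoc]
        rw [sub_mul, one_mul, inv_eq_conjTranspose hU.unitary, e3]
      rw [← Matrix.sub_apply, e2]
      refine (norm_entry_le _ _ _).trans ((Matrix.l2_opNorm_mul _ _).trans ?_)
      gcongr
      exact norm_conj_unitary_le hU.unitary V
    have h3 : ‖(U * V * U⁻¹) (Sum.inl α) (Sum.inl β)‖ ≤ ‖V‖ := by
      rw [inv_eq_conjTranspose hU.unitary]
      exact (norm_entry_le _ _ _).trans (norm_conj_unitary_le hU.unitary V)
    have h4 := half_gap_le hh hU hU' hv hαβ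
    have h5 := min_gap hh hαβ
    have h6 := hU.abs_energy_sub_le hU' α
    rw [add_sub_cancel_left] at h6
    have hN : (0 : ℝ) < N := by exact_mod_cast Fin.pos α
    generalize (U' * U⁻¹) (Sum.inl α) (Sum.inl β) = z at *
    generalize (U' * V * Uᴴ) (Sum.inl α) (Sum.inl β) = y at *
    generalize (U * V * U⁻¹) (Sum.inl α) (Sum.inl β) = w at *
    have h7 : E' α - cleanEnergy h α = (E' α - cleanEnergy h β) -
      (cleanEnergy h α - cleanEnergy h β) := by ring
    rw [h7] at h6
    have he : cleanEnergy h α - cleanEnergy h β ≠ 0 := sub_ne_zero.2 hαβ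
    generalize E' α - cleanEnergy h β = e' at *
    generalize cleanEnergy h α - cleanEnergy h β = e at *
    have hec : (e : ℂ) ≠ 0 := by exact_mod_cast he
    -- The two error sources separated: y - w comes from replacing U' by U, e - e' from the energy
    -- shift.
    have h8 : (z - 2 * w / e) * e' = 2 * (y - w) + 2 * w * ((e - e' : ℝ) : ℂ) / e := by
      push_cast at h1 ⊢
      field_simp
      linear_combination 2 * (e : ℂ) * h1
    have h9 : 1 / |e| ≤ 2 * (N : ℝ) ^ 2 := by
      rw [div_le_iff₀ (abs_pos.2 he)]
      rw [div_le_iff₀ (by positivity)] at h5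
      linarith
    have h10 : ‖z - 2 * w / e‖ * |e'| ≤ 2 * (‖U' * U⁻¹ - 1‖ * ‖V‖) +
        2 * ‖V‖ * (2 * ‖V‖) * (2 * (N : ℝ) ^ 2) := by
      rw [← Real.norm_eq_abs e', ← Complex.norm_real, ← norm_mul, h8]
      refine (norm_add_le _ _).trans (add_le_add ?_ ?_)
      · rw [norm_mul, Complex.norm_ofNat]
        gcongr
      · rw [norm_div, norm_mul, norm_mul, Complex.norm_ofNat, Complex.norm_real, Complex.norm_real,
          Real.norm_eq_abs, Real.norm_eq_abs, div_eq_mul_one_div]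
        rw [abs_sub_comm] at h6
        gcongr
    rw [le_div_iff₀ (abs_pos.2 he)]
    nlinarith [norm_nonneg (z - 2 * w / (e : ℂ))]

theorem norm_sub_one_le (hB : IsBogoliubov U) : ‖U - 1‖ ≤ 2 * ‖U.toBlocks₁₁ - 1‖ +
    2 * ‖U.toBlocks₁₂‖ := by
  have h1 : U - 1 = Matrix.fromBlocks (U.toBlocks₁₁ - 1) U.toBlocks₁₂ (conjMat U.toBlocks₁₂)
      (conjMat (U.toBlocks₁₁ - 1)) := by
    conv_lhs => rw [hB.eq_fromBlocks]
    rw [← Matrix.fromBlocks_one, sub_eq_add_neg, Matrix.fromBlocks_neg, Matrix.fromBlocks_add,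
      conjMat_sub, conjMat_one, neg_zero, add_zero, add_zero, ← sub_eq_add_neg, ← sub_eq_add_neg]
  rw [h1]
  refine (norm_fromBlocks_le _ _ _ _).trans ?_
  rw [norm_conjMat, norm_conjMat]
  linarith

/-- First-order perturbation theory of the quasiparticle basis, with error bounds. -/
theorem exists_adapted_estimates (hh : 1 < h) {b : ℝ} (hb : 0 < b) :
    ∃ C : ℝ, 0 < C ∧ ∀ (N : ℕ) (V : Matrix (Nambu N) (Nambu N) ℂ) (E' : Fin N → ℝ)
      (U' : Matrix (Nambu N) (Nambu N) ℂ), C ≤ N → ‖V‖ ≤ b / (N : ℝ) ^ 3 →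
      Diagonalizes ((isingMatrix fun _ : Fin N => h) + V) E' U' →
      ∃ U, Diagonalizes (isingMatrix fun _ : Fin N => h) (cleanEnergy h) U ∧
        ‖U' * U⁻¹ - 1‖ ≤ C / N ∧
        ‖(U' * U⁻¹).toBlocks₁₁ - 1 - mixing (cleanEnergy h) U V‖ ≤ C / (N : ℝ) ^ 2 ∧
        ‖mixing (cleanEnergy h) U V‖ ≤ C / N ∧
        ‖(U' * U⁻¹).toBlocks₁₂‖ ^ 2 ≤ C ^ 2 / (N : ℝ) ^ 5 := by
  have hpos : 0 < h - 1 := by linarith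
  set g := (h - 1)⁻¹ with hg
  have hg0 : 0 < g := inv_pos.2 hpos
  set C1 := (1024 + g ^ 2) * b ^ 2 with hC1
  set C2 := 2 * C1 + 64 * b + 2 * (b * g) with hC2
  set C3 := 32 * C2 * b + 128 * b ^ 2 with hC3
  have hC10 : 0 < C1 := by positivity
  have hC20 : 0 < C2 := by positivity
  have hC30 : 0 < C3 := by positivity
  -- One constant above all those needed: N ≥ C yields 8b ≤ N for the gap condition and 2·C1 ≤ N for
  -- the polar decomposition, and the remaining terms dominate the final estimates.
  refine ⟨1 + 8 * b + 2 * C1 + C2 + (C1 + C3) + (32 * b + C3) + b * g, by positivity, ?_⟩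
  set C := 1 + 8 * b + 2 * C1 + C2 + (C1 + C3) + (32 * b + C3) + b * g with hC
  have hbg : 0 < b * g := by positivity
  intro N V E' U' hN hV hU'
  have hN1 : (1 : ℝ) ≤ N := by linarith
  have hN0 : (0 : ℝ) < N := by linarith
  have hvN : ‖V‖ * (N : ℝ) ^ 3 ≤ b := by rwa [le_div_iff₀ (by positivity)] at hV
  have hv0 := norm_nonneg V
  have hv2 : ‖V‖ * (N : ℝ) ^ 2 ≤ b / N := by
    rw [le_div_iff₀ hN0]; linarith
  have hv : 8 * (N : ℝ) ^ 2 * ‖V‖ ≤ 1 := by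
    have : b / N ≤ 1 / 8 := by rw [div_le_div_iff₀ hN0 (by norm_num)]; linarith
    linarith
  have hvg : N * (‖V‖ / (h - 1)) ^ 2 ≤ (b * g) ^ 2 / (N : ℝ) ^ 5 := by
    rw [le_div_iff₀ (by positivity), div_eq_mul_inv, ← hg]
    calc N * (‖V‖ * g) ^ 2 * (N : ℝ) ^ 5 = (‖V‖ * (N : ℝ) ^ 3) ^ 2 * g ^ 2 := by ring
      _ ≤ b ^ 2 * g ^ 2 := by gcongr
      _ = _ := by ring
  have hδ : 1024 * ‖V‖ ^ 2 * (N : ℝ) ^ 4 + N * (‖V‖ / (h - 1)) ^ 2 ≤ C1 / (N : ℝ) ^ 2 := by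
    have h1 : 1024 * ‖V‖ ^ 2 * (N : ℝ) ^ 4 ≤ 1024 * b ^ 2 / (N : ℝ) ^ 2 := by
      calc _ = 1024 * (‖V‖ * (N : ℝ) ^ 2) ^ 2 := by ring
        _ ≤ 1024 * (b / N) ^ 2 := by gcongr
        _ = _ := by rw [div_pow]; ring
    have h2 : (b * g) ^ 2 / (N : ℝ) ^ 5 ≤ (b * g) ^ 2 / (N : ℝ) ^ 2 := by
      gcongr
      norm_num
    calc _ ≤ 1024 * b ^ 2 / (N : ℝ) ^ 2 + (b * g) ^ 2 / (N : ℝ) ^ 2 := by linarith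
      _ = _ := by rw [hC1]; ring
  have hNN : (N : ℝ) ≤ (N : ℝ) ^ 2 := by nlinarith
  have hδ2 : C1 / (N : ℝ) ^ 2 ≤ 1 / 2 := by
    rw [div_le_div_iff₀ (by positivity) two_pos]; linarith
  obtain ⟨U, hU, hUδ⟩ := exists_adapted hh hU' hv (hδ.trans hδ2)
  have hX := hU'.isBogoliubov.mul hU.isBogoliubov.inv
  have hR2 := (sq_opNorm_le_sum _).trans ((sum_sq_pairBlock_le hh hU hU').trans hvg)
  have hO2 := (sq_opNorm_le_sum _).trans (sum_sq_offLevel_le hh hU hU' hv)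
  have hsub := norm_sub_mixing_le hh hU hU' hv
  set P := (U' * U⁻¹).toBlocks₁₁
  set R := (U' * U⁻¹).toBlocks₁₂
  set Q := levelPart (cleanEnergy h) P
  set a := mixing (cleanEnergy h) U V
  have hO : ‖P - Q‖ ≤ 32 * b / N := by
    refine (le_of_sq_le_sq (hO2.trans (le_of_eq ?_)) (by positivity : 0 ≤ 32 * (‖V‖ * (N : ℝ) ^ 2))).trans ?_
    · ring
    · rw [mul_div_assoc]; gcongr
  have hQ : ‖Q - 1‖ ≤ C1 / (N : ℝ) ^ 2 := hUδ.trans hδ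
  have hR : ‖R‖ ≤ b * g / N := by
    refine le_of_sq_le_sq (hR2.trans ?_) (by positivity)
    rw [div_pow]
    gcongr
    norm_num
  have hC1N : C1 / (N : ℝ) ^ 2 ≤ C1 / N := by gcongr
  have hXn : ‖U' * U⁻¹ - 1‖ ≤ C2 / N := by
    have h1 : ‖P - 1‖ ≤ ‖P - Q‖ + ‖Q - 1‖ := norm_sub_le_norm_sub_add_norm_sub _ _ _
    calc _ ≤ 2 * ‖P - 1‖ + 2 * ‖R‖ := norm_sub_one_le hX
      _ ≤ 2 * (32 * b / N + C1 / N) + 2 * (b * g / N) := by linarith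
      _ = _ := by rw [hC2]; ring
  have hPa : ‖P - Q - a‖ ≤ C3 / (N : ℝ) ^ 2 := by
    refine hsub.trans ?_
    calc _ = 8 * (4 * ‖U' * U⁻¹ - 1‖ * (‖V‖ * (N : ℝ) ^ 2) + 16 * (‖V‖ * (N : ℝ) ^ 2) ^ 2) := by ring
      _ ≤ 8 * (4 * (C2 / N) * (b / N) + 16 * (b / N) ^ 2) := by gcongr
      _ = _ := by rw [hC3]; field_simp; ring
  have hC3N : C3 / (N : ℝ) ^ 2 ≤ C3 / N := by gcongr
  refine ⟨U, hU, hXn.trans (by gcongr; linarith), ?_, ?_, hR2.trans ?_⟩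
  · have e : P - 1 - a = (Q - 1) + (P - Q - a) := by abel
    rw [e]
    refine (norm_add_le _ _).trans ((add_le_add hQ hPa).trans ?_)
    rw [← add_div]
    gcongr
    linarith
  · have e := norm_sub_le (P - Q) (P - Q - a)
    rw [sub_sub_cancel] at e
    refine e.trans ((add_le_add hO (hPa.trans hC3N)).trans ?_)
    rw [← add_div]
    gcongr
    linarith
  · gcongr
    linarith

/-- First-order expansion of the pairing matrix. -/
theorem norm_pairing_expansion_le {n : Type*} [Fintype n] [DecidableEq n]
    {P R G a : Matrix n n ℂ} {C M : ℝ} (hC : 0 < C) (hM : 1 ≤ M) (hCM : 6 * C ≤ M)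
    (ha : aᴴ = -a) (hP : ‖P - 1 - a‖ ≤ C / M ^ 2) (han : ‖a‖ ≤ C / M)
    (hR : ‖R‖ ^ 2 ≤ C ^ 2 / M ^ 5) (hG : ‖G‖ ≤ M) :
    ‖Pᴴ - G * Rᴴ - 1‖ ≤ 1 / 2 ∧ ∀ G', (Pᴴ - G * Rᴴ) * G' = G * Pᵀ - Rᵀ →
    ‖G' - G - (a * G - G * conjMat a)‖ ≤ 2 * (4 * C + 6 * C ^ 2) / √M := by
  have hM0 : 0 < M := by linarith
  have hs : 0 < √M := Real.sqrt_pos.2 hM0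
  have hs1 : 1 ≤ √M := Real.one_le_sqrt.2 hM
  have hss : √M * √M = M := Real.mul_self_sqrt hM0.le
  have hsM : √M ≤ M := by nlinarith
  -- The exponent 5/2 matters: R† stands between two factors G of size M in the error, which leaves
  -- M^{-1/2}.
  have hR' : ‖R‖ ≤ C / (M ^ 2 * √M) := by
    refine le_of_sq_le_sq (hR.trans (le_of_eq ?_)) (by positivity)
    rw [div_pow, mul_pow, Real.sq_sqrt hM0.le]
    ring
  set e1 := (P - 1 - a)ᴴ - G * Rᴴ with he1
  set e2 := G * (P - 1 - a)ᵀ - Rᵀ with he2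
  set T := a * G - G * conjMat a with hT
  have hat : aᵀ = -conjMat a := by
    rw [← conjMat_conjTranspose, ha, conjMat_neg]
  have hB : Pᴴ - G * Rᴴ = 1 - a + e1 := by
    rw [he1, Matrix.conjTranspose_sub, Matrix.conjTranspose_sub, ha, Matrix.conjTranspose_one]
    abel
  have hrhs : G * Pᵀ - Rᵀ = G - G * conjMat a + e2 := by
    rw [he2, Matrix.transpose_sub, Matrix.transpose_sub, hat, Matrix.transpose_one]
    simp only [mul_sub, mul_neg, mul_one]
    abel
  have hMM : C / M ^ 2 ≤ C / (M * √M) := by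
    rw [pow_two]; gcongr
  have hGR : ‖G * Rᴴ‖ ≤ C / (M * √M) := by
    refine (Matrix.l2_opNorm_mul _ _).trans ?_
    rw [Matrix.l2_opNorm_conjTranspose]
    calc ‖G‖ * ‖R‖ ≤ M * (C / (M ^ 2 * √M)) := by gcongr
      _ = _ := by field_simp
  have h1 : ‖e1‖ ≤ 2 * C / (M * √M) := by
    refine (norm_sub_le _ _).trans ?_
    rw [Matrix.l2_opNorm_conjTranspose, mul_div_assoc, two_mul]
    exact add_le_add (hP.trans hMM) hGR
  have h2 : ‖e2‖ ≤ 2 * C / M := by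
    refine (norm_sub_le _ _).trans ?_
    rw [norm_transpose, mul_div_assoc, two_mul]
    refine add_le_add ((Matrix.l2_opNorm_mul _ _).trans ?_) (hR'.trans ?_)
    · rw [norm_transpose]
      calc ‖G‖ * ‖P - 1 - a‖ ≤ M * (C / M ^ 2) := by gcongr
        _ = _ := by field_simp
    · gcongr
      nlinarith [mul_le_mul hM hs1 zero_le_one hM0.le]
  have hTn : ‖T‖ ≤ 2 * C := by
    refine (norm_sub_le _ _).trans ?_
    have i1 : ‖a * G‖ ≤ C := (Matrix.l2_opNorm_mul _ _).trans <| by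
      calc ‖a‖ * ‖G‖ ≤ C / M * M := by gcongr
        _ = C := by field_simp
    have i2 : ‖G * conjMat a‖ ≤ C := (Matrix.l2_opNorm_mul _ _).trans <| by
      rw [norm_conjMat]
      calc ‖G‖ * ‖a‖ ≤ M * (C / M) := by gcongr
        _ = C := by field_simp
    linarith
  have hB1 : ‖Pᴴ - G * Rᴴ - 1‖ ≤ 1 / 2 := by
    have e : Pᴴ - G * Rᴴ - 1 = e1 - a := by rw [hB]; abel
    rw [e]
    refine (norm_sub_le _ _).trans ?_
    have i1 : 2 * C / (M * √M) ≤ 2 * C / M := by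
      gcongr
      nlinarith
    have i2 : 2 * C / M + C / M ≤ 1 / 2 := by
      rw [← add_div, div_le_div_iff₀ hM0 two_pos]
      linarith
    linarith
  refine ⟨hB1, fun G' hG' => ?_⟩
  set B := Pᴴ - G * Rᴴ
  -- Here B = 1 - a + e1, and T is chosen so that the terms of order zero and one cancel.
  have hkey : B * (G' - G - T) = e2 + a * T - e1 * (G + T) := by
    rw [mul_sub, mul_sub, hG', hrhs, hB, hT]
    noncomm_ring
  have hBe : ‖B * (G' - G - T)‖ ≤ (4 * C + 6 * C ^ 2) / √M := by
    rw [hkey]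
    refine (norm_sub_le _ _).trans ((add_le_add_left (norm_add_le _ _) _).trans ?_)
    have i1 : ‖a * T‖ ≤ 2 * C ^ 2 / M := (Matrix.l2_opNorm_mul _ _).trans <| by
      calc ‖a‖ * ‖T‖ ≤ C / M * (2 * C) := by gcongr
        _ = _ := by ring
    have i2 : ‖e1 * (G + T)‖ ≤ 2 * C / √M + 4 * C ^ 2 / √M := (Matrix.l2_opNorm_mul _ _).trans <| by
      calc ‖e1‖ * ‖G + T‖ ≤ 2 * C / (M * √M) * (M + 2 * C) := by
            gcongr
            exact (norm_add_le _ _).trans (add_le_add hG hTn)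
        _ = 2 * C / √M + 4 * C ^ 2 / (M * √M) := by field_simp; ring
        _ ≤ _ := by
          gcongr
          nlinarith
    have i3 : 2 * C / M ≤ 2 * C / √M := by gcongr
    have i4 : 2 * C ^ 2 / M ≤ 2 * C ^ 2 / √M := by gcongr
    calc _ ≤ 2 * C / √M + 2 * C ^ 2 / √M + (2 * C / √M + 4 * C ^ 2 / √M) := by linarith
      _ = _ := by ring
  -- B is within 1/2 of the identity, so the error is absorbed into the left-hand side at the cost
  -- of a factor 2.
  have hX : ‖G' - G - T‖ ≤ ‖B * (G' - G - T)‖ + 1 / 2 * ‖G' - G - T‖ := by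
    have e : G' - G - T = B * (G' - G - T) - (B - 1) * (G' - G - T) := by
      rw [sub_mul B 1, one_mul, sub_sub_cancel]
    calc ‖G' - G - T‖ = ‖B * (G' - G - T) - (B - 1) * (G' - G - T)‖ := by rw [← e]
      _ ≤ ‖B * (G' - G - T)‖ + ‖B - 1‖ * ‖G' - G - T‖ :=
        (norm_sub_le _ _).trans (add_le_add_right (Matrix.l2_opNorm_mul _ _) _)
      _ ≤ _ := by gcongr
  rw [mul_div_assoc]
  linarith

end Mixing

/-! ### The perturbed pairing matrix and its first-order shift. -/

section Pairing

variable {N : ℕ} {h : ℝ} {H V : Matrix (Nambu N) (Nambu N) ℂ} {E E' E₀ : Fin N → ℝ}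
  {U U' U₀ : Matrix (Nambu N) (Nambu N) ℂ}

theorem isUnit_of_norm_sub_one_lt {n : Type*} [Fintype n] [DecidableEq n] {A : Matrix n n ℂ}
    (hA : ‖A - 1‖ < 1) : IsUnit A := by
  have h1 := isUnit_one_sub_of_norm_lt_one (x := 1 - A) (by rwa [norm_sub_rev])
  rwa [sub_sub_cancel] at h1

/-- The inverse of H has norm at most 1/g, so H⁻¹(H + V) is within distance less than 1 of the
identity and therefore invertible. A perturbation below the gap creates no zero modes. -/
theorem Diagonalizes.eq_zero_of_add_mulVec (hU : Diagonalizes H E U) {g : ℝ}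
    (hg : ∀ α, g ≤ E α / 2) (hV : ‖V‖ < g) (x : Nambu N → ℂ) (hx : (H + V) *ᵥ x = 0) : x = 0 := by
  have hg0 : 0 < g := (norm_nonneg V).trans_lt hV
  have hab : ∀ a, g ≤ |halfLevels E a| := by
    rintro (a | a)
    · exact (hg a).trans (le_abs_self _)
    · simpa [halfLevels] using (hg a).trans (le_abs_self _)
  set M := Uᴴ * (Matrix.diagonal fun a => ((halfLevels E a)⁻¹ : ℂ)) * U with hM
  have h1 : M * H = 1 := by
    rw [hM, Matrix.mul_assoc, hU.mul_eq, ← Matrix.mul_assoc, Matrix.mul_assoc Uᴴ,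
      Matrix.diagonal_mul_diagonal]
    have : (fun a => ((halfLevels E a : ℂ))⁻¹ * (halfLevels E a : ℂ)) = fun _ => 1 := by
      ext a
      have h2 : (halfLevels E a : ℂ) ≠ 0 := by
        exact_mod_cast abs_pos.1 (hg0.trans_le (hab a))
      exact inv_mul_cancel₀ h2
    rw [this, Matrix.diagonal_one, Matrix.mul_one, hU.conjTranspose_mul]
  have h2 : ‖M‖ ≤ g⁻¹ := by
    rw [hM]
    refine (norm_mul_mul_le ?_ (norm_le_one_of_mem_unitary hU.unitary) _).trans ?_
    · rw [Matrix.l2_opNorm_conjTranspose]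
      exact norm_le_one_of_mem_unitary hU.unitary
    · rw [Matrix.l2_opNorm_diagonal, pi_norm_le_iff_of_nonneg (inv_nonneg.2 hg0.le)]
      intro a
      rw [norm_inv, Complex.norm_real, Real.norm_eq_abs]
      gcongr
      exact hab a
  have h3 : IsUnit (M * (H + V)) := by
    refine isUnit_of_norm_sub_one_lt ?_
    rw [mul_add, h1, add_sub_cancel_left]
    calc ‖M * V‖ ≤ ‖M‖ * ‖V‖ := Matrix.l2_opNorm_mul _ _
      _ ≤ g⁻¹ * ‖V‖ := by gcongr
      _ < g⁻¹ * g := by gcongr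
      _ = 1 := inv_mul_cancel₀ hg0.ne'
  have h4 : (M * (H + V)) *ᵥ x = 0 := by rw [← Matrix.mulVec_mulVec, hx, Matrix.mulVec_zero]
  obtain ⟨u, hu⟩ := h3
  rw [← hu] at h4
  rw [← Matrix.one_mulVec x, ← u.inv_mul, ← Matrix.mulVec_mulVec, h4, Matrix.mulVec_zero]

theorem exists_diagonalizes_zero_field (N : ℕ) :
    ∃ E₀ U₀, Diagonalizes (isingMatrix fun _ : Fin N => 0) E₀ U₀ :=
  (isPerturbation_isingMatrix _).exists_diagonalizes fun x hx => by
    rw [← Matrix.one_mulVec x, ← isingMatrix_zero_mul_self, ← Matrix.mulVec_mulVec, hx,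
      Matrix.mulVec_zero]

theorem exists_diagonalizes_clean (hh : 1 < h) (N : ℕ) :
    ∃ U, Diagonalizes (isingMatrix fun _ : Fin N => h) (cleanEnergy h) U := by
  have h1 := diagonalizes_modes (N := N) hh
  exact ⟨_, by rw [← h1.energy_eq hh]; exact h1⟩

theorem exists_diagonalizes_perturbed (hh : 1 < h) (hV : IsPerturbation V) (hv : ‖V‖ < h - 1) :
    ∃ E' U', Diagonalizes ((isingMatrix fun _ : Fin N => h) + V) E' U' := by
  obtain ⟨U, hU⟩ := exists_diagonalizes_clean hh N
  exact ((isPerturbation_isingMatrix _).add hV).exists_diagonalizes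
    (hU.eq_zero_of_add_mulVec (fun α => (sub_one_lt_cleanEnergy hh α).le) hv)

theorem norm_isingMatrix_le (hh : 1 < h) : ‖isingMatrix fun _ : Fin N => h‖ ≤ h + 1 := by
  obtain ⟨U, hU⟩ := exists_diagonalizes_clean hh N
  rw [hU.eq_conj]
  refine (norm_mul_mul_le ?_ (norm_le_one_of_mem_unitary hU.unitary) _).trans ?_
  · rw [Matrix.l2_opNorm_conjTranspose]
    exact norm_le_one_of_mem_unitary hU.unitary
  · rw [Matrix.l2_opNorm_diagonal, pi_norm_le_iff_of_nonneg (by linarith)]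
    intro a
    rw [Complex.norm_real, Real.norm_eq_abs, abs_le]
    rcases a with a | a <;> simp only [halfLevels, Sum.elim_inl, Sum.elim_inr] <;>
      constructor <;> linarith [cleanEnergy_le hh a, sub_one_lt_cleanEnergy hh a]

theorem sub_one_le_norm_isingMatrix (hh : 1 < h) (hN : 0 < N) :
    h - 1 ≤ ‖isingMatrix fun _ : Fin N => h‖ := by
  obtain ⟨U, hU⟩ := exists_diagonalizes_clean hh N
  have h1 := (norm_entry_le _ (Sum.inl ⟨0, hN⟩) (Sum.inl ⟨0, hN⟩)).trans
    (norm_conj_unitary_le hU.unitary (isingMatrix fun _ : Fin N => h))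
  rw [hU.diag_halfLevels, Matrix.diagonal_apply_eq, Complex.norm_real, Real.norm_eq_abs] at h1
  exact (sub_one_lt_cleanEnergy hh ⟨0, hN⟩).le.trans ((le_abs_self _).trans h1)

/-- Change of the reference quasiparticle basis in the blocks of `U₀ U⁻¹`. -/
theorem blockW_change (hU : IsBogoliubov U) (hU' : IsBogoliubov U')
    (h1 : IsUnit (blockW₁ U₀ U)) :
    blockW₁ U₀ U' = blockW₁ U₀ U *
      ((U' * U⁻¹).toBlocks₁₁ᴴ - bcsMatrix U₀ U * (U' * U⁻¹).toBlocks₁₂ᴴ) ∧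
    blockW₂ U₀ U' = blockW₁ U₀ U *
      ((U' * U⁻¹).toBlocks₁₂ᵀ - bcsMatrix U₀ U * (U' * U⁻¹).toBlocks₁₁ᵀ) := by
  have hX := (hU'.mul hU.inv).eq_fromBlocks
  have h2 : U₀ * U'⁻¹ = (U₀ * U⁻¹) * (U' * U⁻¹)ᴴ := by
    have e : U⁻¹ * U = 1 := by
      rw [inv_eq_conjTranspose hU.1]; exact Matrix.mem_unitaryGroup_iff'.1 hU.1
    rw [Matrix.conjTranspose_mul, inv_eq_conjTranspose hU'.1, Matrix.mul_assoc,
      ← Matrix.mul_assoc U⁻¹, inv_eq_conjTranspose hU.1, Matrix.conjTranspose_conjTranspose,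
      ← inv_eq_conjTranspose hU.1, e, Matrix.one_mul]
  have h3 := blockW₁_mul_bcsMatrix h1
  have e1 : blockW₁ U₀ U = (U₀ * U⁻¹).toBlocks₁₁ := rfl
  have e2 : blockW₂ U₀ U = (U₀ * U⁻¹).toBlocks₁₂ := rfl
  set P := (U' * U⁻¹).toBlocks₁₁
  set R := (U' * U⁻¹).toBlocks₁₂
  have h4 : U₀ * U'⁻¹ = Matrix.fromBlocks (blockW₁ U₀ U * Pᴴ + blockW₂ U₀ U * Rᴴ)
      (blockW₁ U₀ U * Rᵀ + blockW₂ U₀ U * Pᵀ)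
      ((U₀ * U⁻¹).toBlocks₂₁ * Pᴴ + (U₀ * U⁻¹).toBlocks₂₂ * Rᴴ)
      ((U₀ * U⁻¹).toBlocks₂₁ * Rᵀ + (U₀ * U⁻¹).toBlocks₂₂ * Pᵀ) := by
    rw [h2, hX, Matrix.fromBlocks_conjTranspose, conjTranspose_conjMat, conjTranspose_conjMat]
    conv_lhs => rw [← Matrix.fromBlocks_toBlocks (U₀ * U⁻¹)]
    rw [Matrix.fromBlocks_multiply, e1, e2]
  have h5 : blockW₂ U₀ U = -(blockW₁ U₀ U * bcsMatrix U₀ U) := by rw [h3, neg_neg]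
  constructor
  · rw [show blockW₁ U₀ U' = (U₀ * U'⁻¹).toBlocks₁₁ from rfl, h4, Matrix.toBlocks_fromBlocks₁₁, h5,
      mul_sub, ← Matrix.mul_assoc, neg_mul, ← sub_eq_add_neg]
  · rw [show blockW₂ U₀ U' = (U₀ * U'⁻¹).toBlocks₁₂ from rfl, h4, Matrix.toBlocks_fromBlocks₁₂, h5,
      mul_sub, ← Matrix.mul_assoc, neg_mul, ← sub_eq_add_neg]

/-- The first-order change of the pairing matrix. -/
noncomputable def pairingShift (E : Fin N → ℝ) (U₀ U V : Matrix (Nambu N) (Nambu N) ℂ) :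
    Matrix (Fin N) (Fin N) ℂ :=
  mixing E U V * bcsMatrix U₀ U - bcsMatrix U₀ U * conjMat (mixing E U V)

/-- First-order perturbation theory of the quasiparticle basis and of the pairing matrix. -/
theorem exists_adapted_pairing (hh : 1 < h) {b : ℝ} (hb : 0 < b) :
    ∃ C : ℝ, 0 < C ∧ ∀ (N : ℕ) (V : Matrix (Nambu N) (Nambu N) ℂ) (E' : Fin N → ℝ)
      (U' : Matrix (Nambu N) (Nambu N) ℂ), C ≤ N → V.IsHermitian → ‖V‖ ≤ b / (N : ℝ) ^ 3 →
      Diagonalizes ((isingMatrix fun _ : Fin N => h) + V) E' U' →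
      ∃ U, Diagonalizes (isingMatrix fun _ : Fin N => h) (cleanEnergy h) U ∧
        ‖U' * U⁻¹ - 1‖ ≤ C / √N ∧
        ∀ E₀ U₀, Diagonalizes (isingMatrix fun _ : Fin N => 0) E₀ U₀ →
          IsUnit (blockW₁ U₀ U') ∧
          ‖bcsMatrix U₀ U' - bcsMatrix U₀ U - pairingShift (cleanEnergy h) U₀ U V‖ ≤ C / √N := by
  obtain ⟨C, hC, key⟩ := exists_adapted_estimates hh hb
  refine ⟨1 + 8 * C + 12 * C ^ 2, by positivity, fun N V E' U' hN hV hVb hU' => ?_⟩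
  have hC2 : 0 ≤ C ^ 2 := by positivity
  have hN1 : (1 : ℝ) ≤ N := by linarith
  have hN0 : (0 : ℝ) < N := by linarith
  obtain ⟨U, hU, h1, h2, h3, h4⟩ := key N V E' U' (by linarith) hVb hU'
  have hsN : √(N : ℝ) ≤ N := by
    rw [Real.sqrt_le_left hN0.le]; nlinarith
  refine ⟨U, hU, h1.trans ?_, fun E₀ U₀ h₀ => ?_⟩
  · have : 0 < √(N : ℝ) := Real.sqrt_pos.2 hN0
    gcongr
    linarith
  · have hu := isUnit_clean_blockW₁ hh h₀ hU
    have hW := blockW_change (U₀ := U₀) hU.isBogoliubov hU'.isBogoliubov hu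
    set P := (U' * U⁻¹).toBlocks₁₁
    set R := (U' * U⁻¹).toBlocks₁₂
    set G := bcsMatrix U₀ U
    obtain ⟨hB, hexp⟩ := norm_pairing_expansion_le hC hN1 (by linarith)
      (mixing_conjTranspose (E := cleanEnergy h) hU.unitary hV) h2 h3 h4
      (norm_clean_bcsMatrix_le hh h₀ hU)
    have hBu : IsUnit (Pᴴ - G * Rᴴ) := isUnit_of_norm_sub_one_lt (hB.trans_lt (by norm_num))
    have hu' : IsUnit (blockW₁ U₀ U') := by
      rw [hW.1]
      exact hu.mul hBu
    refine ⟨hu', (hexp _ ?_).trans ?_⟩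
    · have h5 := blockW₁_mul_bcsMatrix hu'
      rw [hW.1, hW.2, Matrix.mul_assoc, ← mul_neg] at h5
      rw [hu.mul_left_cancel h5, neg_sub]
    · gcongr
      linarith

/-- A single entry sees only one column of the second factor. With B = G this brings in the weight
of one energy instead of ‖G‖, which is needed to localize large changes. -/
theorem norm_mul_apply_le {n : Type*} [Fintype n] [DecidableEq n] (A B : Matrix n n ℂ) (i j : n) :
    ‖(A * B) i j‖ ≤ ‖A‖ * √(∑ k, ‖B k j‖ ^ 2) := by
  refine le_of_sq_le_sq ?_ (by positivity)
  rw [mul_pow, Real.sq_sqrt (by positivity), Matrix.mul_apply]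
  calc ‖∑ k, A i k * B k j‖ ^ 2 ≤ (∑ k, ‖A i k‖ * ‖B k j‖) ^ 2 := by
        gcongr
        refine (norm_sum_le _ _).trans (le_of_eq ?_)
        simp
    _ ≤ (∑ k, ‖A i k‖ ^ 2) * ∑ k, ‖B k j‖ ^ 2 := Finset.sum_mul_sq_le_sq_mul_sq _ _ _
    _ ≤ _ := by
      gcongr
      exact sum_sq_norm_row_le A i

/-- G preserves energies, so in either product the intermediate index has the energy of β or of α
respectively. Every denominator thus becomes E_α - E_β (the conjugated term has the same real one)
and can be pulled out. -/
theorem pairingShift_apply (hh : 1 < h)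
    (h₀ : Diagonalizes (isingMatrix fun _ : Fin N => 0) E₀ U₀)
    (hU : Diagonalizes (isingMatrix fun _ : Fin N => h) (cleanEnergy h) U)
    {α β : Fin N} (hαβ : cleanEnergy h α ≠ cleanEnergy h β) :
    pairingShift (cleanEnergy h) U₀ U V α β =
      2 * (((U * V * U⁻¹).toBlocks₁₁ * bcsMatrix U₀ U) α β -
        (bcsMatrix U₀ U * conjMat (U * V * U⁻¹).toBlocks₁₁) α β) /
          ((cleanEnergy h α - cleanEnergy h β : ℝ) : ℂ) := by
  rw [pairingShift, Matrix.sub_apply]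
  simp only [Matrix.mul_apply]
  rw [← Finset.sum_sub_distrib, ← Finset.sum_sub_distrib, Finset.mul_sum, Finset.sum_div]
  refine Finset.sum_congr rfl fun γ _ => ?_
  have hz := fun {γ δ : Fin N} (hne : cleanEnergy h γ ≠ cleanEnergy h δ) =>
    clean_bcsMatrix_eq_zero hh h₀ hU hne
  rw [conjMat_apply, conjMat_apply]
  simp only [mixing, Matrix.of_apply]
  have e1 : (if cleanEnergy h α = cleanEnergy h γ then 0 else
      2 * (U * V * U⁻¹).toBlocks₁₁ α γ / ((cleanEnergy h α - cleanEnergy h γ : ℝ) : ℂ)) *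
      bcsMatrix U₀ U γ β = 2 * ((U * V * U⁻¹).toBlocks₁₁ α γ * bcsMatrix U₀ U γ β) /
        ((cleanEnergy h α - cleanEnergy h β : ℝ) : ℂ) := by
    by_cases h1 : cleanEnergy h γ = cleanEnergy h β
    · rw [h1, if_neg hαβ]; ring
    · rw [hz h1]; simp
  have e2 : bcsMatrix U₀ U α γ * star (if cleanEnergy h γ = cleanEnergy h β then 0 else
      2 * (U * V * U⁻¹).toBlocks₁₁ γ β / ((cleanEnergy h γ - cleanEnergy h β : ℝ) : ℂ)) =
      2 * (bcsMatrix U₀ U α γ * star ((U * V * U⁻¹).toBlocks₁₁ γ β)) /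
        ((cleanEnergy h α - cleanEnergy h β : ℝ) : ℂ) := by
    by_cases h1 : cleanEnergy h α = cleanEnergy h γ
    · rw [← h1, if_neg hαβ, star_div₀, star_mul', Complex.star_def,
        Complex.conj_ofReal, Complex.conj_ofNat]
      ring
    · rw [hz h1]; simp
  rw [e1, e2]
  ring

/-- G stays inside a level while the mixing matrix has no entries there. Entries that were already
nonzero are hence unaffected at first order. -/
theorem pairingShift_apply_eq_zero (hh : 1 < h)
    (h₀ : Diagonalizes (isingMatrix fun _ : Fin N => 0) E₀ U₀)
    (hU : Diagonalizes (isingMatrix fun _ : Fin N => h) (cleanEnergy h) U)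
    {α β : Fin N} (hαβ : cleanEnergy h α = cleanEnergy h β) :
    pairingShift (cleanEnergy h) U₀ U V α β = 0 := by
  rw [pairingShift, Matrix.sub_apply, Matrix.mul_apply, Matrix.mul_apply, ← Finset.sum_sub_distrib]
  refine Finset.sum_eq_zero fun γ _ => ?_
  rw [conjMat_apply]
  simp only [mixing, Matrix.of_apply]
  by_cases h1 : cleanEnergy h α = cleanEnergy h γ
  · rw [if_pos h1, if_pos (h1.symm.trans hαβ)]; simp
  · rw [clean_bcsMatrix_eq_zero hh h₀ hU h1,
      clean_bcsMatrix_eq_zero hh h₀ hU (fun h2 => h1 (hαβ.trans h2.symm))]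
    simp

theorem norm_pairingShift_le (hh : 1 < h)
    (h₀ : Diagonalizes (isingMatrix fun _ : Fin N => 0) E₀ U₀)
    (hU : Diagonalizes (isingMatrix fun _ : Fin N => h) (cleanEnergy h) U)
    {α β : Fin N} (hαβ : cleanEnergy h α ≠ cleanEnergy h β) :
    ‖pairingShift (cleanEnergy h) U₀ U V α β‖ * |cleanEnergy h α - cleanEnergy h β| ≤
      2 * ‖V‖ * (√(pairWeight h (cleanEnergy h α / 2)) + √(pairWeight h (cleanEnergy h β / 2))) := by
  rw [pairingShift_apply hh h₀ hU hαβ, norm_div, Complex.norm_real, Real.norm_eq_abs,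
    div_mul_cancel₀ _ (abs_pos.2 (sub_ne_zero.2 hαβ)).ne', norm_mul, Complex.norm_ofNat,
    mul_assoc 2 ‖V‖]
  have hX : ‖(U * V * U⁻¹).toBlocks₁₁‖ ≤ ‖V‖ := by
    refine (norm_toBlocks₁₁_le _).trans ?_
    rw [inv_eq_conjTranspose hU.unitary]
    exact norm_conj_unitary_le hU.unitary V
  set X := (U * V * U⁻¹).toBlocks₁₁
  have h1 : ‖(X * bcsMatrix U₀ U) α β‖ ≤ ‖V‖ * √(pairWeight h (cleanEnergy h β / 2)) := by
    refine (norm_mul_apply_le _ _ _ _).trans ?_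
    rw [sum_sq_col_clean_bcsMatrix hh h₀ hU]
    gcongr
  have h2 : ‖(bcsMatrix U₀ U * conjMat X) α β‖ ≤ ‖V‖ * √(pairWeight h (cleanEnergy h α / 2)) := by
    rw [← Matrix.transpose_apply (bcsMatrix U₀ U * conjMat X), Matrix.transpose_mul]
    refine (norm_mul_apply_le _ _ _ _).trans ?_
    simp only [Matrix.transpose_apply]
    rw [sum_sq_row_clean_bcsMatrix hh h₀ hU, norm_transpose, norm_conjMat]
    gcongr
  have h3 := norm_sub_le ((X * bcsMatrix U₀ U) α β) ((bcsMatrix U₀ U * conjMat X) α β)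
  linarith

end Pairing

/-! ### Bounds on the first-order shift and localization at the band edge. -/

section Robustness

variable {N : ℕ} {h : ℝ} {V : Matrix (Nambu N) (Nambu N) ℂ} {E₀ : Fin N → ℝ}
  {U U₀ : Matrix (Nambu N) (Nambu N) ℂ}

theorem sqrt_pairWeight_clean_le (hh : 1 < h) (α : Fin N) :
    √(pairWeight h (cleanEnergy h α / 2)) ≤ N := by
  rw [Real.sqrt_le_left (Nat.cast_nonneg N)]
  exact pairWeight_clean_le hh α

/-- The hypothesis is used in both directions. Since the weight is at most N², the gap is O(N⁻²);
since the gap is at least of order N⁻², the square root of the weight is at least of order N. As the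
weight times the distance to the band edge is at most 2, α is near the edge, and β follows by the
bound on the gap. -/
theorem energy_le_of_gap_le_pairWeight (hh : 1 < h) {b ε v : ℝ} (hb : 0 < b) (hε : 0 < ε)
    (hv0 : 0 ≤ v) (hv : v * (N : ℝ) ^ 3 ≤ b) {α β : Fin N}
    (hne : cleanEnergy h α ≠ cleanEnergy h β)
    (hαβ : ε * |cleanEnergy h α - cleanEnergy h β| ≤
      8 * v * √(pairWeight h (cleanEnergy h α / 2))) :
    cleanEnergy h α / 2 - (h - 1) ≤ (512 * b ^ 2 / ε ^ 2 + 4 * b / ε) / (N : ℝ) ^ 2 ∧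
    cleanEnergy h β / 2 - (h - 1) ≤ (512 * b ^ 2 / ε ^ 2 + 4 * b / ε) / (N : ℝ) ^ 2 := by
  have hN : (0 : ℝ) < N := by exact_mod_cast Fin.pos α
  have h1 := min_gap hh hne
  have h2 := sqrt_pairWeight_clean_le hh α
  have ht : 0 < cleanEnergy h α / 2 - (h - 1) := by linarith [sub_one_lt_cleanEnergy hh α]
  have h3 := pairWeight_le hh (sub_one_lt_cleanEnergy hh α)
  rw [le_div_iff₀ ht] at h3
  have h4 : √(pairWeight h (cleanEnergy h α / 2)) ^ 2 * (cleanEnergy h α / 2 - (h - 1)) ≤ 2 := by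
    rcases le_total 0 (pairWeight h (cleanEnergy h α / 2)) with h5 | h5
    · rwa [Real.sq_sqrt h5]
    · rw [Real.sqrt_eq_zero_of_nonpos h5]; norm_num
  have h5 : (cleanEnergy h β / 2 - (h - 1)) - (cleanEnergy h α / 2 - (h - 1)) ≤
      |cleanEnergy h α - cleanEnergy h β| / 2 := by
    linarith [neg_abs_le (cleanEnergy h α - cleanEnergy h β)]
  have hg0 := Real.sqrt_nonneg (pairWeight h (cleanEnergy h α / 2))
  generalize √(pairWeight h (cleanEnergy h α / 2)) = g at *
  generalize |cleanEnergy h α - cleanEnergy h β| = e at *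
  generalize cleanEnergy h α / 2 - (h - 1) = t at *
  generalize cleanEnergy h β / 2 - (h - 1) = s at *
  have he : e ≤ 8 * b / (ε * (N : ℝ) ^ 2) := by
    rw [le_div_iff₀ (by positivity)]
    calc e * (ε * (N : ℝ) ^ 2) = (ε * e) * (N : ℝ) ^ 2 := by ring
      _ ≤ (8 * v * g) * (N : ℝ) ^ 2 := by gcongr
      _ ≤ (8 * v * N) * (N : ℝ) ^ 2 := by gcongr
      _ = 8 * (v * (N : ℝ) ^ 3) := by ring
      _ ≤ 8 * b := by gcongr
  have hg : ε * N ≤ 16 * b * g := by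
    calc ε * N = ε * (1 / (2 * (N : ℝ) ^ 2)) * (2 * (N : ℝ) ^ 3) := by field_simp
      _ ≤ ε * e * (2 * (N : ℝ) ^ 3) := by gcongr
      _ ≤ 8 * v * g * (2 * (N : ℝ) ^ 3) := by gcongr
      _ = 16 * (v * (N : ℝ) ^ 3) * g := by ring
      _ ≤ 16 * b * g := by gcongr
  have htb : t ≤ 512 * b ^ 2 / ε ^ 2 / (N : ℝ) ^ 2 := by
    rw [div_div, le_div_iff₀ (by positivity)]
    calc t * (ε ^ 2 * (N : ℝ) ^ 2) = (ε * N) ^ 2 * t := by ring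
      _ ≤ (16 * b * g) ^ 2 * t := by gcongr
      _ = 256 * b ^ 2 * (g ^ 2 * t) := by ring
      _ ≤ 256 * b ^ 2 * 2 := by gcongr
      _ = _ := by ring
  have he2 : 8 * b / (ε * (N : ℝ) ^ 2) = 2 * (4 * b / ε / (N : ℝ) ^ 2) := by
    field_simp; norm_num
  have hp : 0 ≤ 4 * b / ε / (N : ℝ) ^ 2 := by positivity
  rw [add_div]
  constructor <;> linarith

theorem energy_le_of_pairingShift (hh : 1 < h) {b ε : ℝ} (hb : 0 < b) (hε : 0 < ε)
    (hv : ‖V‖ * (N : ℝ) ^ 3 ≤ b) (h₀ : Diagonalizes (isingMatrix fun _ : Fin N => 0) E₀ U₀)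
    (hU : Diagonalizes (isingMatrix fun _ : Fin N => h) (cleanEnergy h) U)
    {α β : Fin N} (hαβ : ε / 2 ≤ ‖pairingShift (cleanEnergy h) U₀ U V α β‖) :
    cleanEnergy h α / 2 - (h - 1) ≤ (512 * b ^ 2 / ε ^ 2 + 4 * b / ε) / (N : ℝ) ^ 2 ∧
    cleanEnergy h β / 2 - (h - 1) ≤ (512 * b ^ 2 / ε ^ 2 + 4 * b / ε) / (N : ℝ) ^ 2 := by
  have hne : cleanEnergy h α ≠ cleanEnergy h β := fun h1 => by
    rw [pairingShift_apply_eq_zero hh h₀ hU h1, norm_zero] at hαβ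
    linarith
  have h1 := norm_pairingShift_le (V := V) hh h₀ hU hne
  have h2 : ε / 2 * |cleanEnergy h α - cleanEnergy h β| ≤ 2 * ‖V‖ *
      (√(pairWeight h (cleanEnergy h α / 2)) + √(pairWeight h (cleanEnergy h β / 2))) :=
    le_trans (by gcongr) h1
  have hv0 := norm_nonneg V
  -- The larger of the two weights dominates the sum; its index plays the role of α in
  -- `energy_le_of_gap_le_pairWeight`.
  rcases le_total (√(pairWeight h (cleanEnergy h α / 2)))
    (√(pairWeight h (cleanEnergy h β / 2))) with h3 | h3
  · refine (energy_le_of_gap_le_pairWeight hh hb hε hv0 hv hne.symm ?_).symm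
    rw [abs_sub_comm]
    nlinarith
  · refine energy_le_of_gap_le_pairWeight hh hb hε hv0 hv hne ?_
    nlinarith

theorem norm_pairingShift_le_const (hh : 1 < h) {b : ℝ} (hb : 0 < b)
    (hv : ‖V‖ * (N : ℝ) ^ 3 ≤ b) (h₀ : Diagonalizes (isingMatrix fun _ : Fin N => 0) E₀ U₀)
    (hU : Diagonalizes (isingMatrix fun _ : Fin N => h) (cleanEnergy h) U) (α β : Fin N) :
    ‖pairingShift (cleanEnergy h) U₀ U V α β‖ ≤ 8 * b := by
  by_cases hne : cleanEnergy h α = cleanEnergy h β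
  · rw [pairingShift_apply_eq_zero hh h₀ hU hne, norm_zero]
    positivity
  have hN : (0 : ℝ) < N := by exact_mod_cast Fin.pos α
  have h1 := norm_pairingShift_le (V := V) hh h₀ hU hne
  have h2 := min_gap hh hne
  have h3 := sqrt_pairWeight_clean_le hh α
  have h4 := sqrt_pairWeight_clean_le hh β
  calc ‖pairingShift (cleanEnergy h) U₀ U V α β‖ =
        ‖pairingShift (cleanEnergy h) U₀ U V α β‖ * (1 / (2 * (N : ℝ) ^ 2)) *
          (2 * (N : ℝ) ^ 2) := by field_simp
    _ ≤ ‖pairingShift (cleanEnergy h) U₀ U V α β‖ * |cleanEnergy h α - cleanEnergy h β| *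
          (2 * (N : ℝ) ^ 2) := by gcongr
    _ ≤ 2 * ‖V‖ * (√(pairWeight h (cleanEnergy h α / 2)) +
          √(pairWeight h (cleanEnergy h β / 2))) * (2 * (N : ℝ) ^ 2) := by gcongr
    _ ≤ 2 * ‖V‖ * (N + N) * (2 * (N : ℝ) ^ 2) := by gcongr
    _ = 8 * (‖V‖ * (N : ℝ) ^ 3) := by ring
    _ ≤ 8 * b := by gcongr

/-- The distance to the band edge is at least 2(2l + 1)²/N² at level l, so M bounds the level; two
indices per level turn this into a bound counted from the end. -/
theorem le_add_of_energy_le (hh : 1 < h) {M : ℝ} {K : ℕ} (hK : M + 1 ≤ K) {α : Fin N}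
    (hα : cleanEnergy h α / 2 - (h - 1) ≤ M / (N : ℝ) ^ 2) : N ≤ α.val + K := by
  have hN : (0 : ℝ) < N := by exact_mod_cast Fin.pos α
  have h1 := (le_cleanEnergy_sub hh α).trans hα
  rw [div_le_div_iff_of_pos_right (by positivity)] at h1
  have h2 : N ≤ α.val + (2 * level α + 1) + 1 := by
    have := α.isLt
    unfold level
    omega
  have h3 : (2 * level α + 1 : ℝ) + 1 ≤ K := by
    have : (0 : ℝ) ≤ level α := Nat.cast_nonneg _
    nlinarith
  have h4 : 2 * level α + 1 + 1 ≤ K := by exact_mod_cast h3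
  omega

theorem robustness_of_quasiparticles (hh : 1 < h) (c : ℝ) (hc : 0 < c) :
    ∃ (C : ℝ) (r : ℕ → ℝ) (K : ℝ → ℕ), Tendsto r atTop (𝓝 0) ∧
      ∀ᶠ N : ℕ in atTop, ∀ V : Matrix (Nambu N) (Nambu N) ℂ, IsPerturbation V →
        ‖V‖ / ‖isingMatrix (fun _ : Fin N => h)‖ ≤ c / (N : ℝ) ^ 3 →
        (∃ E₀ U₀, Diagonalizes (isingMatrix (fun _ : Fin N => 0)) E₀ U₀) ∧
        (∃ E' U', Diagonalizes (isingMatrix (fun _ : Fin N => h) + V) E' U') ∧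
        ∀ E' U', Diagonalizes (isingMatrix (fun _ : Fin N => h) + V) E' U' →
          ∃ E U, Diagonalizes (isingMatrix (fun _ : Fin N => h)) E U ∧
            ‖U' * U⁻¹ - 1‖ ≤ r N ∧
            (∀ α, |E' α - E α| ≤ r N) ∧
            ∀ E₀ U₀, Diagonalizes (isingMatrix (fun _ : Fin N => 0)) E₀ U₀ →
              IsUnit (blockW₁ U₀ U) ∧ Thouless U₀ U (bcsMatrix U₀ U) ∧
              IsUnit (blockW₁ U₀ U') ∧ Thouless U₀ U' (bcsMatrix U₀ U') ∧
              (∀ α β, ‖(bcsMatrix U₀ U' - bcsMatrix U₀ U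
                  - (mixing E U V * bcsMatrix U₀ U
                      - bcsMatrix U₀ U * conjMat (mixing E U V))) α β‖ ≤ r N) ∧
              (∀ α β, bcsMatrix U₀ U α β ≠ 0 →
                ‖bcsMatrix U₀ U' α β - bcsMatrix U₀ U α β‖ ≤ r N) ∧
              (∀ α β, ‖bcsMatrix U₀ U' α β - bcsMatrix U₀ U α β‖ ≤ C) ∧
              (∀ ε : ℝ, 0 < ε → ∀ α β,
                ε ≤ ‖bcsMatrix U₀ U' α β - bcsMatrix U₀ U α β‖ →
                (∀ γ, E α ≤ E γ + K ε / (N : ℝ) ^ 2 ∧ E β ≤ E γ + K ε / (N : ℝ) ^ 2) ∧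
                N ≤ α.val + K ε ∧ N ≤ β.val + K ε) := by
  have hpos : 0 < h - 1 := by linarith
  set b := c * (h + 1) with hb_def
  have hb : 0 < b := by positivity
  obtain ⟨C₀, hC₀, key⟩ := exists_adapted_pairing hh hb
  set D := C₀ + 2 * b with hD
  have hD0 : 0 < D := by positivity
  -- K adds three contributions: L = 4D²/ε² bounds those N for which the remainder still exceeds
  -- ε/2, L²·2(h + 1) makes the energy claim trivial for these N, and 2M + 1 serves the remaining N.
  refine ⟨8 * b + D, fun N => D / √N, fun ε => ⌈4 * D ^ 2 / ε ^ 2 +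
    (4 * D ^ 2 / ε ^ 2) ^ 2 * (2 * (h + 1)) + (2 * (512 * b ^ 2 / ε ^ 2 + 4 * b / |ε|) + 1)⌉₊, ?_, ?_⟩
  · exact (Real.tendsto_sqrt_atTop.comp tendsto_natCast_atTop_atTop).const_div_atTop D
  -- The last term of the threshold forces ‖V‖ < h - 1, which ensures that the perturbed matrix can
  -- be diagonalized.
  filter_upwards [tendsto_natCast_atTop_atTop.eventually_ge_atTop (1 + C₀ + 2 * b / (h - 1))] with
    N hN V hV hVn
  have hbh : 0 < b / (h - 1) := by positivity
  rw [mul_div_assoc] at hN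
  have hN1 : (1 : ℝ) ≤ N := by linarith
  have hN0 : (0 : ℝ) < N := by linarith
  have hs : 0 < √(N : ℝ) := Real.sqrt_pos.2 hN0
  have hs1 : 1 ≤ √(N : ℝ) := Real.one_le_sqrt.2 hN1
  have hsN : √(N : ℝ) ≤ N := by
    rw [Real.sqrt_le_left hN0.le]; nlinarith
  have hN3 : (N : ℝ) ≤ (N : ℝ) ^ 3 := le_self_pow₀ hN1 three_ne_zero
  have hVb : ‖V‖ ≤ b / (N : ℝ) ^ 3 := by
    have h1 := sub_one_le_norm_isingMatrix (N := N) hh (by exact_mod_cast hN0)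
    have h2 := norm_isingMatrix_le (N := N) hh
    rw [div_le_iff₀ (by linarith)] at hVn
    calc ‖V‖ ≤ c / (N : ℝ) ^ 3 * (h + 1) := hVn.trans (by gcongr)
      _ = _ := by rw [hb_def]; ring
  have hv : ‖V‖ * (N : ℝ) ^ 3 ≤ b := by rwa [le_div_iff₀ (by positivity)] at hVb
  have hVs : ‖V‖ < h - 1 := by
    refine hVb.trans_lt ?_
    rw [div_lt_iff₀ (by positivity)]
    have : b / (h - 1) < (N : ℝ) ^ 3 := by linarith
    rw [div_lt_iff₀ hpos] at this
    linarith
  refine ⟨exists_diagonalizes_zero_field N, exists_diagonalizes_perturbed hh hV hVs,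
    fun E' U' hU' => ?_⟩
  obtain ⟨U, hU, hX, hG⟩ := key N V E' U' (by linarith) hV.1 hVb hU'
  have hCD : C₀ / √N ≤ D / √N := by
    gcongr; linarith
  refine ⟨cleanEnergy h, U, hU, hX.trans hCD, fun α => ?_, fun E₀ U₀ h₀ => ?_⟩
  · have h1 := hU.abs_energy_sub_le hU' α
    rw [add_sub_cancel_left] at h1
    refine h1.trans ?_
    calc 2 * ‖V‖ ≤ 2 * (b / (N : ℝ) ^ 3) := by gcongr
      _ ≤ 2 * (b / √N) := by gcongr; exact hsN.trans hN3
      _ = 2 * b / √N := by ring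
      _ ≤ _ := by gcongr; linarith
  obtain ⟨hu', hΔ⟩ := hG E₀ U₀ h₀
  have hu := isUnit_clean_blockW₁ hh h₀ hU
  have hΔ' : ∀ α β, ‖bcsMatrix U₀ U' α β - bcsMatrix U₀ U α β -
      pairingShift (cleanEnergy h) U₀ U V α β‖ ≤ D / √N := fun α β =>
    (norm_entry_le _ α β).trans (hΔ.trans hCD)
  have htri : ∀ α β, ‖bcsMatrix U₀ U' α β - bcsMatrix U₀ U α β‖ ≤
      ‖pairingShift (cleanEnergy h) U₀ U V α β‖ + D / √N := fun α β => by
    have h1 := norm_sub_norm_le (bcsMatrix U₀ U' α β - bcsMatrix U₀ U α β)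
      (pairingShift (cleanEnergy h) U₀ U V α β)
    linarith [hΔ' α β]
  refine ⟨hu, thouless_bcsMatrix h₀.isBogoliubov hU.isBogoliubov hu, hu',
    thouless_bcsMatrix h₀.isBogoliubov hU'.isBogoliubov hu', hΔ', fun α β hne => ?_,
    fun α β => ?_, fun ε hε α β hαβ => ?_⟩
  · have h1 : cleanEnergy h α = cleanEnergy h β := by
      by_contra h2
      exact hne (clean_bcsMatrix_eq_zero hh h₀ hU h2)
    have h2 := htri α β
    rwa [pairingShift_apply_eq_zero hh h₀ hU h1, norm_zero, zero_add] at h2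
  · refine (htri α β).trans (add_le_add (norm_pairingShift_le_const hh hb hv h₀ hU α β) ?_)
    exact div_le_self hD0.le hs1
  · rw [abs_of_pos hε]
    set M := 512 * b ^ 2 / ε ^ 2 + 4 * b / ε with hM
    have hM0 : 0 < M := by positivity
    set L := 4 * D ^ 2 / ε ^ 2 with hL
    have hL0 : 0 < L := by positivity
    set K := ⌈L + L ^ 2 * (2 * (h + 1)) + (2 * M + 1)⌉₊ with hK
    have hLh : 0 < L ^ 2 * (2 * (h + 1)) := by positivity
    have hK1 : L + L ^ 2 * (2 * (h + 1)) + (2 * M + 1) ≤ K := Nat.le_ceil _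
    -- If the remainder is below ε/2, the first-order shift itself is at least ε/2 and localizes at
    -- the edge. Otherwise N ≤ L, and K exceeds both N and the bandwidth bound 2(h + 1) times N².
    by_cases hsmall : D / √N ≤ ε / 2
    · have h1 : ε / 2 ≤ ‖pairingShift (cleanEnergy h) U₀ U V α β‖ := by
        linarith [htri α β]
      obtain ⟨h2, h3⟩ := energy_le_of_pairingShift hh hb hε hv h₀ hU h1
      have h4 : 2 * (M / (N : ℝ) ^ 2) ≤ K / (N : ℝ) ^ 2 := by
        rw [← mul_div_assoc]; gcongr; linarith
      refine ⟨fun γ => ?_, le_add_of_energy_le hh (by linarith) h2,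
        le_add_of_energy_le hh (by linarith) h3⟩
      have h5 := sub_one_lt_cleanEnergy hh γ
      constructor <;> linarith
    · have h1 : (N : ℝ) ≤ L := by
        rw [not_le, div_lt_div_iff₀ two_pos hs] at hsmall
        rw [hL, le_div_iff₀ (by positivity)]
        calc (N : ℝ) * ε ^ 2 = (ε * √N) ^ 2 := by rw [mul_pow, Real.sq_sqrt hN0.le]; ring
          _ ≤ (D * 2) ^ 2 := by gcongr
          _ = _ := by ring
      have h2 : N ≤ K := by
        have : (N : ℝ) ≤ K := by linarith
        exact_mod_cast this
      have h3 : 2 * (h + 1) ≤ K / (N : ℝ) ^ 2 := by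
        rw [le_div_iff₀ (by positivity)]
        calc 2 * (h + 1) * (N : ℝ) ^ 2 ≤ 2 * (h + 1) * L ^ 2 := by gcongr
          _ ≤ (K : ℝ) := by linarith
      refine ⟨fun γ => ?_, by omega, by omega⟩
      have h5 := hU.pos γ
      constructor
      · linarith [cleanEnergy_le hh α]
      · linarith [cleanEnergy_le hh β]

end Robustness

/-! ### Basis-independent lower bounds between two degenerate levels. -/

section LowestBlock

variable {N : ℕ} {h : ℝ} {V : Matrix (Nambu N) (Nambu N) ℂ} {E₀ : Fin N → ℝ}
  {U U₀ : Matrix (Nambu N) (Nambu N) ℂ}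

theorem cleanEnergy_ne_of_level_ne (hh : 1 < h) {α β : Fin N} (hne : level α ≠ level β) :
    cleanEnergy h α ≠ cleanEnergy h β := by
  have h1 := gap_le hh hne
  have hN : (0 : ℝ) < N := by exact_mod_cast Fin.pos α
  have h2 : (0 : ℝ) < min ((N : ℝ) - α) (α + 1) := by
    have : (α : ℝ) < N := by exact_mod_cast α.isLt
    exact lt_min (by linarith) (by positivity)
  have h3 : (α : ℝ) ≠ β := fun h4 => hne (by rw [Fin.ext (by exact_mod_cast h4 : α.val = β.val)])
  have h4 : 0 < |(α : ℝ) - β| := abs_pos.2 (sub_ne_zero.2 h3)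
  have h5 : 0 < |cleanEnergy h α - cleanEnergy h β| := lt_of_lt_of_le (by positivity) h1
  exact sub_ne_zero.1 (abs_pos.1 h5)

theorem clean_bcsMatrix_eq_zero_of_level_ne (hh : 1 < h)
    (h₀ : Diagonalizes (isingMatrix fun _ : Fin N => 0) E₀ U₀)
    (hU : Diagonalizes (isingMatrix fun _ : Fin N => h) (cleanEnergy h) U) {α β : Fin N}
    (hne : level α ≠ level β) : bcsMatrix U₀ U α β = 0 :=
  clean_bcsMatrix_eq_zero hh h₀ hU (cleanEnergy_ne_of_level_ne hh hne)

/-- The diagonal of AGG†A† computed in two ways: when GG† is diagonal, multiplication by G only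
reweights the columns of A in Hilbert–Schmidt norm. -/
theorem sum_sq_mul_of_mul_conjTranspose {n : Type*} [Fintype n] [DecidableEq n]
    {A G : Matrix n n ℂ} {p : n → ℝ} (hG : G * Gᴴ = Matrix.diagonal fun i => (p i : ℂ)) :
    ∑ i, ∑ j, ‖(A * G) i j‖ ^ 2 = ∑ i, ∑ j, p j * ‖A i j‖ ^ 2 := by
  refine Finset.sum_congr rfl fun i _ => ?_
  have h1 : ∀ B : Matrix n n ℂ, (B * Bᴴ) i i = ((∑ j, ‖B i j‖ ^ 2 : ℝ) : ℂ) := by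
    intro B
    rw [Matrix.mul_apply]
    push_cast
    refine Finset.sum_congr rfl fun j _ => ?_
    rw [Matrix.conjTranspose_apply, Complex.star_def, Complex.mul_conj']
  have h2 := h1 (A * G)
  rw [Matrix.conjTranspose_mul, Matrix.mul_assoc, ← Matrix.mul_assoc G, hG, Matrix.mul_apply] at h2
  have h3 : ((∑ j, ‖(A * G) i j‖ ^ 2 : ℝ) : ℂ) = ((∑ j, p j * ‖A i j‖ ^ 2 : ℝ) : ℂ) := by
    rw [← h2]
    push_cast
    refine Finset.sum_congr rfl fun j _ => ?_
    rw [Matrix.diagonal_mul, Matrix.conjTranspose_apply, Complex.star_def, ← Complex.mul_conj']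
    ring
  exact_mod_cast h3

theorem sum_sq_mul_of_conjTranspose_mul {n : Type*} [Fintype n] [DecidableEq n]
    {A G : Matrix n n ℂ} {p : n → ℝ} (hG : Gᴴ * G = Matrix.diagonal fun i => (p i : ℂ)) :
    ∑ i, ∑ j, ‖(G * A) i j‖ ^ 2 = ∑ i, ∑ j, p i * ‖A i j‖ ^ 2 := by
  have h1 := sum_sq_mul_of_mul_conjTranspose (A := Aᴴ) (G := Gᴴ) (p := p)
    (by rw [Matrix.conjTranspose_conjTranspose, hG])
  rw [← Matrix.conjTranspose_mul] at h1
  simp only [Matrix.conjTranspose_apply, norm_star] at h1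
  rw [Finset.sum_comm, h1, Finset.sum_comm]

/-- The block of a matrix between two levels of the clean chain. -/
noncomputable def levelBlock (m n : ℕ) (A : Matrix (Fin N) (Fin N) ℂ) :
    Matrix (Fin N) (Fin N) ℂ :=
  Matrix.of fun α β => if level α = m ∧ level β = n then A α β else 0

theorem card_level_le (m : ℕ) : (Finset.univ.filter fun α : Fin N => level α = m).card ≤ 2 := by
  have h1 := Finset.card_le_card_of_injOn (s := Finset.univ.filter fun α : Fin N => level α = m)
    (t := Finset.range 2) (fun α => (N - 1 - α.val) % 2)
    (fun α _ => by simp only [Finset.coe_range, Set.mem_Iio]; omega)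
    (fun α hα β hβ hαβ => by
      have := α.isLt
      have := β.isLt
      have hα' : level α = m := by simpa using hα
      have hβ' : level β = m := by simpa using hβ
      unfold level at hα' hβ'
      ext
      dsimp only at hαβ
      omega)
  simpa using h1

theorem sum_levelBlock_le {m n : ℕ} {A : Matrix (Fin N) (Fin N) ℂ} {q : ℝ} (hq : 0 ≤ q)
    (hA : ∀ α β, level α = m → level β = n → ‖A α β‖ ^ 2 ≤ q)
    (hA' : ∀ α β, ¬ (level α = m ∧ level β = n) → A α β = 0) :
    ∑ α, ∑ β, ‖A α β‖ ^ 2 ≤ 4 * q := by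
  calc ∑ α, ∑ β, ‖A α β‖ ^ 2 ≤ ∑ α : Fin N, ∑ β : Fin N,
        (if level α = m then 1 else 0) * (if level β = n then 1 else 0) * q := by
        refine Finset.sum_le_sum fun α _ => Finset.sum_le_sum fun β _ => ?_
        by_cases h1 : level α = m ∧ level β = n
        · rw [if_pos h1.1, if_pos h1.2, one_mul, one_mul]
          exact hA α β h1.1 h1.2
        · rw [hA' α β h1, norm_zero, zero_pow two_ne_zero]
          split_ifs <;> simp [hq]
    _ = ((Finset.univ.filter fun α : Fin N => level α = m).card : ℝ) *
          ((Finset.univ.filter fun β : Fin N => level β = n).card : ℝ) * q := by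
        simp_rw [mul_assoc, ← Finset.mul_sum, ← Finset.sum_mul]
        rw [Finset.sum_boole, Finset.sum_boole]
    _ ≤ 2 * 2 * q := by
        gcongr
        · exact_mod_cast card_level_le m
        · exact_mod_cast card_level_le n
    _ = 4 * q := by ring

/-- G preserves levels, so restricting X to a block between two levels commutes with multiplication
by G from either side. -/
theorem levelBlock_mul_sub (hh : 1 < h)
    (h₀ : Diagonalizes (isingMatrix fun _ : Fin N => 0) E₀ U₀)
    (hU : Diagonalizes (isingMatrix fun _ : Fin N => h) (cleanEnergy h) U)
    (m n : ℕ) (X : Matrix (Fin N) (Fin N) ℂ) :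
    levelBlock m n X * bcsMatrix U₀ U - bcsMatrix U₀ U * conjMat (levelBlock m n X) =
      levelBlock m n (X * bcsMatrix U₀ U - bcsMatrix U₀ U * conjMat X) := by
  have hz := fun {γ δ : Fin N} (hne : level γ ≠ level δ) =>
    clean_bcsMatrix_eq_zero_of_level_ne hh h₀ hU hne
  ext α β
  have e1 : ∀ γ, levelBlock m n X α γ * bcsMatrix U₀ U γ β =
      if level α = m ∧ level β = n then X α γ * bcsMatrix U₀ U γ β else 0 := fun γ => by
    by_cases h1 : level γ = level β
    · simp [levelBlock, h1]
    · simp [hz h1]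
  have e2 : ∀ γ, bcsMatrix U₀ U α γ * conjMat (levelBlock m n X) γ β =
      if level α = m ∧ level β = n then bcsMatrix U₀ U α γ * conjMat X γ β else 0 := fun γ => by
    by_cases h1 : level α = level γ
    · simp only [levelBlock, conjMat_apply, Matrix.of_apply, h1]
      split_ifs <;> simp
    · simp [hz h1]
  rw [Matrix.sub_apply, Matrix.mul_apply, Matrix.mul_apply]
  simp only [e1, e2]
  simp only [levelBlock, Matrix.of_apply, Matrix.sub_apply, Matrix.mul_apply]
  split_ifs <;> simp

/-- On the block A of the perturbation the squared Hilbert–Schmidt norms of GA* and AG are exactly p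
and p' times that of A. If p > 2p' they cannot cancel, whatever basis is used inside the degenerate
levels, and the block has at most four entries, so one of them is large. -/
theorem exists_large_pairingShift (hh : 1 < h)
    (h₀ : Diagonalizes (isingMatrix fun _ : Fin N => 0) E₀ U₀)
    (hU : Diagonalizes (isingMatrix fun _ : Fin N => h) (cleanEnergy h) U)
    {m n : ℕ} (hmn : m ≠ n) {e p p' M : ℝ} (hM : 0 < M) (hp : 2 * p' < p)
    (hpm : ∀ α : Fin N, level α = m → pairWeight h (cleanEnergy h α / 2) = p)
    (hpn : ∀ α : Fin N, level α = n → pairWeight h (cleanEnergy h α / 2) = p')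
    (hen : ∀ α β : Fin N, level α = m → level β = n → |cleanEnergy h α - cleanEnergy h β| ≤ e)
    (hX : M ≤ ∑ α, ∑ β, ‖levelBlock m n (U * V * U⁻¹).toBlocks₁₁ α β‖ ^ 2) :
    ∃ α β, level α = m ∧ level β = n ∧
      (p - 2 * p') * M ≤ 4 * e ^ 2 * ‖pairingShift (cleanEnergy h) U₀ U V α β‖ ^ 2 := by
  set X := (U * V * U⁻¹).toBlocks₁₁
  set A := levelBlock m n X with hA
  have hT : ∀ α β : Fin N, level α = m → level β = n →
      4 * ‖(X * bcsMatrix U₀ U - bcsMatrix U₀ U * conjMat X) α β‖ ^ 2 ≤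
        e ^ 2 * ‖pairingShift (cleanEnergy h) U₀ U V α β‖ ^ 2 := by
    intro α β hα hβ
    have hne := cleanEnergy_ne_of_level_ne hh (by rw [hα, hβ]; exact hmn : level α ≠ level β)
    have h1 := congrArg norm (pairingShift_apply (V := V) hh h₀ hU hne)
    rw [norm_div, Complex.norm_real, Real.norm_eq_abs,
      eq_div_iff (abs_pos.2 (sub_ne_zero.2 hne)).ne', norm_mul, Complex.norm_ofNat] at h1
    rw [Matrix.sub_apply]
    calc _ = (‖pairingShift (cleanEnergy h) U₀ U V α β‖ *
          |cleanEnergy h α - cleanEnergy h β|) ^ 2 := by rw [h1]; ring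
      _ ≤ (‖pairingShift (cleanEnergy h) U₀ U V α β‖ * e) ^ 2 := by
        gcongr
        exact hen α β hα hβ
      _ = _ := by ring
  have hAG : ∑ α, ∑ β, ‖(A * bcsMatrix U₀ U) α β‖ ^ 2 = p' * ∑ α, ∑ β, ‖A α β‖ ^ 2 := by
    rw [sum_sq_mul_of_mul_conjTranspose (clean_bcsMatrix_mul_conjTranspose hh h₀ hU),
      Finset.mul_sum]
    refine Finset.sum_congr rfl fun α _ => ?_
    rw [Finset.mul_sum]
    refine Finset.sum_congr rfl fun β _ => ?_
    by_cases h1 : level α = m ∧ level β = n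
    · rw [hpn β h1.2]
    · simp [hA, levelBlock, h1]
  have hGA : ∑ α, ∑ β, ‖(bcsMatrix U₀ U * conjMat A) α β‖ ^ 2 = p * ∑ α, ∑ β, ‖A α β‖ ^ 2 := by
    rw [sum_sq_mul_of_conjTranspose_mul (clean_bcsMatrix_conjTranspose_mul hh h₀ hU),
      Finset.mul_sum]
    refine Finset.sum_congr rfl fun α _ => ?_
    rw [Finset.mul_sum]
    refine Finset.sum_congr rfl fun β _ => ?_
    rw [conjMat_apply, norm_star]
    by_cases h1 : level α = m ∧ level β = n
    · rw [hpm α h1.1]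
    · simp [hA, levelBlock, h1]
  have hS := levelBlock_mul_sub hh h₀ hU m n X
  rw [← hA] at hS
  set S := levelBlock m n (X * bcsMatrix U₀ U - bcsMatrix U₀ U * conjMat X) with hSdef
  have hsum : ∑ α, ∑ β, ‖(bcsMatrix U₀ U * conjMat A) α β‖ ^ 2 ≤
      2 * (∑ α, ∑ β, ‖(A * bcsMatrix U₀ U) α β‖ ^ 2) + 2 * ∑ α, ∑ β, ‖S α β‖ ^ 2 := by
    rw [Finset.mul_sum, Finset.mul_sum, ← Finset.sum_add_distrib]
    refine Finset.sum_le_sum fun α _ => ?_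
    rw [Finset.mul_sum, Finset.mul_sum, ← Finset.sum_add_distrib]
    refine Finset.sum_le_sum fun β _ => ?_
    have h1 : (bcsMatrix U₀ U * conjMat A) α β = (A * bcsMatrix U₀ U) α β - S α β := by
      rw [← hS, Matrix.sub_apply, sub_sub_cancel]
    rw [h1]
    have h2 := norm_sub_le ((A * bcsMatrix U₀ U) α β) (S α β)
    calc _ ≤ (‖(A * bcsMatrix U₀ U) α β‖ + ‖S α β‖) ^ 2 := by gcongr
      _ ≤ _ := by nlinarith [sq_nonneg (‖(A * bcsMatrix U₀ U) α β‖ - ‖S α β‖)]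
  rw [hAG, hGA] at hsum
  have hpp : 0 < p - 2 * p' := by linarith
  have hpM : (p - 2 * p') * M ≤ 2 * ∑ α, ∑ β, ‖S α β‖ ^ 2 := by
    have : (p - 2 * p') * M ≤ (p - 2 * p') * ∑ α, ∑ β, ‖A α β‖ ^ 2 := by gcongr
    linarith
  -- Otherwise each of the at most four squared entries of S would be at most (p - 2p')M/16, with
  -- sum at most half of the lower bound (p - 2p')M/2 in `hpM`.
  by_contra! hcon
  have hbound := sum_levelBlock_le (m := m) (n := n) (A := S) (q := (p - 2 * p') * M / 16)
    (by positivity) (fun α β hα hβ => by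
      have h1 := hT α β hα hβ
      have h2 := hcon α β hα hβ
      rw [hSdef, levelBlock, Matrix.of_apply, if_pos ⟨hα, hβ⟩]
      linarith) (fun α β h1 => by rw [hSdef, levelBlock, Matrix.of_apply, if_neg h1])
  have : 0 < (p - 2 * p') * M := by positivity
  linarith

theorem Diagonalizes.mulVec_eigenvector_eq_zero {H : Matrix (Nambu N) (Nambu N) ℂ}
    {E : Fin N → ℝ} (hU : Diagonalizes H E U) {x : Nambu N → ℂ} {s : ℝ}
    (hx : H *ᵥ x = (s : ℂ) • x) {a : Nambu N} (ha : halfLevels E a ≠ s) : (U *ᵥ x) a = 0 := by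
  have h1 : U *ᵥ (H *ᵥ x) = (Matrix.diagonal fun a => (halfLevels E a : ℂ)) *ᵥ (U *ᵥ x) := by
    rw [Matrix.mulVec_mulVec, hU.mul_eq, Matrix.mulVec_mulVec]
  have h2 := congrFun h1 a
  rw [hx, Matrix.mulVec_smul, Matrix.mulVec_diagonal, Pi.smul_apply, smul_eq_mul] at h2
  have h3 : ((halfLevels E a : ℂ) - s) * (U *ᵥ x) a = 0 := by linear_combination -h2
  refine (mul_eq_zero.1 h3).resolve_left (sub_ne_zero.2 ?_)
  exact_mod_cast ha

/-- U carries normalized eigenvectors to unit vectors supported on their levels, so Cauchy–Schwarz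
applies to the block. This transfers a matrix element between plane waves to any, possibly adapted,
basis U. -/
theorem sq_norm_matrixElement_le (hh : 1 < h)
    (hU : Diagonalizes (isingMatrix fun _ : Fin N => h) (cleanEnergy h) U)
    {x y : Nambu N → ℂ} {γ δ : Fin N}
    (hx : isingMatrix (fun _ : Fin N => h) *ᵥ x = ((cleanEnergy h γ / 2 : ℝ) : ℂ) • x)
    (hy : isingMatrix (fun _ : Fin N => h) *ᵥ y = ((cleanEnergy h δ / 2 : ℝ) : ℂ) • y)
    (hx1 : star x ⬝ᵥ x = 1) (hy1 : star y ⬝ᵥ y = 1) :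
    ‖star x ⬝ᵥ (V *ᵥ y)‖ ^ 2 ≤
      ∑ α, ∑ β, ‖levelBlock (level γ) (level δ) (U * V * U⁻¹).toBlocks₁₁ α β‖ ^ 2 := by
  have hsq : ∀ z : Nambu N → ℂ, star z ⬝ᵥ z = 1 → ∑ a, ‖(U *ᵥ z) a‖ ^ 2 = 1 := fun z hz => by
    rw [sum_sq_mulVec_unitary hU.unitary]
    have : ((∑ a, ‖z a‖ ^ 2 : ℝ) : ℂ) = 1 := by
      rw [← hz]
      simp only [dotProduct, Complex.ofReal_sum, Complex.ofReal_pow, Pi.star_apply]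
      exact Finset.sum_congr rfl fun a _ => (Complex.conj_mul' _).symm
    exact_mod_cast this
  have hsupp : ∀ (z : Nambu N → ℂ) (ε : Fin N),
      isingMatrix (fun _ : Fin N => h) *ᵥ z = ((cleanEnergy h ε / 2 : ℝ) : ℂ) • z →
      (∀ α, level α ≠ level ε → (U *ᵥ z) (Sum.inl α) = 0) ∧
      ∀ α, (U *ᵥ z) (Sum.inr α) = 0 := by
    intro z ε hz
    refine ⟨fun α hα => hU.mulVec_eigenvector_eq_zero hz ?_,
      fun α => hU.mulVec_eigenvector_eq_zero hz ?_⟩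
    · simp only [halfLevels, Sum.elim_inl]
      have := cleanEnergy_ne_of_level_ne hh hα
      intro h1
      exact this (by linarith)
    · simp only [halfLevels, Sum.elim_inr]
      intro h1
      linarith [sub_one_lt_cleanEnergy hh α, sub_one_lt_cleanEnergy hh ε]
  obtain ⟨hxl, hxr⟩ := hsupp x γ hx
  obtain ⟨hyl, hyr⟩ := hsupp y δ hy
  have hxs := hsq x hx1
  have hys := hsq y hy1
  have e0 : Uᴴ * (U * V * Uᴴ) * U = Uᴴ * U * V * (Uᴴ * U) := by
    simp only [Matrix.mul_assoc]
  have e1 : star x ⬝ᵥ (V *ᵥ y) = star (U *ᵥ x) ⬝ᵥ ((U * V * U⁻¹) *ᵥ (U *ᵥ y)) := by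
    rw [inv_eq_conjTranspose hU.unitary, Matrix.star_mulVec, ← Matrix.dotProduct_mulVec,
      Matrix.mulVec_mulVec, Matrix.mulVec_mulVec, e0, hU.conjTranspose_mul, Matrix.one_mul,
      Matrix.mul_one]
  rw [Fintype.sum_sum_type] at hxs hys
  simp only [hxr, hyr, norm_zero, ne_eq, OfNat.ofNat_ne_zero, not_false_eq_true, zero_pow,
    Finset.sum_const_zero, add_zero] at hxs hys
  set A := levelBlock (level γ) (level δ) (U * V * U⁻¹).toBlocks₁₁ with hA
  have e2 : star (U *ᵥ x) ⬝ᵥ ((U * V * U⁻¹) *ᵥ (U *ᵥ y)) =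
      ∑ α, ∑ β, A α β * (star ((U *ᵥ x) (Sum.inl α)) * (U *ᵥ y) (Sum.inl β)) := by
    rw [dotProduct, Fintype.sum_sum_type]
    simp only [Pi.star_apply, hxr, star_zero, zero_mul, Finset.sum_const_zero, add_zero]
    refine Finset.sum_congr rfl fun α _ => ?_
    have e3 : ∀ (W : Matrix (Nambu N) (Nambu N) ℂ) (z : Nambu N → ℂ), (W *ᵥ z) (Sum.inl α) =
        ∑ β, W (Sum.inl α) (Sum.inl β) * z (Sum.inl β) +
          ∑ β, W (Sum.inl α) (Sum.inr β) * z (Sum.inr β) := fun W z => by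
      rw [Matrix.mulVec, dotProduct, Fintype.sum_sum_type]
    rw [e3 (U * V * U⁻¹)]
    simp only [hyr, mul_zero, Finset.sum_const_zero, add_zero, Finset.mul_sum]
    refine Finset.sum_congr rfl fun β _ => ?_
    by_cases h1 : level α = level γ
    · by_cases h2 : level β = level δ
      · simp only [hA, levelBlock, Matrix.of_apply, h1, h2, and_self, if_true, Matrix.toBlocks₁₁]
        ring
      · simp [hyl β h2]
    · simp [hxl α h1]
  rw [e1, e2]
  calc _ ≤ (∑ α, ∑ β, ‖A α β‖ * (‖(U *ᵥ x) (Sum.inl α)‖ * ‖(U *ᵥ y) (Sum.inl β)‖)) ^ 2 := by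
        gcongr
        refine (norm_sum_le _ _).trans (Finset.sum_le_sum fun α _ => ?_)
        refine (norm_sum_le _ _).trans (Finset.sum_le_sum fun β _ => ?_)
        rw [norm_mul, norm_mul, norm_star]
    _ ≤ (∑ α, ∑ β, ‖A α β‖ ^ 2) *
        ∑ α, ∑ β, (‖(U *ᵥ x) (Sum.inl α)‖ * ‖(U *ᵥ y) (Sum.inl β)‖) ^ 2 := by
        simp only [← Finset.sum_product']
        exact Finset.sum_mul_sq_le_sq_mul_sq _ _ _
    _ = _ := by
        simp only [mul_pow]
        rw [← Finset.sum_mul_sum, hxs, hys]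
        ring

end LowestBlock

/-! ### Large-N asymptotics of the lowest levels and the cosine field. -/

section Asymptotics

variable {h : ℝ}

/-- The positive momentum of the quasiparticles of level `m`. -/
noncomputable def levelMomentum (m N : ℕ) : ℝ := (2 * (m : ℝ) + 1) * Real.pi / N

theorem tendsto_levelMomentum (m : ℕ) : Tendsto (levelMomentum m) atTop (𝓝 0) :=
  tendsto_const_div_atTop_nhds_zero_nat _

theorem continuous_dispersion (h : ℝ) : Continuous (dispersion h) := by
  unfold dispersion
  fun_prop

theorem dispersion_zero (hh : 1 < h) : dispersion h 0 = h - 1 := by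
  rw [dispersion, Real.cos_zero, show 1 + h ^ 2 - 2 * h * 1 = (h - 1) ^ 2 by ring,
    Real.sqrt_sq (by linarith)]

theorem tendsto_dispersion_levelMomentum (hh : 1 < h) (m : ℕ) :
    Tendsto (fun N => dispersion h (levelMomentum m N)) atTop (𝓝 (h - 1)) := by
  have h1 := ((continuous_dispersion h).tendsto 0).comp (tendsto_levelMomentum m)
  rwa [dispersion_zero hh] at h1

/-- The band is quadratic at its edge: (ε - (h-1))(ε + (h-1)) = 4h sin²(k/2) = hk² sinc²(k/2), where
kN is constant and the sinc factor tends to 1. -/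
theorem tendsto_sq_mul_dispersion_sub (hh : 1 < h) (m : ℕ) :
    Tendsto (fun N : ℕ => (N : ℝ) ^ 2 * (dispersion h (levelMomentum m N) - (h - 1))) atTop
      (𝓝 (h * ((2 * (m : ℝ) + 1) * Real.pi) ^ 2 / (2 * (h - 1)))) := by
  have hpos : 0 < h - 1 := by linarith
  have h1 : Tendsto (fun N : ℕ => h * ((2 * (m : ℝ) + 1) * Real.pi) ^ 2 *
      Real.sinc (levelMomentum m N / 2) ^ 2 / (dispersion h (levelMomentum m N) + (h - 1))) atTop
      (𝓝 (h * ((2 * (m : ℝ) + 1) * Real.pi) ^ 2 * Real.sinc (0 / 2) ^ 2 /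
        ((h - 1) + (h - 1)))) := by
    refine Tendsto.div ?_ ((tendsto_dispersion_levelMomentum hh m).add_const _) (by linarith)
    refine Tendsto.const_mul _ (Tendsto.pow ?_ 2)
    exact (Real.continuous_sinc.tendsto _).comp ((tendsto_levelMomentum m).div_const 2)
  rw [zero_div, Real.sinc_zero, one_pow, mul_one, ← two_mul] at h1
  refine h1.congr' ?_
  filter_upwards [eventually_ne_atTop 0] with N hN
  have hN' : (N : ℝ) ≠ 0 := by exact_mod_cast hN
  set k := levelMomentum m N with hk
  have h2 := dispersion_sub_mul_add h k 0
  rw [dispersion_zero hh, Real.cos_zero] at h2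
  have h3 : Real.cos k = 1 - 2 * Real.sin (k / 2) ^ 2 := by
    have := Real.cos_two_mul (k / 2)
    rw [mul_div_cancel₀ _ two_ne_zero] at this
    linarith [Real.sin_sq_add_cos_sq (k / 2)]
  have h4 : Real.sin (k / 2) = k / 2 * Real.sinc (k / 2) := by
    by_cases h0 : k / 2 = 0
    · rw [h0]; simp
    · rw [Real.sinc_of_ne_zero h0, mul_div_cancel₀ _ h0]
  have h5 : (0 : ℝ) < dispersion h k + (h - 1) := by linarith [sub_one_le_dispersion h k]
  have h6 : (2 * (m : ℝ) + 1) * Real.pi = k * N := by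
    rw [hk, levelMomentum]; field_simp
  rw [div_eq_iff h5.ne', mul_assoc, mul_assoc ((N : ℝ) ^ 2), h2, h3, h4, h6]
  ring

/-- The denominator of the weight contains ε - (h - 1), which is of order N⁻². The limit is inverse
quadratic in 2m + 1, so the two lowest levels have weights in ratio 9. -/
theorem tendsto_pairWeight_div_sq (hh : 1 < h) (m : ℕ) :
    Tendsto (fun N : ℕ => pairWeight h (dispersion h (levelMomentum m N)) / (N : ℝ) ^ 2) atTop
      (𝓝 (4 * (h - 1) ^ 2 / (h * ((2 * (m : ℝ) + 1) * Real.pi)) ^ 2)) := by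
  have hpos : 0 < h - 1 := by linarith
  have hd := tendsto_dispersion_levelMomentum hh m
  have h1 : Tendsto (fun N : ℕ => (h ^ 2 - (dispersion h (levelMomentum m N) - 1) ^ 2) /
      ((dispersion h (levelMomentum m N) + (1 + h)) *
        ((N : ℝ) ^ 2 * (dispersion h (levelMomentum m N) - (h - 1))))) atTop
      (𝓝 ((h ^ 2 - ((h - 1) - 1) ^ 2) / (((h - 1) + (1 + h)) *
        (h * ((2 * (m : ℝ) + 1) * Real.pi) ^ 2 / (2 * (h - 1)))))) := by
    refine Tendsto.div (tendsto_const_nhds.sub ((hd.sub_const 1).pow 2))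
      ((hd.add_const _).mul (tendsto_sq_mul_dispersion_sub hh m)) ?_
    have := Real.pi_pos
    positivity
  have e : (h ^ 2 - ((h - 1) - 1) ^ 2) / (((h - 1) + (1 + h)) *
      (h * ((2 * (m : ℝ) + 1) * Real.pi) ^ 2 / (2 * (h - 1)))) =
      4 * (h - 1) ^ 2 / (h * ((2 * (m : ℝ) + 1) * Real.pi)) ^ 2 := by
    have := Real.pi_pos
    have : (2 * (m : ℝ) + 1) ≠ 0 := by positivity
    have : h ≠ 0 := by positivity
    have : h - 1 + (1 + h) ≠ 0 := by positivity
    field_simp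
    ring
  rw [e] at h1
  refine h1.congr fun N => ?_
  rw [pairWeight, div_div]
  congr 1
  ring

variable {N : ℕ}

theorem exp_levelMomentum (m : ℕ) (hN : N ≠ 0) :
    Complex.exp (levelMomentum m N * N * Complex.I) = -1 := by
  have h1 := exp_odd_mul_pi (m : ℤ) hN
  rw [← h1, levelMomentum]
  push_cast
  rfl

/-- The two momenta differ by 2π/N, the wave number of the cosine. One of its exponentials is
resonant and gives D·N/2; the other leaves wave number 4π/N, which sums to zero because N > 2. -/
theorem sum_cos_mul_exp (hN : 2 < N) (D : ℝ) :
    ∑ j : Fin N, ((D * Real.cos (2 * Real.pi * j.val / N) : ℝ) : ℂ) *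
      Complex.exp (((levelMomentum 1 N - levelMomentum 0 N : ℝ) : ℂ) * j * Complex.I) =
      ((D * N / 2 : ℝ) : ℂ) := by
  have hN0 : N ≠ 0 := by omega
  have hNC : (N : ℂ) ≠ 0 := by exact_mod_cast hN0
  have h1 : ∀ j : Fin N, ((D * Real.cos (2 * Real.pi * j.val / N) : ℝ) : ℂ) *
      Complex.exp (((levelMomentum 1 N - levelMomentum 0 N : ℝ) : ℂ) * j * Complex.I) =
      D / 2 + D / 2 * Complex.exp (((2 * (2 : ℤ) * Real.pi / N : ℝ) : ℂ) * j * Complex.I) := by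
    intro j
    set z := Complex.exp (2 * Real.pi * j / N * Complex.I) with hz
    have e1 : Complex.exp (((levelMomentum 1 N - levelMomentum 0 N : ℝ) : ℂ) * j * Complex.I) =
        z := by
      rw [hz, levelMomentum, levelMomentum]
      congr 1
      push_cast
      field_simp
      ring
    have e2 : Complex.exp (((2 * (2 : ℤ) * Real.pi / N : ℝ) : ℂ) * j * Complex.I) = z * z := by
      rw [hz, ← Complex.exp_add]
      congr 1
      push_cast
      field_simp
      ring
    have e3 : ((Real.cos (2 * Real.pi * j.val / N) : ℝ) : ℂ) = (z + z⁻¹) / 2 := by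
      rw [Complex.ofReal_cos, Complex.cos, hz, ← Complex.exp_neg]
      push_cast
      rw [neg_mul]
    have hz0 : z ≠ 0 := Complex.exp_ne_zero _
    rw [Complex.ofReal_mul, e1, e2, e3]
    field_simp
    ring
  simp only [h1]
  rw [Finset.sum_add_distrib, ← Finset.mul_sum, sum_exp_int_mul_two_pi hN0]
  · simp
    ring
  · intro h2
    have := Int.le_of_dvd (by norm_num) h2
    omega

/-- The overlap of the Bogoliubov amplitudes of the two lowest levels. -/
noncomputable def overlapFactor (h : ℝ) (k l : ℝ) : ℝ :=
  ((dispersion h k + (h - Real.cos k)) * (dispersion h l + (h - Real.cos l)) -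
    Real.sin k * Real.sin l) /
  (√((dispersion h k + (h - Real.cos k)) ^ 2 + Real.sin k ^ 2) *
    √((dispersion h l + (h - Real.cos l)) ^ 2 + Real.sin l ^ 2))

theorem fieldPerturbation_matrixElement (hN : 2 < N) (D : ℝ) :
    star (mode h (levelMomentum 0 N) N) ⬝ᵥ (fieldPerturbation
      (fun j : Fin N => D * Real.cos (2 * Real.pi * j.val / N)) *ᵥ mode h (levelMomentum 1 N) N) =
      ((overlapFactor h (levelMomentum 0 N) (levelMomentum 1 N) * (D / 2) : ℝ) : ℂ) := by
  have h1 := star_mode_dotProduct (N := N) h (levelMomentum 0 N) (levelMomentum 1 N)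
    (fun j : Fin N => D * Real.cos (2 * Real.pi * j.val / N)) (-1)
  have h2 : fieldPerturbation (fun j : Fin N => D * Real.cos (2 * Real.pi * j.val / N)) =
      Matrix.diagonal (Sum.elim
        (fun j : Fin N => ((D * Real.cos (2 * Real.pi * j.val / N) : ℝ) : ℂ))
        fun j : Fin N => ((-1 * (D * Real.cos (2 * Real.pi * j.val / N)) : ℝ) : ℂ)) := by
    rw [fieldPerturbation]
    congr 2
    ext j
    push_cast
    ring
  rw [h2, h1, sum_cos_mul_exp hN, ← Complex.ofReal_mul]
  congr 1
  have hN0 : (0 : ℝ) < N := by exact_mod_cast (by omega : 0 < N)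
  rw [modeNormSq, modeNormSq, Real.sqrt_mul' _ hN0.le, Real.sqrt_mul' _ hN0.le, overlapFactor,
    mul_inv, mul_inv, div_eq_mul_inv (_ - _), mul_inv]
  have h3 : (√(N : ℝ))⁻¹ * (√(N : ℝ))⁻¹ * N = 1 := by
    rw [← mul_inv, Real.mul_self_sqrt hN0.le, inv_mul_cancel₀ hN0.ne']
  generalize (√(N : ℝ))⁻¹ = s at *
  generalize (√((dispersion h (levelMomentum 0 N) + (h - Real.cos (levelMomentum 0 N))) ^ 2 +
    Real.sin (levelMomentum 0 N) ^ 2))⁻¹ = u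
  generalize (√((dispersion h (levelMomentum 1 N) + (h - Real.cos (levelMomentum 1 N))) ^ 2 +
    Real.sin (levelMomentum 1 N) ^ 2))⁻¹ = v
  linear_combination (u * v * ((dispersion h (levelMomentum 0 N) +
    (h - Real.cos (levelMomentum 0 N))) * (dispersion h (levelMomentum 1 N) +
    (h - Real.cos (levelMomentum 1 N))) - Real.sin (levelMomentum 0 N) *
    Real.sin (levelMomentum 1 N)) * (D / 2)) * h3

/-- At zero momentum the hole amplitudes sin k vanish and both normalized modes are pure particles,
so the opposite sign of the field on holes is irrelevant in the limit. -/
theorem tendsto_overlapFactor (hh : 1 < h) (m n : ℕ) :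
    Tendsto (fun N => overlapFactor h (levelMomentum m N) (levelMomentum n N)) atTop (𝓝 1) := by
  have hpos : 0 < h - 1 := by linarith
  have h0 : overlapFactor h 0 0 = 1 := by
    rw [overlapFactor, dispersion_zero hh, Real.cos_zero, Real.sin_zero,
      Real.mul_self_sqrt (by positivity)]
    have : h - 1 + (h - 1) ≠ 0 := by positivity
    field_simp
    ring
  have hc : ContinuousAt (fun p : ℝ × ℝ => overlapFactor h p.1 p.2) (0, 0) := by
    have := continuous_dispersion h
    unfold overlapFactor
    refine ContinuousAt.div (by fun_prop) (by fun_prop) ?_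
    simp only [dispersion_zero hh, Real.cos_zero, Real.sin_zero]
    positivity
  have h1 := hc.tendsto.comp ((tendsto_levelMomentum m).prodMk_nhds (tendsto_levelMomentum n))
  rwa [h0] at h1

theorem isPerturbation_fieldPerturbation (δ : Fin N → ℝ) :
    IsPerturbation (fieldPerturbation δ) := by
  refine ⟨?_, Matrix.diagonal fun i => (δ i : ℂ), 0, ?_⟩
  · rw [Matrix.IsHermitian, fieldPerturbation, Matrix.diagonal_conjTranspose]
    congr 1
    ext (i | i) <;> simp
  · rw [conjMat_diagonal_real, fieldPerturbation, ← Matrix.fromBlocks_diagonal]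
    congr 1
    · ext; simp [conjMat_apply]
    · ext i j; by_cases hij : i = j <;> simp [hij]

theorem norm_fieldPerturbation_le {δ : Fin N → ℝ} {D : ℝ} (hD : 0 ≤ D) (hδ : ∀ i, |δ i| ≤ D) :
    ‖fieldPerturbation δ‖ ≤ D := by
  rw [fieldPerturbation, Matrix.l2_opNorm_diagonal, pi_norm_le_iff_of_nonneg hD]
  rintro (i | i) <;> simp [hδ i]

end Asymptotics

/-! ### New pairing entries of order one. -/

section NewEntries

variable {h : ℝ}

theorem eventually_lowest_levels (hh : 1 < h) :
    ∃ p e : ℝ, 0 < p ∧ 0 < e ∧ ∀ᶠ N : ℕ in atTop,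
      p * (N : ℝ) ^ 2 ≤ pairWeight h (dispersion h (levelMomentum 0 N)) -
        2 * pairWeight h (dispersion h (levelMomentum 1 N)) ∧
      |2 * dispersion h (levelMomentum 0 N) - 2 * dispersion h (levelMomentum 1 N)| ≤
        e / (N : ℝ) ^ 2 ∧
      1 / 2 ≤ overlapFactor h (levelMomentum 0 N) (levelMomentum 1 N) := by
  have hpos : 0 < h - 1 := by linarith
  have hpi := Real.pi_pos
  -- In units of this p the two weights divided by N² tend to 4 and 4/9, so the required difference
  -- tends to 4 - 8/9 = 28/9, safely above 1.
  set p := (h - 1) ^ 2 / (h * Real.pi) ^ 2 with hp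
  have hp0 : 0 < p := by positivity
  have h1 := (tendsto_pairWeight_div_sq hh 0).sub ((tendsto_pairWeight_div_sq hh 1).const_mul 2)
  have h2 := ((tendsto_sq_mul_dispersion_sub hh 0).sub
    (tendsto_sq_mul_dispersion_sub hh 1)).abs
  set L := |h * ((2 * ((0 : ℕ) : ℝ) + 1) * Real.pi) ^ 2 / (2 * (h - 1)) -
    h * ((2 * ((1 : ℕ) : ℝ) + 1) * Real.pi) ^ 2 / (2 * (h - 1))| with hL
  have hlim : p < 4 * (h - 1) ^ 2 / (h * ((2 * ((0 : ℕ) : ℝ) + 1) * Real.pi)) ^ 2 -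
      2 * (4 * (h - 1) ^ 2 / (h * ((2 * ((1 : ℕ) : ℝ) + 1) * Real.pi)) ^ 2) := by
    have : 4 * (h - 1) ^ 2 / (h * ((2 * ((0 : ℕ) : ℝ) + 1) * Real.pi)) ^ 2 -
      2 * (4 * (h - 1) ^ 2 / (h * ((2 * ((1 : ℕ) : ℝ) + 1) * Real.pi)) ^ 2) = 28 / 9 * p := by
      rw [hp]
      push_cast
      field_simp
      ring
    linarith
  refine ⟨p, 2 * (L + 1), hp0, by positivity, ?_⟩
  filter_upwards [h1.eventually_const_lt hlim, h2.eventually_lt_const (lt_add_one L),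
    (tendsto_overlapFactor hh 0 1).eventually_const_lt (by norm_num : (1 / 2 : ℝ) < 1),
    eventually_gt_atTop 0] with N a1 a2 a3 a4
  have hN : (0 : ℝ) < (N : ℝ) ^ 2 := by positivity
  refine ⟨?_, ?_, a3.le⟩
  · rw [mul_div_assoc', ← sub_div, lt_div_iff₀ hN] at a1
    exact a1.le
  · rw [le_div_iff₀ hN]
    have e : |2 * dispersion h (levelMomentum 0 N) - 2 * dispersion h (levelMomentum 1 N)| *
        (N : ℝ) ^ 2 = 2 * |(N : ℝ) ^ 2 * (dispersion h (levelMomentum 0 N) - (h - 1)) -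
          (N : ℝ) ^ 2 * (dispersion h (levelMomentum 1 N) - (h - 1))| := by
      rw [← mul_sub, abs_mul, abs_two, ← mul_sub, sub_sub_sub_cancel_right, abs_mul, abs_of_pos hN]
      ring
    rw [e]
    linarith

theorem exists_new_entries (hh : 1 < h) :
    ∃ κ : ℝ, 0 < κ ∧ ∀ c₁ c₂ : ℝ, 0 < c₁ → c₁ ≤ c₂ → ∀ᶠ N : ℕ in atTop,
      ∀ D : ℝ, c₁ / (N : ℝ) ^ 3 ≤ D → D ≤ c₂ / (N : ℝ) ^ 3 →
        ∀ E₀ U₀ E U E' U', Diagonalizes (isingMatrix (fun _ : Fin N => 0)) E₀ U₀ →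
          Diagonalizes (isingMatrix (fun _ : Fin N => h)) E U →
          Diagonalizes (isingMatrix (fun _ : Fin N => h) + fieldPerturbation
            (fun j : Fin N => D * Real.cos (2 * Real.pi * j.val / N))) E' U' →
          ∃ α β : Fin N, N ≤ α.val + 2 ∧ N ≤ β.val + 4 ∧
            bcsMatrix U₀ U α β = 0 ∧ κ * D * (N : ℝ) ^ 3 ≤ ‖bcsMatrix U₀ U' α β‖ := by
  obtain ⟨p, e, hp, he, hev⟩ := eventually_lowest_levels hh
  -- Solves (2κDN³)²·4(e/N²)² = pN²(D/4)². The first-order shift is then at least 2κDN³, and half of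
  -- it is left for the remainder.
  set κ := √p / (16 * e) with hκ
  have hsp : 0 < √p := Real.sqrt_pos.2 hp
  have hκ0 : 0 < κ := by positivity
  refine ⟨κ, hκ0, fun c₁ c₂ hc₁ hc => ?_⟩
  obtain ⟨C, hC, key⟩ := exists_adapted_pairing hh (hc₁.trans_le hc)
  have hr : Tendsto (fun N : ℕ => C / √N) atTop (𝓝 0) :=
    (Real.tendsto_sqrt_atTop.comp tendsto_natCast_atTop_atTop).const_div_atTop C
  filter_upwards [hev, hr.eventually_le_const (by positivity : 0 < κ * c₁), eventually_ge_atTop 4,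
    tendsto_natCast_atTop_atTop.eventually_ge_atTop C] with N h1 h2 h3 h4
  obtain ⟨hpw, hgap, hov⟩ := h1
  intro D hD1 hD2 E₀ U₀ E U₁ E' U' h₀ hU₁ hU'
  have hN : (0 : ℝ) < N := by exact_mod_cast (by omega : 0 < N)
  have hD : 0 < D := lt_of_lt_of_le (by positivity) hD1
  have hE := hU₁.energy_eq hh
  subst hE
  set V := fieldPerturbation (fun j : Fin N => D * Real.cos (2 * Real.pi * j.val / N)) with hV
  have hVn : ‖V‖ ≤ D := norm_fieldPerturbation_le hD.le fun i => by
    rw [abs_mul, abs_of_pos hD]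
    exact mul_le_of_le_one_right hD.le (Real.abs_cos_le_one _)
  -- The adapted U need not be the given diagonalization `U₁`. This is harmless: the perturbed
  -- pairing matrix does not involve the clean basis, and the clean entry between different levels
  -- vanishes in both bases.
  obtain ⟨U, hU, -, hG⟩ := key N V E' U' h4 (isPerturbation_fieldPerturbation _).1
    (hVn.trans hD2) hU'
  obtain ⟨-, hΔ⟩ := hG E₀ U₀ h₀
  have hlev : ∀ α : Fin N, cleanEnergy h α = 2 * dispersion h (levelMomentum (level α) N) :=
    fun α => rfl
  have hlev2 : ∀ α : Fin N, cleanEnergy h α / 2 = dispersion h (levelMomentum (level α) N) :=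
    fun α => by rw [hlev]; ring
  have hα₀ : level (⟨N - 1, by omega⟩ : Fin N) = 0 := by
    unfold level; dsimp only; omega
  have hβ₀ : level (⟨N - 3, by omega⟩ : Fin N) = 1 := by
    unfold level; dsimp only; omega
  have hN0 : N ≠ 0 := by omega
  have hM : (D / 4) ^ 2 ≤
      ∑ α, ∑ β, ‖levelBlock 0 1 (U * V * U⁻¹).toBlocks₁₁ α β‖ ^ 2 := by
    have h5 := sq_norm_matrixElement_le (V := V) hh hU (γ := ⟨N - 1, by omega⟩)
      (δ := ⟨N - 3, by omega⟩)
      (x := mode h (levelMomentum 0 N) N) (y := mode h (levelMomentum 1 N) N)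
      (by rw [hlev2, hα₀]; exact isingMatrix_mulVec_mode h (exp_levelMomentum 0 hN0))
      (by rw [hlev2, hβ₀]; exact isingMatrix_mulVec_mode h (exp_levelMomentum 1 hN0))
      (star_mode_dotProduct_self hh _ (by omega)) (star_mode_dotProduct_self hh _ (by omega))
    rw [hα₀, hβ₀, fieldPerturbation_matrixElement (by omega), Complex.norm_real,
      Real.norm_eq_abs, sq_abs] at h5
    refine le_trans ?_ h5
    gcongr
    nlinarith
  obtain ⟨α, β, hα, hβ, hT⟩ := exists_large_pairingShift (V := V) hh h₀ hU zero_ne_one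
    (e := e / (N : ℝ) ^ 2) (M := (D / 4) ^ 2)
    (p := pairWeight h (dispersion h (levelMomentum 0 N)))
    (p' := pairWeight h (dispersion h (levelMomentum 1 N)))
    (by positivity) (by nlinarith [mul_pos hp (pow_pos hN 2)])
    (fun α hα => by rw [hlev2, hα]) (fun β hβ => by rw [hlev2, hβ])
    (fun α β hα hβ => by rw [hlev, hlev, hα, hβ]; exact hgap) hM
  have hne : level α ≠ level β := by rw [hα, hβ]; exact zero_ne_one
  refine ⟨α, β, ?_, ?_, clean_bcsMatrix_eq_zero_of_level_ne hh h₀ hU₁ hne, ?_⟩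
  · unfold level at hα; omega
  · unfold level at hβ; omega
  have hTbound : 2 * (κ * D * (N : ℝ) ^ 3) ≤ ‖pairingShift (cleanEnergy h) U₀ U V α β‖ := by
    refine le_of_sq_le_sq ?_ (norm_nonneg _)
    have h5 : p * (N : ℝ) ^ 2 * (D / 4) ^ 2 ≤
        4 * (e / (N : ℝ) ^ 2) ^ 2 * ‖pairingShift (cleanEnergy h) U₀ U V α β‖ ^ 2 :=
      le_trans (by gcongr) hT
    have h6 : (2 * (κ * D * (N : ℝ) ^ 3)) ^ 2 * (4 * (e / (N : ℝ) ^ 2) ^ 2) =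
        p * (N : ℝ) ^ 2 * (D / 4) ^ 2 := by
      have hsq := Real.sq_sqrt hp.le
      rw [hκ]
      field_simp
      rw [hsq]
      ring
    rw [← h6, mul_comm] at h5
    exact le_of_mul_le_mul_left h5 (by positivity)
  have h7 := (norm_entry_le _ α β).trans hΔ
  rw [Matrix.sub_apply, Matrix.sub_apply, clean_bcsMatrix_eq_zero_of_level_ne hh h₀ hU hne,
    sub_zero, norm_sub_rev] at h7
  have h8 := norm_sub_norm_le (pairingShift (cleanEnergy h) U₀ U V α β) (bcsMatrix U₀ U' α β)
  -- The lower bound on D is used here: for large N the remainder C/√N is below κc₁, hence below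
  -- half of the first-order shift.
  have h9 : κ * c₁ ≤ κ * D * (N : ℝ) ^ 3 := by
    rw [div_le_iff₀ (by positivity)] at hD1
    rw [mul_assoc]
    gcongr
  linarith

end NewEntries

end IsingQuench

open IsingQuench in
theorem theorem1 (h : ℝ) (hh : 1 < h) :
    (∀ c : ℝ, 0 < c → ∃ (C : ℝ) (r : ℕ → ℝ) (K : ℝ → ℕ), Tendsto r atTop (𝓝 0) ∧
      ∀ᶠ N : ℕ in atTop, ∀ V : Matrix (Nambu N) (Nambu N) ℂ, IsPerturbation V →
        ‖V‖ / ‖isingMatrix (fun _ : Fin N => h)‖ ≤ c / (N : ℝ) ^ 3 →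
        (∃ E₀ U₀, Diagonalizes (isingMatrix (fun _ : Fin N => 0)) E₀ U₀) ∧
        (∃ E' U', Diagonalizes (isingMatrix (fun _ : Fin N => h) + V) E' U') ∧
        ∀ E' U', Diagonalizes (isingMatrix (fun _ : Fin N => h) + V) E' U' →
          ∃ E U, Diagonalizes (isingMatrix (fun _ : Fin N => h)) E U ∧
            ‖U' * U⁻¹ - 1‖ ≤ r N ∧
            (∀ α, |E' α - E α| ≤ r N) ∧
            ∀ E₀ U₀, Diagonalizes (isingMatrix (fun _ : Fin N => 0)) E₀ U₀ →
              IsUnit (blockW₁ U₀ U) ∧ Thouless U₀ U (bcsMatrix U₀ U) ∧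
              IsUnit (blockW₁ U₀ U') ∧ Thouless U₀ U' (bcsMatrix U₀ U') ∧
              (∀ α β, ‖(bcsMatrix U₀ U' - bcsMatrix U₀ U
                  - (mixing E U V * bcsMatrix U₀ U
                      - bcsMatrix U₀ U * conjMat (mixing E U V))) α β‖ ≤ r N) ∧
              (∀ α β, bcsMatrix U₀ U α β ≠ 0 →
                ‖bcsMatrix U₀ U' α β - bcsMatrix U₀ U α β‖ ≤ r N) ∧
              (∀ α β, ‖bcsMatrix U₀ U' α β - bcsMatrix U₀ U α β‖ ≤ C) ∧
              (∀ ε : ℝ, 0 < ε → ∀ α β,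
                ε ≤ ‖bcsMatrix U₀ U' α β - bcsMatrix U₀ U α β‖ →
                (∀ γ, E α ≤ E γ + K ε / (N : ℝ) ^ 2 ∧ E β ≤ E γ + K ε / (N : ℝ) ^ 2) ∧
                N ≤ α.val + K ε ∧ N ≤ β.val + K ε)) ∧
    (∃ κ : ℝ, 0 < κ ∧ ∀ c₁ c₂ : ℝ, 0 < c₁ → c₁ ≤ c₂ → ∀ᶠ N : ℕ in atTop,
      ∀ D : ℝ, c₁ / (N : ℝ) ^ 3 ≤ D → D ≤ c₂ / (N : ℝ) ^ 3 →
        ∀ E₀ U₀ E U E' U', Diagonalizes (isingMatrix (fun _ : Fin N => 0)) E₀ U₀ →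
          Diagonalizes (isingMatrix (fun _ : Fin N => h)) E U →
          Diagonalizes (isingMatrix (fun _ : Fin N => h) + fieldPerturbation
            (fun j : Fin N => D * Real.cos (2 * Real.pi * j.val / N))) E' U' →
          ∃ α β : Fin N, N ≤ α.val + 2 ∧ N ≤ β.val + 4 ∧
            bcsMatrix U₀ U α β = 0 ∧ κ * D * (N : ℝ) ^ 3 ≤ ‖bcsMatrix U₀ U' α β‖) := by
  exact ⟨fun c hc => robustness_of_quasiparticles hh c hc, exists_new_entries hh⟩
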